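/- **Theorem 2.2.** Fix $p>0$. Write $\|\cdot\|$ for the norm of $L^2(0,1)$ and $\phi_n(x)=\sqrt2\sin(n\pi x)$. *Nominal feedback.* Let $\theta\mapsto N(\theta)\in\{1,2,\dots\}$ and $\theta\mapsto(k_1(\theta),\dots,k_{N(\theta)}(\theta))\in\mathbb R^{N(\theta)}$ be maps on $\mathbb R$, put $k(\theta,x)=\sum_{n=1}^{N(\theta)}k_n(\theta)\phi_n(x)$, and let $R_\theta,\omega_\theta>0$ $(\theta\in\mathbb R)$ be constants such that for all $\theta\in\mathbb R$ and $u_0\in L^2(0,1)$ the problem $$u_t=pu_{xx}+\theta u\ (t>0,\ 0<x<1),\quad u(t,0)=0,\quad u(t,1)=\int_0^1k(\theta,x)u(t,x)\,dx\ (t>0),\quad u[0]=u_0$$ has a unique solution $u\in C^0(\mathbb R_+;L^2(0,1))\cap C^1((0,\infty)\times[0,1])$ with $u[t]\in C^2([0,1])$ for $t>0$, and this solution satisfies $$\|u[t]\|\le R_\theta e^{-\omega_\theta t}\|u_0\|,\qquad t\ge0.\tag{2.7}$$ *Adaptive closed loop.* Let $T,a>0$ and let $\tilde N\ge1$ be an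 integer. Given $\theta\in\mathbb R$, $c>0$, $u_0\in L^2(0,1)$, $\hat\theta_0\in\mathbb R$ and $\hat c_0>0$, a solution of the closed loop consists of $u\in C^0(\mathbb R_+;L^2(0,1))$, functions $\hat\theta,\hat c,U:\mathbb R_+\to\mathbb R$ and event times $(\tau_i)_{i\ge0}$ such that, with $I=\mathbb R_+\setminus\{\tau_i:i\ge0\}$: 1. $u\in C^1(I\times[0,1])$ and $u[t]\in C^2([0,1])$ for $t>0$; $u_t=pu_{xx}+\theta u$ on $I\times(0,1)$; $u(t,0)=0$ and $u(t,1)=cU(t)$ for $t\in I$; and $u[0]=u_0$, $\hat\theta(0)=\hat\theta_0$, $\hat c(0)=\hat c_0$. 2. For $i\ge 0$ and $t\in[\tau_i,\tau_{i+1})$: $U(t)=\hat c(\tau_i)^{-1}\int_0^1k(\hat\theta(\tau_i),x)u(t,x)\,dx$, $\hat\theta(t)=\hat\theta(\tau_i)$ and $\hat c(t)=\hat c(\tau_i)$. 3. $\tau_0=0$ and $\tau_{i+1}=\min(\tau_i+T,r_i)$ for $i\ge0$, where $r_i=\inf\{t>\tau_i:\|u[t]\|=R_{\hat\theta(\tau_i)}(1+a)\|u[\tau_i]\|\}$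 if $u[\tau_i]\ne0$ (with $\inf\emptyset=+\infty$), and $r_i=\tau_i+T$ if $u[\tau_i]=0$. 4. For $i\ge0$, $(\hat\theta(\tau_{i+1}),\hat c(\tau_{i+1}))$ is the Euclidean projection of $(\hat\theta(\tau_i),\hat c(\tau_i))$ on the set $S_i$ of all $(\vartheta_1,\vartheta_2)\in\mathbb R^2$ that satisfy, for all $n\ge1$, the normal equations $$\langle f_n,g_n\rangle_i=\vartheta_1\langle g_n,g_n\rangle_i+\vartheta_2\langle g_n,j_n\rangle_i,\qquad \langle f_n,j_n\rangle_i=\vartheta_1\langle g_n,j_n\rangle_i+\vartheta_2\langle j_n,j_n\rangle_i .$$ Here $\langle f,g\rangle_i=\int_{\mu_{i+1}}^{\tau_{i+1}}\int_{\mu_{i+1}}^{\tau_{i+1}}f(t,s)g(t,s)\,ds\,dt$, $\mu_{i+1}=\min\{\tau_j:0\le j\le i,\ \tau_j\ge\tau_{i+1}-\tilde NT\}$, and $$g_n(t,s)=\int_s^t\!\int_0^1\sin(n\pi x)u(\sigma,x)\,dx\,d\sigma,\qquad j_n(t,s)=-(-1)^npn\pi\int_s^tU(\sigma)\,d\sigma,$$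 $$f_n(t,s)=\int_0^1\sin(n\pi x)\,(u(t,x)-u(s,x))\,dx+n^2\pi^2p\,g_n(t,s).$$ *Claim.* There are constants $M_{\theta,\hat\theta,c,\hat c}>0$ $(\theta,\hat\theta\in\mathbb R,\ c,\hat c>0)$, independent of $u_0$, such that for all $\theta\in\mathbb R$, $c>0$, $\hat\theta_0\in\mathbb R$, $\hat c_0>0$ and $u_0\in L^2(0,1)$ the closed loop has a unique solution. There is no Zeno behavior: $\tau_i\to+\infty$. Moreover, the state decays at the nominal rate $\omega_\theta$ of (2.7): $$\|u[t]\|\le M_{\theta,\hat\theta_0,c,\hat c_0}\,e^{-\omega_\theta t}\|u_0\|\qquad\text{for all }t\ge0.$$ Finally, if $u_0\ne0$ then $\hat\theta(t)=\theta$ for all $t\ge\tau_1$; and if $U(t)\ne0$ for some $t\ge0$ then $\hat c(t)=c$ for all $t\ge\tau_2$. -/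

import Mathlib

open MeasureTheory Set Filter Topology

noncomputable section

namespace AdaptiveHeat

/-- The real Hilbert space `L²(0,1)` of classes of square-integrable functions. -/
abbrev L2 : Type := Lp ℝ 2 (volume.restrict (Ioo (0 : ℝ) 1))

/-- `∫₀¹ f(x) w(x) dx` for `w ∈ L²(0,1)`. -/
def pair (f : ℝ → ℝ) (w : L2) : ℝ := ∫ x in Ioo (0 : ℝ) 1, f x * w x

/-- `φ_n(x) = √2 sin(nπx)`. -/
def sineMode (n : ℕ) (x : ℝ) : ℝ := Real.sqrt 2 * Real.sin (n * Real.pi * x)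

/-- The maps `θ ↦ N(θ)` and `θ ↦ (k_1(θ), …, k_{N(θ)}(θ))`; the values `coeff θ n` with `n`
outside `{1, …, N(θ)}` are never used. -/
structure FeedbackGains where
  N : ℝ → ℕ
  coeff : ℝ → ℕ → ℝ

/-- `k(θ, x) = ∑_{n=1}^{N(θ)} k_n(θ) φ_n(x)`. -/
def FeedbackGains.kernel (K : FeedbackGains) (θ x : ℝ) : ℝ :=
  ∑ n ∈ Finset.Icc 1 (K.N θ), K.coeff θ n * sineMode n x

/-- The `L²`-valued map `u` has, for positive times, a pointwise version `v(t,x)` on `[0,1]` with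
`v(t,·) ∈ C²([0,1])` for all `t > 0` and `v ∈ C¹(J × [0,1])`, such that
`v_t = p v_xx + θ v` on `J × (0,1)`, `v(t,0) = 0` and `v(t,1) = b(t)` for `t ∈ J`.
(The version is unique, since it is continuous in `x`.) -/
def IsClassicalOn (p θ : ℝ) (J : Set ℝ) (b : ℝ → ℝ) (u : ℝ → L2) : Prop :=
  ∃ v : ℝ → ℝ → ℝ,
    (∀ t, 0 < t → (u t : ℝ → ℝ) =ᵐ[volume.restrict (Ioo (0 : ℝ) 1)] v t) ∧
    (∀ t, 0 < t → ContDiffOn ℝ 2 (v t) (Icc 0 1)) ∧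
    ContDiffOn ℝ 1 (fun q : ℝ × ℝ => v q.1 q.2) (J ×ˢ Icc (0 : ℝ) 1) ∧
    (∀ t ∈ J, ∀ x ∈ Ioo (0 : ℝ) 1,
      deriv (fun s => v s x) t = p * iteratedDeriv 2 (v t) x + θ * v t x) ∧
    (∀ t ∈ J, v t 0 = 0 ∧ v t 1 = b t)

/-- Solutions of the nominal closed loop `u_t = p u_xx + θ u`, `u(t,0) = 0`, `u(t,1) = c U(t)`,
`U(t) = c⁻¹ ∫₀¹ k(x) u(t,x) dx`, `u[0] = u₀`. The nonzero constant `c` cancels. -/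
def IsNominalSolution (p θ : ℝ) (k : ℝ → ℝ) (u₀ : L2) (u : ℝ → L2) : Prop :=
  ContinuousOn u (Ici 0) ∧ u 0 = u₀ ∧
    IsClassicalOn p θ (Ioi 0) (fun t => pair k (u t)) u

/-- `K` is a nominal feedback with overshoot coefficients `R θ` and decay rates `ω θ`: for every
`θ` and every initial state the nominal closed loop has a unique solution on `[0, ∞)`, and it
satisfies `‖u[t]‖ ≤ R_θ exp(-ω_θ t) ‖u₀‖`. -/
def IsNominalFeedback (p : ℝ) (K : FeedbackGains) (R ω : ℝ → ℝ) : Prop :=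
  ∀ θ : ℝ, 1 ≤ K.N θ ∧ 0 < R θ ∧ 0 < ω θ ∧
    ∀ u₀ : L2, ∃ u : ℝ → L2, IsNominalSolution p θ (K.kernel θ) u₀ u ∧
      (∀ w : ℝ → L2, IsNominalSolution p θ (K.kernel θ) u₀ w → EqOn w u (Ici 0)) ∧
      ∀ t, 0 ≤ t → ‖u t‖ ≤ R θ * Real.exp (-(ω θ) * t) * ‖u₀‖

/-! The regressors of the least-squares identifier, for a state trajectory `u` and an input `U`. -/

/-- `f_n(t,s) = ∫₀¹ sin(nπx)(u(t,x) - u(s,x)) dx + n²π²p ∫_s^t ∫₀¹ sin(nπx) u(σ,x) dx dσ`. -/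
def regF (p : ℝ) (u : ℝ → L2) (n : ℕ) (t s : ℝ) : ℝ :=
  pair (fun x => Real.sin (n * Real.pi * x)) (u t - u s) +
    (n : ℝ) ^ 2 * Real.pi ^ 2 * p *
      ∫ σ in s..t, pair (fun x => Real.sin (n * Real.pi * x)) (u σ)

/-- `g_n(t,s) = ∫_s^t ∫₀¹ sin(nπx) u(σ,x) dx dσ`. -/
def regG (u : ℝ → L2) (n : ℕ) (t s : ℝ) : ℝ :=
  ∫ σ in s..t, pair (fun x => Real.sin (n * Real.pi * x)) (u σ)

/-- `j_n(t,s) = -(-1)^n p n π ∫_s^t U(σ) dσ`. -/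
def regJ (p : ℝ) (U : ℝ → ℝ) (n : ℕ) (t s : ℝ) : ℝ :=
  -(-1 : ℝ) ^ n * p * n * Real.pi * ∫ σ in s..t, U σ

/-- `∫_μ^τ ∫_μ^τ f(t,s) g(t,s) ds dt`. -/
def gram (μ τ : ℝ) (f g : ℝ → ℝ → ℝ) : ℝ := ∫ t in μ..τ, ∫ s in μ..τ, f t s * g t s

/-- The set of parameters `(ϑ₁, ϑ₂) ∈ ℝ²` that satisfy, for all `n = 1, 2, …`, the normal equations
of the least-squares problem `∫∫ (f_n - ϑ₁ g_n - ϑ₂ j_n)² → min` on the window `[μ, τ]`. -/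
def estimateSet (p : ℝ) (u : ℝ → L2) (U : ℝ → ℝ) (μ τ : ℝ) : Set (EuclideanSpace ℝ (Fin 2)) :=
  {q | ∀ n : ℕ, 1 ≤ n →
    gram μ τ (regF p u n) (regG u n) =
        q 0 * gram μ τ (regG u n) (regG u n) + q 1 * gram μ τ (regG u n) (regJ p U n) ∧
    gram μ τ (regF p u n) (regJ p U n) =
        q 0 * gram μ τ (regG u n) (regJ p U n) + q 1 * gram μ τ (regJ p U n) (regJ p U n)}

/-- `q` is a (metric) projection of `x` on `S`: a point of `S` at least distance from `x`. -/
def IsProj (S : Set (EuclideanSpace ℝ (Fin 2))) (x q : EuclideanSpace ℝ (Fin 2)) : Prop :=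
  q ∈ S ∧ ∀ y ∈ S, dist x q ≤ dist x y

/-- A hybrid trajectory: state, parameter estimates, control input and event times. Only the
values at times `t ≥ 0` are meaningful. -/
structure Trajectory where
  u : ℝ → L2
  thetaHat : ℝ → ℝ
  cHat : ℝ → ℝ
  U : ℝ → ℝ
  τ : ℕ → ℝ

/-- The time `r_i` determined by the event trigger, with the convention `inf ∅ = +∞`. -/
def triggerTime (R : ℝ → ℝ) (T a : ℝ) (z : Trajectory) (i : ℕ) : EReal :=
  open Classical in
  if z.u (z.τ i) = 0 then ((z.τ i + T : ℝ) : EReal)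
  else sInf ((fun t : ℝ => (t : EReal)) ''
    {t : ℝ | z.τ i < t ∧ ‖z.u t‖ = R (z.thetaHat (z.τ i)) * (1 + a) * ‖z.u (z.τ i)‖})

/-- `z` is a solution on `[0, ∞)` of the closed loop formed by the plant with parameters `p, θ, c`
and the certainty-equivalence controller with regulation-triggered least-squares identification
(design data `K`, `R`, `T`, `a`, `Ntilde`), with initial data `u₀`, `θ₀`, `c₀`. -/
structure IsSolution (p θ c : ℝ) (K : FeedbackGains) (R : ℝ → ℝ) (T a : ℝ) (Ntilde : ℕ)
    (u₀ : L2) (θ₀ c₀ : ℝ) (z : Trajectory) : Prop where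
  state_continuous : ContinuousOn z.u (Ici 0)
  /-- The plant, on `[0, ∞)` without the event times. -/
  plant : IsClassicalOn p θ (Ici 0 \ range z.τ) (fun t => c * z.U t) z.u
  state_init : z.u 0 = u₀
  thetaHat_init : z.thetaHat 0 = θ₀
  cHat_init : z.cHat 0 = c₀
  /-- The certainty-equivalence controller. -/
  control : ∀ i, ∀ t ∈ Ico (z.τ i) (z.τ (i + 1)),
    z.U t = (z.cHat (z.τ i))⁻¹ * pair (K.kernel (z.thetaHat (z.τ i))) (z.u t)
  /-- The estimates are constant between events. -/
  estimates_const : ∀ i, ∀ t ∈ Ico (z.τ i) (z.τ (i + 1)),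
    z.thetaHat t = z.thetaHat (z.τ i) ∧ z.cHat t = z.cHat (z.τ i)
  event_zero : z.τ 0 = 0
  /-- `τ_{i+1} = min(τ_i + T, r_i)`. -/
  event_succ : ∀ i, ((z.τ (i + 1) : ℝ) : EReal) =
    min ((z.τ i + T : ℝ) : EReal) (triggerTime R T a z i)
  /-- The parameter update, with the window start
  `μ_{i+1} = min {τ_j : j ≤ i, τ_j ≥ τ_{i+1} - Ntilde T}`. -/
  update : ∀ i, ∃ μ : ℝ,
    IsLeast {s : ℝ | ∃ j ≤ i, z.τ j = s ∧ z.τ (i + 1) - Ntilde * T ≤ s} μ ∧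
    IsProj (estimateSet p z.u z.U μ (z.τ (i + 1)))
      !₂[z.thetaHat (z.τ i), z.cHat (z.τ i)]
      !₂[z.thetaHat (z.τ (i + 1)), z.cHat (z.τ (i + 1))]

/-- Two trajectories coincide: same event times, and same values at all times `t ≥ 0`. -/
def Trajectory.Same (z z' : Trajectory) : Prop :=
  z.τ = z'.τ ∧ EqOn z.u z'.u (Ici 0) ∧ EqOn z.thetaHat z'.thetaHat (Ici 0) ∧
    EqOn z.cHat z'.cHat (Ici 0) ∧ EqOn z.U z'.U (Ici 0)

end AdaptiveHeat

end

noncomputable section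

namespace AdaptiveHeat

/-! ### The sine system in `L²(0,1)` -/

/-! Testing the plant with `sin(nπx)` gives, for every mode, the scalar equation `y_n' = (θ - p
n²π²) y_n - p (-1)^n nπ c U`. Two facts follow.

Well-posedness: the kernel is a finite sine sum, so the input sees finitely many modes. These form a
closed linear ODE system, and every other mode is a scalar ODE driven by the resulting boundary
value. Uniqueness is Grönwall on the low modes and then on each mode (`eqOn_of_isClassicalOn`). For
existence the low modes are solved first by a matrix exponential; they prescribe a smooth boundary
value, and the heat equation with that boundary value is solved by a polynomial lift plus a sine
series (`exists_feedback_solution`).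

Identification: the integrated modal equation is the exact identity `f_n = θ g_n + c j_n`. Hence
`(ϑ₁, ϑ₂)` satisfies the normal equations iff `(ϑ₁ - θ) g_n + (ϑ₂ - c) j_n` vanishes on the window
for all `n`. Differentiating gives `|ϑ₁ - θ| |y_n(t)| = n |γ(t)|` with `γ` independent of `n`. Sine
coefficients of an `L²` function tend to zero, so `γ = 0`, and `ϑ₁ = θ` as soon as the state is
nonzero somewhere in the window; then `ϑ₂ = c` as soon as the input is nonzero there. What is not
identified is kept by the projection (`IsPlantTrajectory.isProj`).

Thus for `u₀ ≠ 0` the estimate of `θ` is exact from the first event on. If the input is nonzero at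
some time before the second event, `c` is exact from the second event on. Otherwise the input
vanishes on the second phase, where it is an exponential sum; analyticity keeps it zero after the
restart with the same estimates (`IsPhase.pair_eq_zero`), and the value of the estimate of `c` is
irrelevant. In both cases the loop is nominal after the second event. The nominal bound lies
strictly below the trigger threshold, so from then on events come only by timeout, every `T`: no
Zeno behavior. The second event comes before `2T`, and the trigger bounds the growth until then.

Uniqueness goes event by event: the state up to an event determines the event time, and a projection
on a set closed under midpoints is unique (`IsSolution.agree`). -/

theorem memLp_of_continuous {f : ℝ → ℝ} (hf : Continuous f) :
    MemLp f 2 (volume.restrict (Ioo (0 : ℝ) 1)) := by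
  obtain ⟨C, hC⟩ := (isCompact_Icc (a := (0 : ℝ)) (b := 1)).exists_bound_of_continuousOn
    hf.continuousOn
  refine MemLp.of_bound hf.aestronglyMeasurable C ?_
  filter_upwards [ae_restrict_mem measurableSet_Ioo] with x hx
  exact hC x (Ioo_subset_Icc_self hx)

/-- The class in `L²(0,1)` of a continuous function. -/
def ofCont (f : ℝ → ℝ) (hf : Continuous f) : L2 := (memLp_of_continuous hf).toLp f

theorem coeFn_ofCont (f : ℝ → ℝ) (hf : Continuous f) :
    (ofCont f hf : ℝ → ℝ) =ᵐ[volume.restrict (Ioo (0 : ℝ) 1)] f :=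
  (memLp_of_continuous hf).coeFn_toLp

theorem pair_eq_inner {f : ℝ → ℝ} (hf : Continuous f) (w : L2) :
    pair f w = inner ℝ (ofCont f hf) w := by
  rw [MeasureTheory.L2.inner_def, pair]
  refine integral_congr_ae ?_
  filter_upwards [coeFn_ofCont f hf] with x hx
  simp [hx, mul_comm]

theorem pair_congr {f g : ℝ → ℝ} {w : L2}
    (h : (w : ℝ → ℝ) =ᵐ[volume.restrict (Ioo (0 : ℝ) 1)] g) :
    pair f w = ∫ x in (0 : ℝ)..1, f x * g x := by
  rw [pair, intervalIntegral.integral_of_le zero_le_one, integral_Ioc_eq_integral_Ioo]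
  refine integral_congr_ae ?_
  filter_upwards [h] with x hx
  rw [hx]

/-- The unnormalised sine mode `sin(nπx)`. -/
def sinMode (n : ℕ) (x : ℝ) : ℝ := Real.sin (n * Real.pi * x)

theorem continuous_sinMode (n : ℕ) : Continuous (sinMode n) := by
  unfold sinMode; fun_prop

/-- The class of `sin(nπx)` in `L²(0,1)`. -/
def sinL (n : ℕ) : L2 := ofCont (sinMode n) (continuous_sinMode n)

/-- The sine coefficient `∫₀¹ sin(nπx) w(x) dx`. -/
def coef (n : ℕ) (w : L2) : ℝ := pair (sinMode n) w

theorem coef_eq_inner (n : ℕ) (w : L2) : coef n w = inner ℝ (sinL n) w :=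
  pair_eq_inner (continuous_sinMode n) w

theorem integral_cos_int_mul_pi (k : ℤ) (hk : k ≠ 0) :
    ∫ x in (0 : ℝ)..1, Real.cos (k * Real.pi * x) = 0 := by
  have hk' : (k * Real.pi : ℝ) ≠ 0 := mul_ne_zero (by exact_mod_cast hk) Real.pi_ne_zero
  rw [intervalIntegral.integral_comp_mul_left (fun x => Real.cos x) hk']
  simp [Real.sin_int_mul_pi]

theorem integral_sinMode_mul (m n : ℕ) (hm : 1 ≤ m) (hn : 1 ≤ n) :
    ∫ x in (0 : ℝ)..1, sinMode m x * sinMode n x = if m = n then 1 / 2 else 0 := by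
  have key : ∀ x : ℝ, sinMode m x * sinMode n x =
      1 / 2 * Real.cos (((m : ℤ) - (n : ℤ) : ℤ) * Real.pi * x)
        - 1 / 2 * Real.cos (((m : ℤ) + (n : ℤ) : ℤ) * Real.pi * x) := by
    intro x
    have h1 : (((m : ℤ) - (n : ℤ) : ℤ) : ℝ) * Real.pi * x = m * Real.pi * x - n * Real.pi * x := by
      push_cast; ring
    have h2 : (((m : ℤ) + (n : ℤ) : ℤ) : ℝ) * Real.pi * x = m * Real.pi * x + n * Real.pi * x := by
      push_cast; ring
    rw [h1, h2, Real.cos_sub, Real.cos_add, sinMode, sinMode]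
    ring
  simp_rw [key]
  rw [intervalIntegral.integral_sub (by apply Continuous.intervalIntegrable; fun_prop)
    (by apply Continuous.intervalIntegrable; fun_prop),
    intervalIntegral.integral_const_mul, intervalIntegral.integral_const_mul,
    integral_cos_int_mul_pi ((m : ℤ) + (n : ℤ)) (by omega)]
  split_ifs with h
  · subst h; simp
  · rw [integral_cos_int_mul_pi _ (by omega)]; simp

theorem coef_ofCont (n : ℕ) (f : ℝ → ℝ) (hf : Continuous f) :
    coef n (ofCont f hf) = ∫ x in (0 : ℝ)..1, sinMode n x * f x :=
  pair_congr (coeFn_ofCont f hf)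

theorem coef_sinL (m n : ℕ) (hm : 1 ≤ m) (hn : 1 ≤ n) :
    coef m (sinL n) = if m = n then 1 / 2 else 0 := by
  rw [sinL, coef_ofCont, integral_sinMode_mul m n hm hn]

/-- Completeness of the sines is inherited from the exponentials on `(-1,1)`: each Fourier
coefficient of the odd extension is a multiple of a sine coefficient, so Parseval makes its norm
zero. -/
theorem eq_zero_of_coef_eq_zero (w : L2) (hw : ∀ n, 1 ≤ n → coef n w = 0) : w = 0 := by
  -- the odd extension of `w` to `(-1,1)`
  set g : ℝ → ℝ := (Ioo (0 : ℝ) 1).indicator w with hg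
  have hgL : MemLp g 2 volume := (memLp_indicator_iff_restrict measurableSet_Ioo).2 (Lp.memLp w)
  have hgL' : MemLp (fun x => g (-x)) 2 volume :=
    hgL.comp_measurePreserving (Measure.measurePreserving_neg volume)
  set f : ℝ → ℂ := fun x => ((g x - g (-x) : ℝ) : ℂ) with hf
  have hfL : MemLp f 2 volume := (hgL.sub hgL').ofReal
  have hab : (-1 : ℝ) < 1 := by norm_num
  have hcoef : ∀ n : ℤ, fourierCoeffOn hab f n = 0 := by
    intro n
    rw [fourierCoeffOn_eq_integral]
    have hgi : Integrable g volume := by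
      rw [hg, integrable_indicator_iff measurableSet_Ioo]
      exact (Lp.memLp w).integrable (by norm_num)
    have hsin : ∀ n : ℤ, ∫ x, Real.sin (n * Real.pi * x) * g x = 0 := by
      have hnat : ∀ n : ℕ, ∫ x, Real.sin (n * Real.pi * x) * g x = 0 := by
        intro n
        rcases Nat.eq_zero_or_pos n with rfl | hn
        · simp
        · rw [← hw n hn, coef, pair, ← integral_indicator measurableSet_Ioo]
          congr 1
          ext x
          by_cases hx : x ∈ Ioo (0 : ℝ) 1
          · simp only [hg, Set.indicator_of_mem hx, sinMode]
          · simp only [hg, Set.indicator_of_notMem hx, mul_zero]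
      intro n
      obtain ⟨m, rfl | rfl⟩ := n.eq_nat_or_neg
      · exact_mod_cast hnat m
      · have := hnat m
        simp only [Int.cast_neg, Int.cast_natCast, neg_mul, Real.sin_neg, integral_neg, this,
          neg_zero]
    have hcont : Continuous fun x : ℝ => fourier (-n) (x : AddCircle ((1 : ℝ) - -1)) := by
      exact (fourier (-n)).continuous.comp (AddCircle.continuous_mk' _)
    have hbd : ∀ x : ℝ, ‖fourier (-n) (x : AddCircle ((1 : ℝ) - -1))‖ ≤ 1 := by
      intro x
      rw [fourier_apply]; exact (Circle.norm_coe _).le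
    have hfull : ∫ x in (-1 : ℝ)..1, fourier (-n) (x : AddCircle ((1 : ℝ) - -1)) • f x
        = ∫ x : ℝ, fourier (-n) (x : AddCircle ((1 : ℝ) - -1)) • f x := by
      rw [intervalIntegral.integral_of_le hab.le, ← integral_indicator measurableSet_Ioc]
      congr 1
      ext x
      by_cases hx : x ∈ Ioc (-1 : ℝ) 1
      · simp [Set.indicator_of_mem hx]
      · rw [Set.indicator_of_notMem hx]
        have h1 : g x = 0 := Set.indicator_of_notMem (fun h => hx ⟨by linarith [h.1], h.2.le⟩) _
        have h2 : g (-x) = 0 := by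
          refine Set.indicator_of_notMem (fun h => hx ⟨?_, ?_⟩) _
          · linarith [h.2]
          · linarith [h.1]
        simp [hf, h1, h2]
    have hgC : Integrable (fun x => (g x : ℂ)) volume := hgi.ofReal
    have hgC' : Integrable (fun x => (g (-x) : ℂ)) volume := hgi.comp_neg.ofReal
    have hI : ∀ h : ℝ → ℂ, Continuous h → (∀ x, ‖h x‖ ≤ 1) →
        Integrable (fun x => h x * (g x : ℂ)) volume := fun h hc hb =>
      hgC.bdd_mul hc.aestronglyMeasurable (Eventually.of_forall hb)
    have hval : ∀ x : ℝ, fourier (-n) (x : AddCircle ((1 : ℝ) - -1))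
        - fourier (-n) ((-x : ℝ) : AddCircle ((1 : ℝ) - -1))
        = (-2 * Complex.I) * ((Real.sin (n * Real.pi * x) : ℝ) : ℂ) := by
      intro x
      rw [fourier_coe_apply, fourier_coe_apply, Complex.ofReal_sin, Complex.sin]
      have e1 : 2 * (Real.pi : ℂ) * Complex.I * ((-n : ℤ) : ℂ) * (x : ℂ) / ((1 - -1 : ℝ) : ℂ)
          = -(((n * Real.pi * x : ℝ) : ℂ)) * Complex.I := by
        push_cast; ring
      have e2 : 2 * (Real.pi : ℂ) * Complex.I * ((-n : ℤ) : ℂ) * ((-x : ℝ) : ℂ)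
          / ((1 - -1 : ℝ) : ℂ) = (((n * Real.pi * x : ℝ) : ℂ)) * Complex.I := by
        push_cast; ring
      rw [e1, e2]
      linear_combination (Complex.exp (-(((n * Real.pi * x : ℝ) : ℂ)) * Complex.I)
        - Complex.exp ((((n * Real.pi * x : ℝ) : ℂ)) * Complex.I)) * Complex.I_sq
    rw [hfull]
    -- The substitution `x ↦ -x` in the reflected half moves the antisymmetry from the function to
    -- the exponential, where only the sine survives.
    have hsplit : ∫ x : ℝ, fourier (-n) (x : AddCircle ((1 : ℝ) - -1)) • f x
        = ∫ x, (-2 * Complex.I) * ((Real.sin (n * Real.pi * x) * g x : ℝ) : ℂ) := by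
      have i1 := hI _ hcont hbd
      have i2 := hI (fun x => fourier (-n) ((-x : ℝ) : AddCircle ((1 : ℝ) - -1)))
        (hcont.comp continuous_neg) (fun x => hbd (-x))
      have hneg : ∫ x : ℝ, fourier (-n) (x : AddCircle ((1 : ℝ) - -1)) * (g (-x) : ℂ)
          = ∫ x : ℝ, fourier (-n) ((-x : ℝ) : AddCircle ((1 : ℝ) - -1)) * (g x : ℂ) := by
        rw [← integral_neg_eq_self]
        simp
      have i3 : Integrable (fun x : ℝ => fourier (-n) (x : AddCircle ((1 : ℝ) - -1))
          * (g (-x) : ℂ)) volume :=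
        hgC'.bdd_mul hcont.aestronglyMeasurable (Eventually.of_forall hbd)
      have : ∀ x : ℝ, fourier (-n) (x : AddCircle ((1 : ℝ) - -1)) • f x
          = fourier (-n) (x : AddCircle ((1 : ℝ) - -1)) * (g x : ℂ)
            - fourier (-n) (x : AddCircle ((1 : ℝ) - -1)) * (g (-x) : ℂ) := by
        intro x; simp only [hf, smul_eq_mul]; push_cast; ring
      simp_rw [this]
      rw [integral_sub i1 i3, hneg, ← integral_sub i1 i2]
      congr 1
      ext x
      rw [← sub_mul, hval x]
      push_cast; ring
    rw [hsplit, integral_const_mul, integral_complex_ofReal, hsin n]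
    simp
  have hpars := hasSum_sq_fourierCoeffOn hab (hfL.restrict (Ioc (-1 : ℝ) 1))
  simp only [hcoef, norm_zero, ne_eq, OfNat.ofNat_ne_zero, not_false_eq_true, zero_pow] at hpars
  have h0 := hpars.unique hasSum_zero
  have hint : ∫ x in (-1 : ℝ)..1, ‖f x‖ ^ 2 = 0 := by
    rcases smul_eq_zero.1 h0 with h | h
    · norm_num at h
    · exact h
  rw [intervalIntegral.integral_of_le hab.le, setIntegral_eq_zero_iff_of_nonneg_ae
    (Eventually.of_forall fun x => sq_nonneg _)
    ((hfL.restrict (Ioc (-1 : ℝ) 1)).integrable_norm_pow (by norm_num))] at hint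
  rw [Lp.ext_iff]
  have hsub : Ioo (0 : ℝ) 1 ⊆ Ioc (-1) 1 := fun x hx => ⟨by linarith [hx.1], hx.2.le⟩
  filter_upwards [ae_restrict_of_ae_restrict_of_subset hsub hint, ae_restrict_mem measurableSet_Ioo,
    Lp.coeFn_zero ℝ 2 (volume.restrict (Ioo (0 : ℝ) 1))] with x hx hx' h0
  rw [h0]
  have h2 : g (-x) = 0 := Set.indicator_of_notMem (fun h => by linarith [h.1, hx'.1]) _
  have h1 : g x = w x := Set.indicator_of_mem hx' _
  simpa [hf, h1, h2] using hx

/-- The orthonormal sine functions `φ_{n+1}`. -/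
def sineVec (n : ℕ) : L2 := Real.sqrt 2 • sinL (n + 1)

theorem inner_sineVec (n : ℕ) (w : L2) : inner ℝ (sineVec n) w = Real.sqrt 2 * coef (n + 1) w := by
  rw [sineVec, real_inner_smul_left, coef_eq_inner]

theorem orthonormal_sineVec : Orthonormal ℝ sineVec := by
  rw [orthonormal_iff_ite]
  intro i j
  rw [inner_sineVec, sineVec, coef_eq_inner, real_inner_smul_right, ← coef_eq_inner,
    coef_sinL _ _ (by omega) (by omega), ← mul_assoc, Real.mul_self_sqrt zero_le_two]
  simp

/-- The sine basis of `L²(0,1)`. -/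
def sineBasis : HilbertBasis ℕ ℝ L2 :=
  HilbertBasis.mkOfOrthogonalEqBot orthonormal_sineVec (by
    rw [Submodule.eq_bot_iff]
    intro w hw
    refine eq_zero_of_coef_eq_zero w fun n hn => ?_
    have := (Submodule.mem_orthogonal _ w).1 hw (sineVec (n - 1))
      (Submodule.subset_span (mem_range_self _))
    rw [inner_sineVec, Nat.sub_add_cancel hn] at this
    exact (mul_eq_zero.1 this).resolve_left (by positivity))

theorem sineBasis_apply (n : ℕ) : sineBasis n = sineVec n := by
  rw [sineBasis, HilbertBasis.coe_mkOfOrthogonalEqBot]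

theorem sineBasis_repr (w : L2) (n : ℕ) : sineBasis.repr w n = Real.sqrt 2 * coef (n + 1) w := by
  rw [HilbertBasis.repr_apply_apply, sineBasis_apply, inner_sineVec]

theorem coef_sub (n : ℕ) (v w : L2) : coef n (v - w) = coef n v - coef n w := by
  simp only [coef_eq_inner, inner_sub_right]

theorem continuous_coef (n : ℕ) : Continuous (coef n) := by
  simp only [funext (coef_eq_inner n)]
  fun_prop

theorem eq_of_coef_eq {v w : L2} (h : ∀ n, 1 ≤ n → coef n v = coef n w) : v = w :=
  sub_eq_zero.1 (eq_zero_of_coef_eq_zero _ fun n hn => by rw [coef_sub, h n hn, sub_self])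

theorem summable_coef_sq (w : L2) : Summable fun n => coef (n + 1) w ^ 2 := by
  have h := (lp.memℓp (sineBasis.repr w)).summable (by norm_num)
  have h2 : Summable fun n => (1 / 2 : ℝ) * ‖sineBasis.repr w n‖ ^ (2 : ENNReal).toReal :=
    h.mul_left _
  refine h2.congr fun n => ?_
  rw [sineBasis_repr]
  norm_num [abs_mul, mul_pow]
  ring

/-- Bessel's inequality. This decay, against factors growing like `n`, is what separates `θ` from
`c` in the identifier. -/
theorem tendsto_coef (w : L2) : Tendsto (fun n => coef n w) atTop (𝓝 0) := by
  rw [← tendsto_add_atTop_iff_nat 1]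
  have h := (summable_coef_sq w).tendsto_atTop_zero.sqrt
  simp only [Real.sqrt_sq_eq_abs, Real.sqrt_zero] at h
  exact (tendsto_zero_iff_abs_tendsto_zero _).2 h

/-! ### The feedback functional -/

theorem continuous_kernel (K : FeedbackGains) (θ : ℝ) : Continuous (K.kernel θ) := by
  unfold FeedbackGains.kernel sineMode
  fun_prop

/-- The feedback sees only finitely many modes; this is what reduces the closed loop to a finite
linear system followed by decoupled scalar equations. -/
theorem pair_kernel (K : FeedbackGains) (θ : ℝ) (w : L2) :
    pair (K.kernel θ) w =
      ∑ n ∈ Finset.Icc 1 (K.N θ), Real.sqrt 2 * K.coeff θ n * coef n w := by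
  have hint : ∀ n, Integrable (fun x => sinMode n x * w x) (volume.restrict (Ioo (0 : ℝ) 1)) :=
    fun n => ((Lp.memLp w).integrable (by norm_num)).bdd_mul (c := 1)
      (continuous_sinMode n).aestronglyMeasurable
      (Eventually.of_forall fun x => by simpa [sinMode] using Real.abs_sin_le_one _)
  have : ∀ x, K.kernel θ x * w x = ∑ n ∈ Finset.Icc 1 (K.N θ),
      Real.sqrt 2 * K.coeff θ n * (sinMode n x * w x) := fun x => by
    rw [FeedbackGains.kernel, Finset.sum_mul]
    refine Finset.sum_congr rfl fun n _ => ?_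
    rw [sineMode, sinMode]; ring
  simp only [pair, this]
  rw [integral_finsetSum _ fun n _ => (hint n).const_mul _]
  refine Finset.sum_congr rfl fun n _ => ?_
  rw [integral_const_mul, coef, pair]

theorem continuous_pair_kernel (K : FeedbackGains) (θ : ℝ) :
    Continuous fun w : L2 => pair (K.kernel θ) w := by
  simp only [pair_eq_inner (continuous_kernel K θ)]
  fun_prop

theorem pair_zero_right (f : ℝ → ℝ) : pair f 0 = 0 := by
  rw [pair]
  refine integral_eq_zero_of_ae ?_
  filter_upwards [Lp.coeFn_zero ℝ 2 (volume.restrict (Ioo (0 : ℝ) 1))] with x hx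
  rw [hx]; simp

/-! ### The modal equations -/

theorem hasDerivAt_sinMode (n : ℕ) (x : ℝ) :
    HasDerivAt (sinMode n) (n * Real.pi * Real.cos (n * Real.pi * x)) x := by
  have h := ((hasDerivAt_id x).const_mul (n * Real.pi : ℝ)).sin
  refine h.congr_deriv ?_
  simp only [id, mul_one]; ring

theorem hasDerivAt_cosMode (n : ℕ) (x : ℝ) :
    HasDerivAt (fun x => n * Real.pi * Real.cos (n * Real.pi * x))
      (-(n * Real.pi) ^ 2 * sinMode n x) x := by
  have h := ((hasDerivAt_id x).const_mul (n * Real.pi : ℝ)).cos.const_mul (n * Real.pi : ℝ)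
  refine h.congr_deriv ?_
  simp only [id, mul_one, sinMode]; ring

/-- Green's formula with `sin(nπx)` for a `C²` function on `[0,1]`. -/
theorem integral_sinMode_mul_iteratedDeriv {V : ℝ → ℝ} (hV : ContDiffOn ℝ 2 V (Icc 0 1)) (n : ℕ) :
    IntervalIntegrable (fun x => sinMode n x * iteratedDeriv 2 V x) volume 0 1 ∧
    ∫ x in (0 : ℝ)..1, sinMode n x * iteratedDeriv 2 V x =
      n * Real.pi * V 0 - n * Real.pi * (-1) ^ n * V 1
        - (n * Real.pi) ^ 2 * ∫ x in (0 : ℝ)..1, sinMode n x * V x := by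
  have hu : UniqueDiffOn ℝ (Icc (0 : ℝ) 1) := uniqueDiffOn_Icc zero_lt_one
  set V1 := derivWithin V (Icc 0 1) with hV1
  set V2 := derivWithin V1 (Icc 0 1) with hV2
  have cV1 : ContDiffOn ℝ 1 V1 (Icc 0 1) := hV.derivWithin hu (by norm_num)
  have cV2 : ContinuousOn V2 (Icc 0 1) := cV1.continuousOn_derivWithin hu le_rfl
  have d1 : ∀ x ∈ Ioo (0 : ℝ) 1, HasDerivAt V (V1 x) x := fun x hx =>
    ((hV.differentiableOn (by norm_num)) x (Ioo_subset_Icc_self hx)).hasDerivWithinAt.hasDerivAt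
      (Icc_mem_nhds hx.1 hx.2)
  have d2 : ∀ x ∈ Ioo (0 : ℝ) 1, HasDerivAt V1 (V2 x) x := fun x hx =>
    ((cV1.differentiableOn (by norm_num)) x (Ioo_subset_Icc_self hx)).hasDerivWithinAt.hasDerivAt
      (Icc_mem_nhds hx.1 hx.2)
  -- At the endpoints `iteratedDeriv` depends on values of `V` outside `[0,1]`, so it agrees with
  -- the one-sided derivatives only in the interior; the two endpoints are a null set for the
  -- integrals.
  have e2 : ∀ x ∈ Ioo (0 : ℝ) 1, iteratedDeriv 2 V x = V2 x := by
    intro x hx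
    rw [iteratedDeriv_succ, iteratedDeriv_one]
    have : deriv V =ᶠ[𝓝 x] V1 := by
      filter_upwards [Ioo_mem_nhds hx.1 hx.2] with y hy using (d1 y hy).deriv
    rw [this.deriv_eq, (d2 x hx).deriv]
  have iV2 : IntervalIntegrable (fun x => sinMode n x * V2 x) volume 0 1 :=
    ContinuousOn.intervalIntegrable_of_Icc zero_le_one
      ((continuous_sinMode n).continuousOn.mul cV2)
  have iV : IntervalIntegrable (fun x => (n * Real.pi) ^ 2 * (sinMode n x * V x)) volume 0 1 :=
    ContinuousOn.intervalIntegrable_of_Icc zero_le_one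
      (continuousOn_const.mul ((continuous_sinMode n).continuousOn.mul hV.continuousOn))
  have econgr : EqOn (fun x => sinMode n x * V2 x) (fun x => sinMode n x * iteratedDeriv 2 V x)
      (Ioo 0 1) := fun x hx => by simp only [e2 x hx]
  have hgreen := intervalIntegral.integral_eq_sub_of_hasDerivAt_of_le (a := 0) (b := 1)
    (f := fun x => sinMode n x * V1 x - n * Real.pi * Real.cos (n * Real.pi * x) * V x)
    (f' := fun x => sinMode n x * V2 x + (n * Real.pi) ^ 2 * (sinMode n x * V x)) zero_le_one
    (((continuous_sinMode n).continuousOn.mul cV1.continuousOn).sub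
      ((by fun_prop : Continuous fun x => n * Real.pi * Real.cos (n * Real.pi * x)).continuousOn.mul
        hV.continuousOn))
    (fun x hx => by
      refine (((hasDerivAt_sinMode n x).mul (d2 x hx)).sub
        ((hasDerivAt_cosMode n x).mul (d1 x hx))).congr_deriv ?_
      ring) (iV2.add iV)
  rw [intervalIntegral.integral_add iV2 iV, intervalIntegral.integral_const_mul] at hgreen
  constructor
  · refine iV2.congr_ae ?_
    rw [uIoc_of_le zero_le_one, ← restrict_Ioo_eq_restrict_Ioc]
    filter_upwards [ae_restrict_mem measurableSet_Ioo] with x hx using econgr hx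
  · have h3 : ∫ x in (0 : ℝ)..1, sinMode n x * iteratedDeriv 2 V x
        = ∫ x in (0 : ℝ)..1, sinMode n x * V2 x := by
      simp only [intervalIntegral.integral_of_le zero_le_one, integral_Ioc_eq_integral_Ioo]
      exact (setIntegral_congr_fun measurableSet_Ioo econgr).symm
    rw [h3]
    simp only [sinMode, Real.sin_nat_mul_pi, mul_zero, mul_one, zero_mul,
      Real.sin_zero, Real.cos_zero, Real.cos_nat_mul_pi] at hgreen ⊢
    linarith

/-- Differentiate under the integral, with `v_t` bounded on a compact rectangle around `t`, insert
the equation and apply Green's formula. The boundary value `b` enters every mode. -/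
theorem hasDerivAt_coef {p θ : ℝ} {J : Set ℝ} {b : ℝ → ℝ} {u : ℝ → L2}
    (h : IsClassicalOn p θ J b u) {α β : ℝ} (hα : 0 ≤ α) (hJ : Ioo α β ⊆ J) {t : ℝ}
    (ht : t ∈ Ioo α β) (n : ℕ) :
    HasDerivAt (fun s => coef n (u s))
      ((θ - p * (n * Real.pi) ^ 2) * coef n (u t) - p * (-1) ^ n * (n * Real.pi) * b t) t := by
  obtain ⟨v, hv, hv2, hv1, hpde, hbc⟩ := h
  have hcoef : ∀ s ∈ Ioo α β, coef n (u s) = ∫ x in (0 : ℝ)..1, sinMode n x * v s x :=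
    fun s hs => pair_congr (hv s (hα.trans_lt hs.1))
  set S : Set (ℝ × ℝ) := Ioo α β ×ˢ Icc (0 : ℝ) 1 with hS
  set f : ℝ × ℝ → ℝ := fun q => v q.1 q.2 with hf
  have hfS : ContDiffOn ℝ 1 f S := hv1.mono (prod_mono hJ subset_rfl)
  have hu : UniqueDiffOn ℝ S := isOpen_Ioo.uniqueDiffOn.prod (uniqueDiffOn_Icc zero_lt_one)
  set D : ℝ → ℝ → ℝ := fun s x => fderivWithin ℝ f S (s, x) (1, 0) with hD
  have cD : ContinuousOn (fun q : ℝ × ℝ => D q.1 q.2) S :=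
    (hfS.continuousOn_fderivWithin hu le_rfl).clm_apply continuousOn_const
  have hder : ∀ s ∈ Ioo α β, ∀ x ∈ Icc (0 : ℝ) 1, HasDerivAt (fun s => v s x) (D s x) s := by
    intro s hs x hx
    have h1 : HasFDerivWithinAt f (fderivWithin ℝ f S (s, x)) S (s, x) :=
      (hfS.differentiableOn (by norm_num) (s, x) ⟨hs, hx⟩).hasFDerivWithinAt
    have h2 : HasDerivWithinAt (fun r : ℝ => (r, x)) ((1 : ℝ), (0 : ℝ)) (Ioo α β) s :=
      ((hasDerivAt_id s).prodMk (hasDerivAt_const s x)).hasDerivWithinAt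
    have h3 := h1.comp_hasDerivWithinAt s h2 (fun r hr => mk_mem_prod hr hx)
    exact h3.hasDerivAt (Ioo_mem_nhds hs.1 hs.2)
  obtain ⟨ε, hε, hεs⟩ := Metric.isOpen_iff.1 isOpen_Ioo t ht
  have hIcc : Icc (t - ε / 2) (t + ε / 2) ⊆ Ioo α β := fun s hs =>
    hεs (by rw [Metric.mem_ball, Real.dist_eq, abs_lt]; constructor <;> linarith [hs.1, hs.2])
  obtain ⟨C, hC⟩ := (isCompact_Icc.prod isCompact_Icc).exists_bound_of_continuousOn
    (cD.mono (prod_mono hIcc (subset_refl (Icc (0 : ℝ) 1))))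
  have hslice : ∀ s ∈ Ioo α β, ContinuousOn (fun x => v s x) (Icc 0 1) := fun s hs =>
    (hv2 s (hα.trans_lt hs.1)).continuousOn
  have hmeas : ∀ g : ℝ → ℝ, ContinuousOn g (Icc 0 1) →
      AEStronglyMeasurable (fun x => sinMode n x * g x) (volume.restrict (uIoc 0 1)) := by
    intro g hg
    rw [uIoc_of_le zero_le_one]
    exact (((continuous_sinMode n).continuousOn.mul hg).mono
      Ioc_subset_Icc_self).aestronglyMeasurable measurableSet_Ioc
  have hDs : ContinuousOn (fun x => D t x) (Icc 0 1) :=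
    cD.comp (f := fun x : ℝ => (t, x)) (by fun_prop) (fun x hx => ⟨ht, hx⟩)
  have key := (intervalIntegral.hasDerivAt_integral_of_dominated_loc_of_deriv_le (μ := volume)
    (a := 0) (b := 1) (F := fun s x => sinMode n x * v s x) (F' := fun s x => sinMode n x * D s x)
    (x₀ := t) (s := Icc (t - ε / 2) (t + ε / 2)) (bound := fun _ => C)
    (Icc_mem_nhds (by linarith) (by linarith))
    (by filter_upwards [Ioo_mem_nhds ht.1 ht.2] with s hs using hmeas _ (hslice s hs))
    (ContinuousOn.intervalIntegrable_of_Icc zero_le_one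
      ((continuous_sinMode n).continuousOn.mul (hslice t ht)))
    (hmeas _ hDs)
    (Eventually.of_forall fun x hx s hs => by
      rw [uIoc_of_le zero_le_one] at hx
      have h1 := hC (s, x) ⟨hs, Ioc_subset_Icc_self hx⟩
      rw [norm_mul]
      calc _ ≤ 1 * ‖D s x‖ := by
            gcongr; simpa [sinMode] using Real.abs_sin_le_one (n * Real.pi * x)
        _ ≤ C := by simpa using h1)
    (by simp)
    (Eventually.of_forall fun x hx s hs => by
      rw [uIoc_of_le zero_le_one] at hx
      exact (hder s (hIcc hs) x (Ioc_subset_Icc_self hx)).const_mul _)).2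
  have heq : (fun s => coef n (u s)) =ᶠ[𝓝 t] fun s => ∫ x in (0 : ℝ)..1, sinMode n x * v s x := by
    filter_upwards [Ioo_mem_nhds ht.1 ht.2] with s hs using hcoef s hs
  refine (key.congr_of_eventuallyEq heq).congr_deriv ?_
  obtain ⟨ig, hg⟩ := integral_sinMode_mul_iteratedDeriv (hv2 t (hα.trans_lt ht.1)) n
  have iv : IntervalIntegrable (fun x => sinMode n x * v t x) volume 0 1 :=
    ContinuousOn.intervalIntegrable_of_Icc zero_le_one
      ((continuous_sinMode n).continuousOn.mul (hslice t ht))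
  have h4 : ∫ x in (0 : ℝ)..1, sinMode n x * D t x = ∫ x in (0 : ℝ)..1,
      (p * (sinMode n x * iteratedDeriv 2 (v t) x) + θ * (sinMode n x * v t x)) := by
    simp only [intervalIntegral.integral_of_le zero_le_one, integral_Ioc_eq_integral_Ioo]
    refine setIntegral_congr_fun measurableSet_Ioo fun x hx => ?_
    have := hpde t (hJ ht) x hx
    rw [(hder t ht x (Ioo_subset_Icc_self hx)).deriv] at this
    simp only [this]; ring
  rw [h4, intervalIntegral.integral_add (ig.const_mul _) (iv.const_mul _),
    intervalIntegral.integral_const_mul, intervalIntegral.integral_const_mul, hg, hcoef t ht,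
    (hbc t (hJ ht)).1, (hbc t (hJ ht)).2]
  ring

/-! ### Uniqueness -/

/-- A continuous nonnegative function with `E' ≤ C E` that vanishes initially vanishes. -/
theorem eq_zero_of_deriv_le {α β C : ℝ} {E E' : ℝ → ℝ} (hc : ContinuousOn E (Icc α β))
    (hd : ∀ t ∈ Ioo α β, HasDerivAt E (E' t) t) (hle : ∀ t ∈ Ioo α β, E' t ≤ C * E t)
    (h0 : E α = 0) (hnn : ∀ t ∈ Icc α β, 0 ≤ E t) : ∀ t ∈ Icc α β, E t = 0 := by
  intro t ht
  have hexp : ∀ s : ℝ, HasDerivAt (fun s => Real.exp (-C * s)) (Real.exp (-C * s) * -C) s := by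
    intro s
    have := ((hasDerivAt_id s).const_mul (-C)).exp
    simpa using this
  have hanti : AntitoneOn (fun s => Real.exp (-C * s) * E s) (Icc α β) := by
    refine antitoneOn_of_deriv_nonpos (convex_Icc _ _) (by fun_prop) ?_ ?_
    · intro s hs
      rw [interior_Icc] at hs
      exact ((hexp s).mul (hd s hs)).differentiableAt.differentiableWithinAt
    · intro s hs
      rw [interior_Icc] at hs
      rw [((hexp s).fun_mul (hd s hs)).deriv]
      have := mul_le_mul_of_nonneg_left (hle s hs) (Real.exp_pos (-C * s)).le
      linarith
  have h1 := hanti (left_mem_Icc.2 (ht.1.trans ht.2)) ht ht.1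
  simp only [h0, mul_zero] at h1
  refine le_antisymm ?_ (hnn t ht)
  by_contra hcon
  push Not at hcon
  have := mul_pos (Real.exp_pos (-C * t)) hcon
  linarith

/-- The modes `1, …, N` under a feedback that depends on these modes only: a solution with zero
initial value vanishes. -/
theorem modes_eq_zero {α β : ℝ} (s : Finset ℕ) (lam bet kap : ℕ → ℝ) (d : ℕ → ℝ → ℝ)
    (hc : ∀ n ∈ s, ContinuousOn (d n) (Icc α β))
    (hd : ∀ n ∈ s, ∀ t ∈ Ioo α β,
      HasDerivAt (d n) (lam n * d n t + bet n * ∑ m ∈ s, kap m * d m t) t)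
    (h0 : ∀ n ∈ s, d n α = 0) : ∀ n ∈ s, ∀ t ∈ Icc α β, d n t = 0 := by
  set E : ℝ → ℝ := fun t => ∑ n ∈ s, d n t ^ 2 with hE
  set L := ∑ n ∈ s, |lam n| with hL
  set B := ∑ n ∈ s, bet n ^ 2 with hB
  set Q := ∑ n ∈ s, kap n ^ 2 with hQ
  -- The growth rate comes from Cauchy–Schwarz for the two sums `∑ bet d` and `∑ kap d`, combined by
  -- `2xy ≤ x² + y²`.
  have hEz := eq_zero_of_deriv_le (α := α) (β := β) (C := 2 * L + B + Q) (E := E)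
    (E' := fun t => ∑ n ∈ s,
      2 * d n t * (lam n * d n t + bet n * ∑ m ∈ s, kap m * d m t))
    (continuousOn_finsetSum _ fun n hn => (hc n hn).pow 2)
    (fun t ht => by
      refine (HasDerivAt.fun_sum fun n hn => (hd n hn t ht).pow 2).congr_deriv ?_
      refine Finset.sum_congr rfl fun n _ => ?_
      norm_num)
    (fun t ht => by
      have hEnn : 0 ≤ E t := Finset.sum_nonneg fun n _ => sq_nonneg _
      set w := ∑ m ∈ s, kap m * d m t with hw
      have hw2 : w ^ 2 ≤ Q * E t := Finset.sum_mul_sq_le_sq_mul_sq _ _ _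
      have hb2 : (∑ n ∈ s, bet n * d n t) ^ 2 ≤ B * E t := Finset.sum_mul_sq_le_sq_mul_sq _ _ _
      have h1 : ∑ n ∈ s, lam n * d n t ^ 2 ≤ L * E t := by
        rw [hL, Finset.sum_mul]
        refine Finset.sum_le_sum fun n hn => ?_
        have : d n t ^ 2 ≤ E t :=
          Finset.single_le_sum (f := fun n => d n t ^ 2) (fun i _ => sq_nonneg _) hn
        calc lam n * d n t ^ 2 ≤ |lam n| * d n t ^ 2 := by gcongr; exact le_abs_self _
          _ ≤ |lam n| * E t := by gcongr
      have h2 : ∑ n ∈ s, 2 * d n t * (lam n * d n t + bet n * w)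
          = 2 * ∑ n ∈ s, lam n * d n t ^ 2 + 2 * (∑ n ∈ s, bet n * d n t) * w := by
        rw [mul_assoc, Finset.sum_mul, Finset.mul_sum, Finset.mul_sum, ← Finset.sum_add_distrib]
        exact Finset.sum_congr rfl fun n _ => by ring
      simp only [h2]
      nlinarith [sq_nonneg ((∑ n ∈ s, bet n * d n t) - w)])
    (Finset.sum_eq_zero fun n hn => by rw [h0 n hn]; ring)
    (fun t _ => Finset.sum_nonneg fun n _ => sq_nonneg _)
  intro n hn t ht
  have := (Finset.sum_eq_zero_iff_of_nonneg fun n _ => sq_nonneg (d n t)).1 (hEz t ht) n hn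
  exact pow_eq_zero_iff (two_ne_zero) |>.1 this

/-- A continuous function with `d' = l d` that vanishes initially vanishes. -/
theorem mode_eq_zero {α β l : ℝ} {d : ℝ → ℝ} (hc : ContinuousOn d (Icc α β))
    (hd : ∀ t ∈ Ioo α β, HasDerivAt d (l * d t) t) (h0 : d α = 0) : ∀ t ∈ Icc α β, d t = 0 :=
  modes_eq_zero {0} (fun _ => l) 0 0 (fun _ => d) (fun _ _ => hc)
    (fun _ _ t ht => by simpa using hd t ht) (fun _ _ => h0) 0 (Finset.mem_singleton_self 0)

/-- Uniqueness on an interval for the plant with the feedback `u(t,1) = ρ ∫ k u`. -/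
theorem eqOn_of_isClassicalOn {p θ θh ρ : ℝ} {K : FeedbackGains} {J J' : Set ℝ} {b b' : ℝ → ℝ}
    {u u' : ℝ → L2} (h : IsClassicalOn p θ J b u) (h' : IsClassicalOn p θ J' b' u') {α β : ℝ}
    (hα : 0 ≤ α) (hJ : Ioo α β ⊆ J) (hJ' : Ioo α β ⊆ J')
    (hc : ContinuousOn u (Icc α β)) (hc' : ContinuousOn u' (Icc α β))
    (hb : ∀ t ∈ Ioo α β, b t = ρ * pair (K.kernel θh) (u t))
    (hb' : ∀ t ∈ Ioo α β, b' t = ρ * pair (K.kernel θh) (u' t)) (h0 : u α = u' α) :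
    EqOn u u' (Icc α β) := by
  set d : ℕ → ℝ → ℝ := fun n t => coef n (u t) - coef n (u' t) with hd
  have hdc : ∀ n, ContinuousOn (d n) (Icc α β) := fun n =>
    ((continuous_coef n).comp_continuousOn hc).sub ((continuous_coef n).comp_continuousOn hc')
  have hder : ∀ n, ∀ t ∈ Ioo α β, HasDerivAt (d n) ((θ - p * (n * Real.pi) ^ 2) * d n t
      + -(p * (-1) ^ n * (n * Real.pi)) * (b t - b' t)) t := fun n t ht =>
    ((hasDerivAt_coef h hα hJ ht n).sub (hasDerivAt_coef h' hα hJ' ht n)).congr_deriv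
      (by simp only [hd]; ring)
  have hbb : ∀ t ∈ Ioo α β, b t - b' t = ∑ m ∈ Finset.Icc 1 (K.N θh),
      (ρ * (Real.sqrt 2 * K.coeff θh m)) * d m t := by
    intro t ht
    rw [hb t ht, hb' t ht, pair_kernel, pair_kernel, ← mul_sub, ← Finset.sum_sub_distrib,
      Finset.mul_sum]
    exact Finset.sum_congr rfl fun n _ => by simp only [hd]; ring
  have hd0 : ∀ n, d n α = 0 := fun n => by simp only [hd, h0, sub_self]
  -- The low modes of the difference obey a closed homogeneous system and vanish. Then the boundary
  -- values agree, and each mode of the difference is left with a homogeneous scalar equation.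
  have hlow := modes_eq_zero (Finset.Icc 1 (K.N θh)) (fun n => θ - p * (n * Real.pi) ^ 2)
    (fun n => -(p * (-1) ^ n * (n * Real.pi))) (fun m => ρ * (Real.sqrt 2 * K.coeff θh m)) d
    (fun n _ => hdc n) (fun n _ t ht => by rw [← hbb t ht]; exact hder n t ht) (fun n _ => hd0 n)
  have hbz : ∀ t ∈ Ioo α β, b t - b' t = 0 := fun t ht => by
    rw [hbb t ht]
    exact Finset.sum_eq_zero fun n hn => by rw [hlow n hn t (Ioo_subset_Icc_self ht), mul_zero]
  intro t ht
  refine eq_of_coef_eq fun n _ => sub_eq_zero.1 ?_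
  refine mode_eq_zero (l := θ - p * (n * Real.pi) ^ 2) (hdc n) (fun s hs => ?_) (hd0 n) t ht
  have := hder n s hs
  rwa [hbz s hs, mul_zero, add_zero] at this

/-! ### Sine series -/

/-- The frequency `(m+1)π`. -/
def freq (m : ℕ) : ℝ := ((m + 1 : ℕ) : ℝ) * Real.pi

theorem one_le_freq (m : ℕ) : 1 ≤ freq m := by
  have h1 : (1 : ℝ) ≤ ((m + 1 : ℕ) : ℝ) := by exact_mod_cast Nat.le_add_left 1 m
  have h2 : (1 : ℝ) ≤ Real.pi := by linarith [Real.pi_gt_three]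
  unfold freq
  nlinarith

theorem abs_sinMode_le (n : ℕ) (x : ℝ) : |sinMode n x| ≤ 1 := Real.abs_sin_le_one _

theorem hasDerivAt_sinMode_succ (m : ℕ) (x : ℝ) :
    HasDerivAt (sinMode (m + 1)) (freq m * Real.cos (freq m * x)) x :=
  hasDerivAt_sinMode (m + 1) x

theorem hasDerivAt_cosMode_succ (m : ℕ) (x : ℝ) :
    HasDerivAt (fun x => freq m * Real.cos (freq m * x)) (-freq m ^ 2 * sinMode (m + 1) x) x :=
  hasDerivAt_cosMode (m + 1) x

theorem norm_sineSeries_le {α : ℕ → ℝ} (m : ℕ) (x : ℝ) :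
    ‖α m * sinMode (m + 1) x‖ ≤ freq m ^ 2 * |α m| ∧
    ‖α m * (freq m * Real.cos (freq m * x))‖ ≤ freq m ^ 2 * |α m| ∧
    ‖α m * (-freq m ^ 2 * sinMode (m + 1) x)‖ ≤ freq m ^ 2 * |α m| := by
  have h1 := one_le_freq m
  have h2 : freq m ≤ freq m ^ 2 := by nlinarith
  have hs := abs_sinMode_le (m + 1) x
  have hc := Real.abs_cos_le_one (freq m * x)
  have ha := abs_nonneg (α m)
  have hf : |freq m| = freq m := abs_of_nonneg (by linarith)
  simp only [Real.norm_eq_abs, abs_mul, abs_neg, abs_pow, hf]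
  refine ⟨?_, ?_, ?_⟩
  · nlinarith [mul_le_mul_of_nonneg_left hs ha]
  · have : freq m * |Real.cos (freq m * x)| ≤ freq m ^ 2 := by nlinarith [abs_nonneg (Real.cos (freq m * x))]
    nlinarith
  · have : freq m ^ 2 * |sinMode (m + 1) x| ≤ freq m ^ 2 := by nlinarith
    nlinarith

theorem hasDerivAt_sineSeries {α : ℕ → ℝ} (hα : Summable fun m => freq m ^ 2 * |α m|) (x : ℝ) :
    HasDerivAt (fun x => ∑' m, α m * sinMode (m + 1) x)
        (∑' m, α m * (freq m * Real.cos (freq m * x))) x ∧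
      HasDerivAt (fun x => ∑' m, α m * (freq m * Real.cos (freq m * x)))
        (∑' m, α m * (-freq m ^ 2 * sinMode (m + 1) x)) x := by
  constructor
  · exact hasDerivAt_tsum hα (fun m y => (hasDerivAt_sinMode_succ m y).const_mul (α m))
      (fun m y => (norm_sineSeries_le m y).2.1)
      (Summable.of_norm_bounded hα fun m => (norm_sineSeries_le m x).1) x
  · exact hasDerivAt_tsum hα (fun m y => (hasDerivAt_cosMode_succ m y).const_mul (α m))
      (fun m y => (norm_sineSeries_le m y).2.2)
      (Summable.of_norm_bounded hα fun m => (norm_sineSeries_le m x).2.1) x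

theorem contDiff_sineSeries {α : ℕ → ℝ} (hα : Summable fun m => freq m ^ 2 * |α m|) :
    ContDiff ℝ 2 (fun x => ∑' m, α m * sinMode (m + 1) x) := by
  have e1 := funext fun x => (hasDerivAt_sineSeries hα x).1.deriv
  have e2 := funext fun x => (hasDerivAt_sineSeries hα x).2.deriv
  rw [show (2 : WithTop ℕ∞) = 1 + 1 by norm_num, contDiff_succ_iff_deriv]
  refine ⟨fun x => (hasDerivAt_sineSeries hα x).1.differentiableAt, by simp, ?_⟩
  rw [contDiff_one_iff_deriv]
  rw [e1]
  refine ⟨fun x => (hasDerivAt_sineSeries hα x).2.differentiableAt, ?_⟩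
  rw [e2]
  refine continuous_tsum (fun m => ?_) hα fun m x => (norm_sineSeries_le m x).2.2
  have := continuous_sinMode (m + 1)
  fun_prop

theorem coef_sineSeries {α : ℕ → ℝ} (hα : Summable fun m => freq m ^ 2 * |α m|)
    (hc : Continuous fun x => ∑' m, α m * sinMode (m + 1) x) (n : ℕ) :
    coef (n + 1) (ofCont (fun x => ∑' m, α m * sinMode (m + 1) x) hc) = α n / 2 := by
  rw [coef_ofCont]
  have hsum := intervalIntegral.hasSum_intervalIntegral_of_summable_norm (a := 0) (b := 1)
    (f := fun m => ⟨fun x => sinMode (n + 1) x * (α m * sinMode (m + 1) x), by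
      have h1 := continuous_sinMode (n + 1)
      have h2 := continuous_sinMode (m + 1)
      fun_prop⟩) (by
      refine Summable.of_nonneg_of_le (fun m => norm_nonneg _) (fun m => ?_) hα
      rw [ContinuousMap.norm_le _ (by positivity)]
      intro x
      simp only [ContinuousMap.restrict_apply, ContinuousMap.coe_mk, norm_mul]
      have h1 := abs_sinMode_le (n + 1) x
      have h2 := (norm_sineSeries_le (α := α) m x).1
      rw [norm_mul] at h2
      calc _ ≤ 1 * (‖α m‖ * ‖sinMode (m + 1) x‖) := by gcongr; exact h1
        _ ≤ _ := by rwa [one_mul])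
  simp only [ContinuousMap.coe_mk, tsum_mul_left] at hsum
  rw [← hsum.tsum_eq]
  have : ∀ m, ∫ x in (0 : ℝ)..1, sinMode (n + 1) x * (α m * sinMode (m + 1) x)
      = if m = n then α n / 2 else 0 := by
    intro m
    have : ∀ x, sinMode (n + 1) x * (α m * sinMode (m + 1) x)
        = α m * (sinMode (n + 1) x * sinMode (m + 1) x) := fun x => by ring
    simp only [this, intervalIntegral.integral_const_mul]
    rw [integral_sinMode_mul _ _ (by omega) (by omega)]
    rcases eq_or_ne m n with rfl | h
    · simp; ring
    · simp [h, Ne.symm h]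
  simp only [this, tsum_ite_eq]

/-- Time-dependent sine series with differentiable coefficients. -/
theorem sineSeries_time {a a' : ℕ → ℝ → ℝ} (ha : ∀ m t, HasDerivAt (a m) (a' m t) t)
    (ha' : ∀ m, Continuous (a' m))
    (hB : ∀ ε S : ℝ, 0 < ε → ∃ B : ℕ → ℝ, Summable B ∧ ∀ m, ∀ t ∈ Icc ε S,
      freq m ^ 2 * |a m t| ≤ B m ∧ |a' m t| ≤ B m) :
    ContDiffOn ℝ 1 (fun q : ℝ × ℝ => ∑' m, a m q.1 * sinMode (m + 1) q.2) (Ioi 0 ×ˢ univ) ∧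
    ∀ t, 0 < t → ∀ x, HasDerivAt (fun s => ∑' m, a m s * sinMode (m + 1) x)
      (∑' m, a' m t * sinMode (m + 1) x) t := by
  have hac : ∀ m, Continuous (a m) := fun m =>
    continuous_iff_continuousAt.2 fun t => (ha m t).continuousAt
  constructor
  · set L : ℕ → ℝ × ℝ → (ℝ × ℝ →L[ℝ] ℝ) := fun m q =>
      a m q.1 • ((freq m * Real.cos (freq m * q.2)) • ContinuousLinearMap.snd ℝ ℝ ℝ)
        + sinMode (m + 1) q.2 • (a' m q.1 • ContinuousLinearMap.fst ℝ ℝ ℝ) with hL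
    have hLd : ∀ m q, HasFDerivAt (fun q : ℝ × ℝ => a m q.1 * sinMode (m + 1) q.2) (L m q) q := by
      intro m q
      have h1 : HasFDerivAt (fun q : ℝ × ℝ => a m q.1)
          (a' m q.1 • ContinuousLinearMap.fst ℝ ℝ ℝ) q :=
        (ha m q.1).comp_hasFDerivAt q (hasFDerivAt_fst)
      have h2 : HasFDerivAt (fun q : ℝ × ℝ => sinMode (m + 1) q.2)
          ((freq m * Real.cos (freq m * q.2)) • ContinuousLinearMap.snd ℝ ℝ ℝ) q :=
        (hasDerivAt_sinMode_succ m q.2).comp_hasFDerivAt q (hasFDerivAt_snd)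
      exact h1.mul h2
    have hLc : ∀ m, Continuous (L m) := by
      intro m
      have h1 := hac m
      have h2 := ha' m
      have h3 := continuous_sinMode (m + 1)
      fun_prop
    have hLb : ∀ m q, ‖L m q‖ ≤ freq m ^ 2 * |a m q.1| + |a' m q.1| := by
      intro m q
      refine (norm_add_le _ _).trans (add_le_add ?_ ?_)
      · rw [smul_smul, norm_smul]
        calc _ ≤ ‖a m q.1 * (freq m * Real.cos (freq m * q.2))‖ * 1 := by
              gcongr; exact ContinuousLinearMap.norm_snd_le ..
          _ ≤ _ := by
              rw [mul_one]
              exact (norm_sineSeries_le (α := fun m => a m q.1) m q.2).2.1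
      · rw [norm_smul, norm_smul]
        calc _ ≤ 1 * (‖a' m q.1‖ * 1) := by
              gcongr
              · exact abs_sinMode_le _ _
              · exact ContinuousLinearMap.norm_fst_le ..
          _ = |a' m q.1| := by simp
    have hloc : ∀ ε S : ℝ, 0 < ε → ∀ t₀ ∈ Ioo ε S,
        ContDiffOn ℝ 1 (fun q : ℝ × ℝ => ∑' m, a m q.1 * sinMode (m + 1) q.2)
          (Ioo ε S ×ˢ univ) := by
      intro ε S hε t₀ ht₀
      obtain ⟨B, hBs, hB⟩ := hB ε S hε
      have hopen : IsOpen (Ioo ε S ×ˢ (univ : Set ℝ)) := isOpen_Ioo.prod isOpen_univ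
      have hb2 : ∀ m, ∀ q ∈ Ioo ε S ×ˢ (univ : Set ℝ), ‖L m q‖ ≤ 2 * B m := by
        intro m q hq
        have := hB m q.1 (Ioo_subset_Icc_self hq.1)
        linarith [hLb m q]
      have hfd : ∀ q ∈ Ioo ε S ×ˢ (univ : Set ℝ),
          HasFDerivAt (fun q : ℝ × ℝ => ∑' m, a m q.1 * sinMode (m + 1) q.2)
            (∑' m, L m q) q := by
        intro q hq
        -- The theorem needs convergence at one point only; at `x = 0` all terms are zero.
        refine hasFDerivAt_tsum_of_isPreconnected (hBs.mul_left 2) hopen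
          (isPreconnected_Ioo.prod isPreconnected_univ) (fun m q _ => hLd m q) hb2
          (x₀ := (t₀, 0)) ⟨ht₀, mem_univ _⟩ ?_ hq
        simp only [sinMode, mul_zero, Real.sin_zero]
        exact summable_zero
      have hcd : ContinuousOn (fun q => ∑' m, L m q) (Ioo ε S ×ˢ (univ : Set ℝ)) :=
        continuousOn_tsum (fun m => (hLc m).continuousOn) (hBs.mul_left 2) hb2
      rw [show (1 : WithTop ℕ∞) = 0 + 1 by norm_num, contDiffOn_succ_iff_fderiv_of_isOpen hopen]
      refine ⟨fun q hq => (hfd q hq).differentiableAt.differentiableWithinAt, by simp, ?_⟩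
      rw [contDiffOn_zero]
      exact hcd.congr fun q hq => (hfd q hq).fderiv
    intro q hq
    have hq1 : 0 < q.1 := hq.1
    have hmem : q.1 ∈ Ioo (q.1 / 2) (q.1 + 1) := ⟨by linarith, by linarith⟩
    refine ((hloc (q.1 / 2) (q.1 + 1) (by linarith) q.1 hmem).contDiffAt ?_).contDiffWithinAt
    exact (isOpen_Ioo.prod isOpen_univ).mem_nhds ⟨hmem, mem_univ _⟩
  · intro t ht x
    obtain ⟨B, hBs, hB⟩ := hB (t / 2) (t + 1) (by linarith)
    have hmem : t ∈ Ioo (t / 2) (t + 1) := ⟨by linarith, by linarith⟩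
    refine hasDerivAt_tsum_of_isPreconnected hBs isOpen_Ioo isPreconnected_Ioo
      (fun m s _ => (ha m s).mul_const _) (fun m s hs => ?_) hmem ?_ hmem
    · rw [norm_mul]
      calc _ ≤ |a' m s| * 1 := by gcongr; exacts [le_rfl, abs_sinMode_le _ _]
        _ ≤ B m := by rw [mul_one]; exact (hB m s (Ioo_subset_Icc_self hs)).2
    · refine Summable.of_norm_bounded hBs fun m => ?_
      exact ((norm_sineSeries_le (α := fun m => a m t) m x).1).trans
        (hB m t (Ioo_subset_Icc_self hmem)).1

/-! ### Square-summable coefficients -/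

theorem exists_coef_eq {α : ℕ → ℝ} (hα : Summable fun m => α m ^ 2) :
    ∃ g : L2, ∀ m, coef (m + 1) g = α m := by
  have hmem : Memℓp (fun m => Real.sqrt 2 * α m) 2 := by
    refine memℓp_gen ?_
    refine (hα.mul_left 2).congr fun m => ?_
    norm_num [abs_mul, mul_pow]
  refine ⟨sineBasis.repr.symm ⟨_, hmem⟩, fun m => ?_⟩
  have h := sineBasis_repr (sineBasis.repr.symm ⟨_, hmem⟩) m
  rw [LinearIsometryEquiv.apply_symm_apply] at h
  exact (mul_left_cancel₀ (by positivity) h).symm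

theorem hasSum_coef_sq (w : L2) : HasSum (fun m => 2 * coef (m + 1) w ^ 2) (‖w‖ ^ 2) := by
  have h := lp.hasSum_norm (p := 2) (by norm_num) (sineBasis.repr w)
  rw [LinearIsometryEquiv.norm_map] at h
  have h2 : ‖w‖ ^ (2 : ENNReal).toReal = ‖w‖ ^ 2 := by norm_num
  rw [h2] at h
  refine h.congr_fun ?_
  intro m
  rw [sineBasis_repr]
  norm_num [abs_mul, mul_pow]

/-- By Parseval the squared distance is a series of squared coefficient differences, and dominated
convergence passes to the limit term by term. -/
theorem continuousOn_of_coef {g : ℝ → L2} {s : Set ℝ}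
    (hc : ∀ m, ContinuousOn (fun t => coef (m + 1) (g t)) s) {b : ℕ → ℝ}
    (hb : Summable fun m => b m ^ 2) (hle : ∀ m, ∀ t ∈ s, |coef (m + 1) (g t)| ≤ b m) :
    ContinuousOn g s := by
  intro t₀ ht₀
  rw [ContinuousWithinAt, tendsto_iff_norm_sub_tendsto_zero]
  have key : Tendsto (fun t => ∑' m, 2 * coef (m + 1) (g t - g t₀) ^ 2) (𝓝[s] t₀)
      (𝓝 (∑' _ : ℕ, (0 : ℝ))) := by
    refine tendsto_tsum_of_dominated_convergence (bound := fun m => 8 * b m ^ 2) (hb.mul_left 8)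
      (fun m => ?_) ?_
    · have h1 : Tendsto (fun t => coef (m + 1) (g t)) (𝓝[s] t₀) (𝓝 (coef (m + 1) (g t₀))) :=
        hc m t₀ ht₀
      have h2 := ((h1.sub_const (coef (m + 1) (g t₀))).pow 2).const_mul 2
      simpa [coef_sub] using h2
    · filter_upwards [self_mem_nhdsWithin] with t ht m
      have h1 := abs_le.1 (hle m t ht)
      have h2 := abs_le.1 (hle m t₀ ht₀)
      rw [Real.norm_of_nonneg (by positivity), coef_sub]
      nlinarith
  simp only [tsum_zero] at key
  have h3 := key.sqrt
  simp only [Real.sqrt_zero] at h3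
  refine h3.congr fun t => ?_
  rw [(hasSum_coef_sq _).tsum_eq, Real.sqrt_sq (norm_nonneg _)]

/-! ### Existence for the plant with a prescribed boundary value -/

/-- The solution of `a' = -μ a - σ h`, `a(0) = c`. -/
def duhamel (μ c σ : ℝ) (h : ℝ → ℝ) (t : ℝ) : ℝ :=
  Real.exp (-μ * t) * (c - σ * ∫ s in (0 : ℝ)..t, Real.exp (μ * s) * h s)

theorem duhamel_zero (μ c σ : ℝ) (h : ℝ → ℝ) : duhamel μ c σ h 0 = c := by
  simp [duhamel]

theorem hasDerivAt_duhamel (μ c σ : ℝ) {h : ℝ → ℝ} (hh : Continuous h) (t : ℝ) :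
    HasDerivAt (duhamel μ c σ h) (-μ * duhamel μ c σ h t - σ * h t) t := by
  have h1 : HasDerivAt (fun s => Real.exp (-μ * s)) (Real.exp (-μ * t) * -μ) t := by
    simpa using ((hasDerivAt_id t).const_mul (-μ)).exp
  have h2 : HasDerivAt (fun t => ∫ s in (0 : ℝ)..t, Real.exp (μ * s) * h s)
      (Real.exp (μ * t) * h t) t :=
    intervalIntegral.integral_hasDerivAt_right (Continuous.intervalIntegrable (by fun_prop) _ _)
      (Continuous.stronglyMeasurableAtFilter (by fun_prop) _ _)
      (Continuous.continuousAt (by fun_prop))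
  refine (h1.mul ((h2.const_mul σ).const_sub c)).congr_deriv ?_
  have e : Real.exp (-μ * t) * Real.exp (μ * t) = 1 := by rw [← Real.exp_add]; simp
  simp only [duhamel]
  linear_combination (-(σ * h t)) * e

/-- The damping kernel `exp(-μ(t-s))` has integral at most `1/μ`. With `μ = p freq²` this gains two
powers of the frequency on the forcing. -/
theorem abs_duhamel_le {μ c σ C S : ℝ} {h : ℝ → ℝ} (hμ : 0 < μ)
    (hC : ∀ s ∈ Icc 0 S, |h s| ≤ C) {t : ℝ} (ht : t ∈ Icc 0 S) :
    |duhamel μ c σ h t| ≤ Real.exp (-μ * t) * |c| + |σ| * (C / μ) := by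
  have hC0 : 0 ≤ C := (abs_nonneg _).trans (hC t ht)
  have h1 : |∫ s in (0 : ℝ)..t, Real.exp (μ * s) * h s| ≤ C / μ * Real.exp (μ * t) := by
    calc |∫ s in (0 : ℝ)..t, Real.exp (μ * s) * h s|
        ≤ ∫ s in (0 : ℝ)..t, Real.exp (μ * s) * C := by
          rw [← Real.norm_eq_abs]
          refine intervalIntegral.norm_integral_le_of_norm_le (μ := volume) ht.1
            (Eventually.of_forall fun s hs => ?_) (Continuous.intervalIntegrable
              (by fun_prop : Continuous fun s => Real.exp (μ * s) * C) _ _)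
          rw [norm_mul, Real.norm_of_nonneg (Real.exp_pos _).le]
          gcongr
          exact hC s ⟨hs.1.le, hs.2.trans ht.2⟩
      _ = C / μ * (Real.exp (μ * t) - 1) := by
          rw [intervalIntegral.integral_mul_const,
            intervalIntegral.integral_comp_mul_left (fun x => Real.exp x) hμ.ne', integral_exp]
          simp; ring
      _ ≤ _ := by
          have : 0 ≤ C / μ := by positivity
          nlinarith
  have e : Real.exp (-μ * t) * Real.exp (μ * t) = 1 := by rw [← Real.exp_add]; simp
  rw [duhamel, abs_mul, abs_of_pos (Real.exp_pos _)]
  calc _ ≤ Real.exp (-μ * t) * (|c| + |σ| * (C / μ * Real.exp (μ * t))) := by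
        gcongr
        refine (abs_sub _ _).trans ?_
        rw [abs_mul]
        gcongr
    _ = Real.exp (-μ * t) * |c| + |σ| * (C / μ) * (Real.exp (-μ * t) * Real.exp (μ * t)) := by ring
    _ = _ := by rw [e, mul_one]

/-- The function with second derivative `x` that vanishes at `0` and `1`. -/
def cubic (x : ℝ) : ℝ := (x ^ 3 - x) / 6

theorem bernoulli_three_eval (x : ℝ) :
    (Polynomial.map (algebraMap ℚ ℝ) (Polynomial.bernoulli 3)).eval x
      = x ^ 3 - 3 / 2 * x ^ 2 + 1 / 2 * x := by
  simp_rw [Polynomial.bernoulli, Finset.sum_range_succ, Polynomial.map_add, Polynomial.eval_add]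
  simp only [Finset.range_zero, Finset.sum_empty, Polynomial.map_monomial,
    Polynomial.eval_monomial, bernoulli_eq_bernoulli'_of_ne_one zero_ne_one, bernoulli'_zero,
    bernoulli_one, bernoulli_eq_bernoulli'_of_ne_one (by norm_num : (2 : ℕ) ≠ 1), bernoulli'_two,
    bernoulli_eq_bernoulli'_of_ne_one (by norm_num : (3 : ℕ) ≠ 1), bernoulli'_three]
  norm_num [Nat.choose]
  ring

/-- This is the Fourier series of the third Bernoulli polynomial at `(1+x)/2`; the half-period shift
produces the alternating sign. -/
theorem hasSum_cubic {x : ℝ} (hx : x ∈ Icc (0 : ℝ) 1) :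
    HasSum (fun m => 2 * (-1) ^ (m + 1) / freq m ^ 3 * sinMode (m + 1) x) (cubic x) := by
  have h := hasSum_one_div_nat_pow_mul_sin one_ne_zero (x := (1 + x) / 2)
    ⟨by linarith [hx.1], by linarith [hx.2]⟩
  rw [show 2 * 1 + 1 = 3 from rfl, bernoulli_three_eval] at h
  have h1 := ((hasSum_nat_add_iff' 1).2 h).mul_left (2 / Real.pi ^ 3)
  have hpi := Real.pi_ne_zero
  have hval : cubic x = 2 / Real.pi ^ 3 *
      ((-1) ^ (1 + 1) * (2 * Real.pi) ^ 3 / 2 / ((3).factorial : ℝ) *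
          (((1 + x) / 2) ^ 3 - 3 / 2 * ((1 + x) / 2) ^ 2 + 1 / 2 * ((1 + x) / 2)) -
        ∑ i ∈ Finset.range 1, 1 / (i : ℝ) ^ 3 * Real.sin (2 * Real.pi * i * ((1 + x) / 2))) := by
    simp [cubic, Nat.factorial]
    field_simp
    ring
  rw [hval]
  refine h1.congr_fun fun m => ?_
  have e : 2 * Real.pi * ((m + 1 : ℕ) : ℝ) * ((1 + x) / 2)
      = ((m + 1 : ℕ) : ℝ) * Real.pi * x + ((m + 1 : ℕ) : ℝ) * Real.pi := by ring
  have hm : (((m + 1 : ℕ) : ℝ)) ≠ 0 := by positivity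
  rw [e, Real.sin_add, Real.sin_nat_mul_pi, Real.cos_nat_mul_pi, sinMode, freq]
  field_simp
  ring

theorem summable_freq_inv_sq : Summable fun m => (freq m ^ 2)⁻¹ := by
  have h := ((summable_nat_add_iff 1).2 (Real.summable_nat_pow_inv.2 (by norm_num : 1 < 2)))
  refine (h.mul_left (Real.pi ^ 2)⁻¹).congr fun m => ?_
  rw [freq, mul_pow, mul_inv, mul_comm]

theorem summable_freq_sq_mul_exp {r : ℝ} (hr : 0 < r) :
    Summable fun m => freq m ^ 2 * Real.exp (-(r * freq m ^ 2)) := by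
  have h := (summable_nat_add_iff 1).2 (Real.summable_pow_mul_exp_neg_nat_mul 2 hr)
  refine Summable.of_nonneg_of_le (fun m => by positivity) (fun m => ?_)
    (h.mul_left (Real.pi ^ 2))
  have h1 : ((m + 1 : ℕ) : ℝ) ≤ freq m ^ 2 := by
    have h2 : (1 : ℝ) ≤ ((m + 1 : ℕ) : ℝ) := by exact_mod_cast Nat.le_add_left 1 m
    have h3 : ((m + 1 : ℕ) : ℝ) ≤ freq m := by
      unfold freq
      nlinarith [Real.pi_gt_three]
    nlinarith [one_le_freq m]
  have h4 : Real.exp (-(r * freq m ^ 2)) ≤ Real.exp (-r * ((m + 1 : ℕ) : ℝ)) :=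
    Real.exp_le_exp.2 (by nlinarith)
  calc freq m ^ 2 * Real.exp (-(r * freq m ^ 2))
      ≤ freq m ^ 2 * Real.exp (-r * ((m + 1 : ℕ) : ℝ)) := by gcongr
    _ = _ := by rw [freq]; ring

/-! ### The lift of the boundary value and the modes of the remainder. -/

section Lift

variable (p : ℝ) (w : ℝ → ℝ) (u₀ : L2)

/-- The cubic lift of the boundary value. -/
def lift (t x : ℝ) : ℝ := x * w t + cubic x * (deriv w t / p)

theorem continuous_lift (t : ℝ) : Continuous (lift p w t) := by
  unfold lift cubic; fun_prop

/-- The sine coefficients of the difference of the solution and the lift. -/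
def remCoef (m : ℕ) : ℝ → ℝ :=
  duhamel (p * freq m ^ 2) (2 * coef (m + 1) (u₀ - ofCont (lift p w 0) (continuous_lift p w 0)))
    (2 * (-1) ^ (m + 1) / freq m ^ 3 / p) (deriv (deriv w))

variable {p w u₀}

theorem remCoef_zero (m : ℕ) : remCoef p w u₀ m 0 =
    2 * coef (m + 1) (u₀ - ofCont (lift p w 0) (continuous_lift p w 0)) :=
  duhamel_zero ..

/-- The cubic term is chosen so that `p · lift_xx` cancels the part `x w'` of `lift_t`; the
remainder is forced only by `-cubic · w''/p`, with coefficients of order `freq⁻³`. The linear lift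
alone would leave a forcing of order `freq⁻¹`, hence second derivatives of order `freq⁻¹` after
damping, which is not summable. -/
theorem hasDerivAt_remCoef (hw : Continuous (deriv (deriv w))) (m : ℕ) (t : ℝ) :
    HasDerivAt (remCoef p w u₀ m) (-(p * freq m ^ 2) * remCoef p w u₀ m t
      - 2 * (-1) ^ (m + 1) / freq m ^ 3 / p * deriv (deriv w) t) t :=
  hasDerivAt_duhamel _ _ _ hw t

/-- Bounds on `[0,S]`. -/
theorem exists_remCoef_bound (hp : 0 < p) (hw : Continuous (deriv (deriv w))) (S : ℝ) :
    ∃ c : ℕ → ℝ, ∃ D Q : ℝ, 0 ≤ D ∧ 0 ≤ Q ∧ (∀ m, 0 ≤ c m) ∧ (∀ m, c m ≤ Q) ∧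
      (Summable fun m => c m ^ 2) ∧
      ∀ m, ∀ t ∈ Icc 0 S,
        |remCoef p w u₀ m t| ≤ Real.exp (-(p * freq m ^ 2) * t) * c m + D / freq m ^ 4 ∧
        |2 * (-1) ^ (m + 1) / freq m ^ 3 / p * deriv (deriv w) t| ≤ D / freq m ^ 2 := by
  obtain ⟨C, hC⟩ := (isCompact_Icc (a := (0 : ℝ)) (b := S)).exists_bound_of_continuousOn
    hw.continuousOn
  set z := u₀ - ofCont (lift p w 0) (continuous_lift p w 0) with hz
  have hbdd : BddAbove (range fun m => |2 * coef (m + 1) z|) := by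
    have h1 : Tendsto (fun m => |2 * coef (m + 1) z|) atTop (𝓝 |2 * 0|) :=
      (((tendsto_add_atTop_iff_nat 1).2 (tendsto_coef z)).const_mul 2).abs
    exact h1.bddAbove_range
  obtain ⟨Q, hQ⟩ := hbdd
  have hQ' : ∀ m, |2 * coef (m + 1) z| ≤ Q := fun m => hQ (mem_range_self m)
  -- The factor `1 + 1/p` dominates both the `1/p` gained from damping in the first bound and the
  -- `1` in the second, so that one constant serves for both.
  refine ⟨fun m => |2 * coef (m + 1) z|, 2 * max C 0 / p * (1 + 1 / p), Q, by positivity,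
    (abs_nonneg _).trans (hQ' 0), fun m => abs_nonneg _, hQ', ?_, ?_⟩
  · refine ((summable_coef_sq z).mul_left 4).congr fun m => ?_
    rw [sq_abs]; ring
  · intro m t ht
    have hf := one_le_freq m
    have hf0 : 0 < freq m := by linarith
    have hσ : |2 * (-1) ^ (m + 1) / freq m ^ 3 / p| = 2 / freq m ^ 3 / p := by
      rw [abs_div, abs_div, abs_mul, abs_pow, abs_pow, abs_neg, abs_one, one_pow, abs_of_pos hp,
        abs_of_pos hf0]
      norm_num
    have hC' : ∀ s ∈ Icc 0 S, |deriv (deriv w) s| ≤ max C 0 := fun s hs =>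
      (hC s hs).trans (le_max_left _ _)
    have h34 : 1 / freq m ^ 3 ≤ 1 / freq m ^ 2 :=
      one_div_le_one_div_of_le (by positivity) (pow_le_pow_right₀ hf (by norm_num))
    have h54 : 1 / freq m ^ 5 ≤ 1 / freq m ^ 4 :=
      one_div_le_one_div_of_le (by positivity) (pow_le_pow_right₀ hf (by norm_num))
    have hM : 0 ≤ max C 0 := le_max_right _ _
    constructor
    · refine (abs_duhamel_le (by positivity) hC' ht).trans ?_
      rw [hσ]
      gcongr
      calc 2 / freq m ^ 3 / p * (max C 0 / (p * freq m ^ 2))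
          = 2 * max C 0 / p * (1 / p) * (1 / freq m ^ 5) := by field_simp
        _ ≤ 2 * max C 0 / p * (1 + 1 / p) * (1 / freq m ^ 4) := by gcongr; linarith
        _ = _ := by ring
    · rw [abs_mul, hσ]
      calc _ ≤ 2 / freq m ^ 3 / p * max C 0 := by gcongr; exact hC' t ht
        _ = 2 * max C 0 / p * 1 * (1 / freq m ^ 3) := by ring
        _ ≤ 2 * max C 0 / p * (1 + 1 / p) * (1 / freq m ^ 2) := by
            gcongr
            have : 0 ≤ 1 / p := by positivity
            linarith
        _ = _ := by ring

/-- The initial coefficients are only square-summable; for `t ≥ ε > 0` the factor `exp(-p freq² t)`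
beats every power of the frequency. The bound therefore holds away from time zero only. -/
theorem exists_remCoef_summable_bound (hp : 0 < p) (hw : Continuous (deriv (deriv w)))
    (ε S : ℝ) (hε : 0 < ε) :
    ∃ B : ℕ → ℝ, Summable B ∧ ∀ m, ∀ t ∈ Icc ε S,
      freq m ^ 2 * |remCoef p w u₀ m t| ≤ B m ∧
      |-(p * freq m ^ 2) * remCoef p w u₀ m t
        - 2 * (-1) ^ (m + 1) / freq m ^ 3 / p * deriv (deriv w) t| ≤ B m := by
  obtain ⟨c, D, Q, hD, hQ, hc, hcQ, -, hb⟩ := exists_remCoef_bound (u₀ := u₀) hp hw S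
  set G : ℕ → ℝ := fun m => Q * (freq m ^ 2 * Real.exp (-(p * ε * freq m ^ 2)))
    + D * (freq m ^ 2)⁻¹ with hG
  have hGs : Summable G :=
    ((summable_freq_sq_mul_exp (by positivity)).mul_left Q).add (summable_freq_inv_sq.mul_left D)
  have h1 : ∀ m, ∀ t ∈ Icc ε S, freq m ^ 2 * |remCoef p w u₀ m t| ≤ G m := by
    intro m t ht
    have hf := one_le_freq m
    have hf0 : 0 < freq m := by linarith
    have h2 := (hb m t ⟨hε.le.trans ht.1, ht.2⟩).1
    have h3 : Real.exp (-(p * freq m ^ 2) * t) ≤ Real.exp (-(p * ε * freq m ^ 2)) := by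
      refine Real.exp_le_exp.2 ?_
      have : p * freq m ^ 2 * ε ≤ p * freq m ^ 2 * t := by gcongr; exact ht.1
      linarith
    calc freq m ^ 2 * |remCoef p w u₀ m t|
        ≤ freq m ^ 2 * (Real.exp (-(p * ε * freq m ^ 2)) * Q + D / freq m ^ 4) := by
          gcongr
          refine h2.trans ?_
          gcongr
          exacts [hc m, hcQ m]
      _ = G m := by simp only [hG]; field_simp
  refine ⟨fun m => (1 + p) * G m + D * (freq m ^ 2)⁻¹,
    (hGs.mul_left _).add (summable_freq_inv_sq.mul_left D), fun m t ht => ?_⟩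
  have hf0 : 0 < freq m := by linarith [one_le_freq m]
  have h2 := h1 m t ht
  have hG0 : 0 ≤ G m := le_trans (by positivity) h2
  have h4 : 0 ≤ D * (freq m ^ 2)⁻¹ := by positivity
  have h5 : 0 ≤ p * G m := by positivity
  constructor
  · linarith
  · refine (abs_sub _ _).trans ?_
    have h3 := (hb m t ⟨hε.le.trans ht.1, ht.2⟩).2
    have h6 : |-(p * freq m ^ 2) * remCoef p w u₀ m t| = p * (freq m ^ 2 * |remCoef p w u₀ m t|) := by
      rw [abs_mul, abs_neg, abs_of_pos (by positivity : 0 < p * freq m ^ 2), mul_assoc]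
    rw [h6]
    have h7 := mul_le_mul_of_nonneg_left h2 hp.le
    rw [div_eq_mul_inv D] at h3
    simp only
    linarith

end Lift

theorem continuous_cubic : Continuous cubic := by unfold cubic; fun_prop

theorem ofCont_lift (p : ℝ) (w : ℝ → ℝ) (t : ℝ) :
    ofCont (lift p w t) (continuous_lift p w t)
      = w t • ofCont id continuous_id + (deriv w t / p) • ofCont cubic continuous_cubic := by
  rw [Lp.ext_iff]
  filter_upwards [coeFn_ofCont _ (continuous_lift p w t), coeFn_ofCont _ continuous_id,
    coeFn_ofCont _ continuous_cubic,
    Lp.coeFn_add (w t • ofCont id continuous_id) ((deriv w t / p) • ofCont cubic continuous_cubic),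
    Lp.coeFn_smul (w t) (ofCont id continuous_id),
    Lp.coeFn_smul (deriv w t / p) (ofCont cubic continuous_cubic)] with x h1 h2 h3 h4 h5 h6
  rw [h1, h4, Pi.add_apply, h5, h6, Pi.smul_apply, Pi.smul_apply, h2, h3, lift]
  simp only [smul_eq_mul, id]; ring

theorem hasDerivAt_lift_time {w : ℝ → ℝ} (hw : ContDiff ℝ 2 w) (p t x : ℝ) :
    HasDerivAt (fun s => lift p w s x) (x * deriv w t + cubic x * (deriv (deriv w) t / p)) t := by
  have h1 : HasDerivAt w (deriv w t) t :=
    (hw.differentiable (by norm_num) t).hasDerivAt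
  have h2 : HasDerivAt (deriv w) (deriv (deriv w) t) t :=
    ((ContDiff.differentiable (n := 1) (hw.deriv' ) (by norm_num)) t).hasDerivAt
  exact (h1.const_mul x).add ((h2.div_const p).const_mul (cubic x))

theorem iteratedDeriv_lift (p : ℝ) (w : ℝ → ℝ) (t x : ℝ) :
    iteratedDeriv 2 (lift p w t) x = x * (deriv w t / p) := by
  have h1 : ∀ x, HasDerivAt (lift p w t) (w t + (3 * x ^ 2 - 1) / 6 * (deriv w t / p)) x := by
    intro x
    have h := ((hasDerivAt_id x).mul_const (w t)).add
      (((((hasDerivAt_id x).pow 3).sub (hasDerivAt_id x)).div_const 6).mul_const (deriv w t / p))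
    refine h.congr_deriv ?_
    simp
  have h2 : HasDerivAt (fun x => w t + (3 * x ^ 2 - 1) / 6 * (deriv w t / p))
      (x * (deriv w t / p)) x := by
    have h := ((((((hasDerivAt_id x).pow 2).const_mul 3).sub_const 1).div_const 6).mul_const
      (deriv w t / p)).const_add (w t)
    refine h.congr_deriv ?_
    simp only [Nat.cast_ofNat, id, Nat.add_one_sub_one, pow_one, mul_one]
    ring
  rw [iteratedDeriv_succ, iteratedDeriv_one, funext fun x => (h1 x).deriv, h2.deriv]

/-- The heat equation with `u(t,0) = 0`, `u(t,1) = w(t)` and an arbitrary initial state in `L²`. -/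
theorem exists_heat_solution {p : ℝ} (hp : 0 < p) {w : ℝ → ℝ} (hw : ContDiff ℝ 2 w) (u₀ : L2) :
    ∃ u : ℝ → L2, ContinuousOn u (Ici 0) ∧ u 0 = u₀ ∧ IsClassicalOn p 0 (Ioi 0) w u := by
  have hw1 : ContDiff ℝ 1 (deriv w) := hw.deriv'
  have hw2 : Continuous (deriv (deriv w)) := hw1.continuous_deriv le_rfl
  set a := remCoef p w u₀ with ha
  have hder : ∀ m t, HasDerivAt (a m) (-(p * freq m ^ 2) * a m t
      - 2 * (-1) ^ (m + 1) / freq m ^ 3 / p * deriv (deriv w) t) t := hasDerivAt_remCoef hw2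
  have hac : ∀ m, Continuous (a m) := fun m =>
    continuous_iff_continuousAt.2 fun t => (hder m t).continuousAt
  have hbound : ∀ S : ℝ, ∃ b : ℕ → ℝ, (Summable fun m => b m ^ 2) ∧
      ∀ m, ∀ t ∈ Icc 0 S, |a m t| ≤ b m := by
    intro S
    obtain ⟨c, D, Q, hD, hQ, hc, -, hcs, hb⟩ := exists_remCoef_bound (u₀ := u₀) hp hw2 S
    refine ⟨fun m => c m + D / freq m ^ 2, ?_, fun m t ht => (hb m t ht).1.trans ?_⟩
    · refine Summable.of_nonneg_of_le (fun m => sq_nonneg _) (fun m => ?_)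
        ((hcs.mul_left 2).add (summable_freq_inv_sq.mul_left (2 * D ^ 2)))
      have hf := one_le_freq m
      have : (D / freq m ^ 2) ^ 2 ≤ D ^ 2 * (freq m ^ 2)⁻¹ := by
        rw [div_pow, div_eq_mul_inv]
        gcongr
        nlinarith
      nlinarith [sq_nonneg (c m - D / freq m ^ 2)]
    · have hf := one_le_freq m
      have h1 : Real.exp (-(p * freq m ^ 2) * t) ≤ 1 := by
        rw [Real.exp_le_one_iff]
        have := mul_nonneg (by positivity : 0 ≤ p * freq m ^ 2) ht.1
        linarith
      have h2 := hc m
      calc _ ≤ 1 * c m + D / freq m ^ 2 := by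
            gcongr
            norm_num
        _ = _ := by rw [one_mul]
  -- The factor `1/2` is `∫₀¹ sin²(nπx) dx`, as the modes are not normalised. Negative times are
  -- frozen at zero, since the bounds hold on `[0,S]` only.
  have hG : ∀ t : ℝ, ∃ g : L2, ∀ m, coef (m + 1) g = a m (max t 0) / 2 := by
    intro t
    obtain ⟨b, hb, hb'⟩ := hbound (max t 0)
    refine exists_coef_eq (Summable.of_nonneg_of_le (fun m => sq_nonneg _) (fun m => ?_) hb)
    have := abs_le.1 (hb' m (max t 0) ⟨le_max_right _ _, le_rfl⟩)
    nlinarith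
  choose G hG using hG
  have hGc : ContinuousOn G (Ici 0) := by
    intro t ht
    obtain ⟨b, hb, hb'⟩ := hbound (t + 1)
    have h1 : ContinuousOn G (Icc 0 (t + 1)) := by
      refine continuousOn_of_coef (b := b) (fun m => ?_) hb fun m s hs => ?_
      · simp only [hG]
        have := hac m
        fun_prop
      · rw [hG, max_eq_left hs.1, abs_div]
        have := hb' m s hs
        have h2 := abs_nonneg (a m s)
        norm_num
        linarith
    refine (h1 t ⟨ht, by linarith⟩).mono_of_mem_nhdsWithin ?_
    rw [← Ici_inter_Iic]
    exact inter_mem self_mem_nhdsWithin (mem_nhdsWithin_of_mem_nhds (Iic_mem_nhds (by linarith)))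
  have hsum : ∀ t, 0 < t → Summable fun m => freq m ^ 2 * |a m t| := by
    intro t ht
    obtain ⟨B, hB, hB'⟩ := exists_remCoef_summable_bound (u₀ := u₀) hp hw2 t t ht
    exact Summable.of_nonneg_of_le (fun m => by positivity) (fun m => (hB' m t ⟨le_rfl, le_rfl⟩).1)
      hB
  obtain ⟨hC1, hdt⟩ := sineSeries_time hder (fun m => by have := hac m; fun_prop)
    (fun ε S hε => exists_remCoef_summable_bound (u₀ := u₀) hp hw2 ε S hε)
  have hwc := hw.continuous
  have hw1c := hw1.continuous
  refine ⟨fun t => ofCont (lift p w t) (continuous_lift p w t) + G t, ?_, ?_,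
    fun t x => lift p w t x + ∑' m, a m t * sinMode (m + 1) x, ?_, ?_, ?_, ?_, ?_⟩
  · simp only [ofCont_lift]
    fun_prop
  · have : G 0 = u₀ - ofCont (lift p w 0) (continuous_lift p w 0) := by
      refine eq_of_coef_eq fun n hn => ?_
      obtain ⟨m, rfl⟩ := Nat.exists_eq_add_of_le' hn
      rw [hG, max_self, ha, remCoef_zero]; ring
    simp only [this]; abel
  · intro t ht
    have hcs := (contDiff_sineSeries (hsum t ht)).continuous
    have hGt : G t = ofCont _ hcs := by
      refine eq_of_coef_eq fun n hn => ?_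
      obtain ⟨m, rfl⟩ := Nat.exists_eq_add_of_le' hn
      rw [hG, coef_sineSeries (hsum t ht), max_eq_left ht.le]
    filter_upwards [Lp.coeFn_add (ofCont (lift p w t) (continuous_lift p w t)) (G t),
      coeFn_ofCont _ (continuous_lift p w t), coeFn_ofCont _ hcs] with x h1 h2 h3
    rw [h1, Pi.add_apply, h2, hGt, h3]
  · intro t ht
    refine ContDiff.contDiffOn (ContDiff.add ?_ (contDiff_sineSeries (hsum t ht)))
    unfold lift cubic
    fun_prop
  · refine ContDiffOn.add (ContDiff.contDiffOn ?_) (hC1.mono (prod_mono subset_rfl (subset_univ _)))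
    have := hw.of_le (by norm_num : (1 : WithTop ℕ∞) ≤ 2)
    unfold lift cubic
    fun_prop
  · intro t ht x hx
    have hs := contDiff_sineSeries (hsum t ht)
    have h1 := ((hasDerivAt_lift_time hw p t x).add (hdt t ht x)).deriv
    have hl : ContDiff ℝ 2 (lift p w t) := by unfold lift cubic; fun_prop
    have h2 : iteratedDeriv 2 (fun x => lift p w t x + ∑' m, a m t * sinMode (m + 1) x) x
        = x * (deriv w t / p) + ∑' m, a m t * (-freq m ^ 2 * sinMode (m + 1) x) := by
      have := iteratedDeriv_fun_add (n := 2) (x := x) hl.contDiffAt hs.contDiffAt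
      rw [this, iteratedDeriv_lift]
      congr 1
      rw [iteratedDeriv_succ, iteratedDeriv_one,
        funext fun x => (hasDerivAt_sineSeries (hsum t ht) x).1.deriv,
        (hasDerivAt_sineSeries (hsum t ht) x).2.deriv]
    -- Summed over the modes, the damping terms give `p` times the second derivative of the
    -- remainder, and the forcing terms resum to the cubic that cancels the `w''` part of `lift_t`.
    have h3 : ∑' m, (-(p * freq m ^ 2) * a m t
        - 2 * (-1) ^ (m + 1) / freq m ^ 3 / p * deriv (deriv w) t) * sinMode (m + 1) x
        = p * ∑' m, a m t * (-freq m ^ 2 * sinMode (m + 1) x)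
          - deriv (deriv w) t / p * cubic x := by
      have hS1 : HasSum (fun m => a m t * (-freq m ^ 2 * sinMode (m + 1) x))
          (∑' m, a m t * (-freq m ^ 2 * sinMode (m + 1) x)) :=
        (Summable.of_norm_bounded (hsum t ht)
          fun m => (norm_sineSeries_le (α := fun m => a m t) m x).2.2).hasSum
      refine HasSum.tsum_eq ?_
      refine ((hS1.mul_left p).sub ((hasSum_cubic (Ioo_subset_Icc_self hx)).mul_left
        (deriv (deriv w) t / p))).congr_fun fun m => ?_
      ring
    refine h1.trans ?_
    rw [h2, h3]
    field_simp
    ring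
  · intro t ht
    simp [lift, cubic, sinMode, Real.sin_nat_mul_pi, -Nat.cast_add]

/-! ### From a prescribed boundary value to feedback control. -/

theorem IsClassicalOn.congr {p θ : ℝ} {J : Set ℝ} {b b' : ℝ → ℝ} {u : ℝ → L2}
    (h : IsClassicalOn p θ J b u) (hb : ∀ t ∈ J, b t = b' t) : IsClassicalOn p θ J b' u := by
  obtain ⟨v, h1, h2, h3, h4, h5⟩ := h
  exact ⟨v, h1, h2, h3, h4, fun t ht => ⟨(h5 t ht).1, (h5 t ht).2.trans (hb t ht)⟩⟩

/-- The factor `exp(θt)` turns the pure heat equation into the one with reaction term `θu`, so only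
the former has to be solved by series. -/
theorem IsClassicalOn.exp_smul {p : ℝ} {b : ℝ → ℝ} {u : ℝ → L2}
    (h : IsClassicalOn p 0 (Ioi 0) b u) (θ : ℝ) :
    IsClassicalOn p θ (Ioi 0) (fun t => Real.exp (θ * t) * b t)
      (fun t => Real.exp (θ * t) • u t) := by
  obtain ⟨v, h1, h2, h3, h4, h5⟩ := h
  refine ⟨fun t x => Real.exp (θ * t) * v t x, ?_, ?_, ?_, ?_, ?_⟩
  · intro t ht
    filter_upwards [h1 t ht, Lp.coeFn_smul (Real.exp (θ * t)) (u t)] with x hx hx'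
    rw [hx', Pi.smul_apply, hx, smul_eq_mul]
  · intro t ht
    exact contDiffOn_const.mul (h2 t ht)
  · refine ContDiffOn.mul (ContDiff.contDiffOn ?_) h3
    fun_prop
  · intro t ht x hx
    have hd : DifferentiableAt ℝ (fun s => v s x) t := by
      have hq : DifferentiableAt ℝ (fun q : ℝ × ℝ => v q.1 q.2) (t, x) :=
        (h3.contDiffAt (prod_mem_nhds (Ioi_mem_nhds ht)
          (Icc_mem_nhds hx.1 hx.2))).differentiableAt (by norm_num)
      exact hq.comp (f := fun s : ℝ => (s, x)) t (by fun_prop)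
    have he : HasDerivAt (fun s => Real.exp (θ * s)) (Real.exp (θ * t) * θ) t := by
      simpa using ((hasDerivAt_id t).const_mul θ).exp
    rw [(he.fun_mul hd.hasDerivAt).deriv, h4 t ht x hx, iteratedDeriv_const_mul_field]
    ring
  · intro t ht
    simp [(h5 t ht).1, (h5 t ht).2]

theorem contDiff_of_hasDerivAt_clm {E : Type*} [NormedAddCommGroup E] [NormedSpace ℝ E]
    {Z : ℝ → E} {A : E →L[ℝ] E} (h : ∀ t, HasDerivAt Z (A (Z t)) t) (n : ℕ) :
    ContDiff ℝ n Z := by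
  induction n with
  | zero =>
    exact contDiff_zero.2 (continuous_iff_continuousAt.2 fun t => (h t).continuousAt)
  | succ n ih =>
    rw [Nat.cast_succ, contDiff_succ_iff_deriv]
    refine ⟨fun t => (h t).differentiableAt, by simp, ?_⟩
    rw [funext fun t => (h t).deriv]
    exact A.contDiff.comp ih

/-- The matrix exponential solves the closed system of the low modes, so that the boundary value is
known, and smooth, before the partial differential equation is solved. -/
theorem exists_finite_modes (s : Finset ℕ) (lam bet kap y₀ : ℕ → ℝ) :
    ∃ Y : ℕ → ℝ → ℝ, (∀ n ∈ s, Y n 0 = y₀ n) ∧ (∀ n ∈ s, ContDiff ℝ 2 (Y n)) ∧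
      ∀ n ∈ s, ∀ t, HasDerivAt (Y n) (lam n * Y n t + bet n * ∑ m ∈ s, kap m * Y m t) t := by
  classical
  let A : (s → ℝ) →L[ℝ] (s → ℝ) := ContinuousLinearMap.pi fun n =>
    lam n • ContinuousLinearMap.proj (R := ℝ) (φ := fun _ : s => ℝ) n
      + bet n • ∑ m : s, kap m • ContinuousLinearMap.proj (R := ℝ) (φ := fun _ : s => ℝ) m
  let Z : ℝ → (s → ℝ) := fun t => NormedSpace.exp (t • A) (fun n => y₀ n)
  have hZ : ∀ t, HasDerivAt Z (A (Z t)) t := by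
    intro t
    have h := (hasDerivAt_exp_smul_const' A t).clm_apply
      (hasDerivAt_const t (fun n : s => y₀ n))
    refine h.congr_deriv ?_
    simp [Z]
  refine ⟨fun n t => if h : n ∈ s then Z t ⟨n, h⟩ else 0, ?_, ?_, ?_⟩
  · intro n hn
    simp [hn, Z]
  · intro n hn
    simp only [hn, dite_true]
    exact (contDiff_pi.1 (contDiff_of_hasDerivAt_clm hZ 2)) ⟨n, hn⟩
  · intro n hn t
    simp only [hn, dite_true]
    refine ((hasDerivAt_pi.1 (hZ t)) ⟨n, hn⟩).congr_deriv ?_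
    simp only [A, ContinuousLinearMap.coe_pi', add_apply,
      smul_apply, ContinuousLinearMap.proj_apply, smul_eq_mul,
      sum_apply]
    congr 2
    rw [← Finset.sum_coe_sort s]
    refine Finset.sum_congr rfl fun m _ => ?_
    simp

/-- Existence for the plant with the feedback `u(t,1) = ρ ∫ k u`. -/
theorem exists_feedback_solution {p : ℝ} (hp : 0 < p) (θ θh ρ : ℝ) (K : FeedbackGains) (u₀ : L2) :
    ∃ u : ℝ → L2, ContinuousOn u (Ici 0) ∧ u 0 = u₀ ∧
      IsClassicalOn p θ (Ioi 0) (fun t => ρ * pair (K.kernel θh) (u t)) u := by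
  set s := Finset.Icc 1 (K.N θh) with hs
  set kap : ℕ → ℝ := fun m => ρ * (Real.sqrt 2 * K.coeff θh m) with hkap
  obtain ⟨Y, hY0, hYc, hYd⟩ := exists_finite_modes s (fun n => θ - p * (n * Real.pi) ^ 2)
    (fun n => -(p * (-1) ^ n * (n * Real.pi))) kap (fun n => coef n u₀)
  set w : ℝ → ℝ := fun t => ∑ m ∈ s, kap m * Y m t with hw
  have hwc : ContDiff ℝ 2 w := ContDiff.sum fun m hm => contDiff_const.mul (hYc m hm)
  obtain ⟨u, huc, hu0, hu⟩ := exists_heat_solution hp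
    (w := fun t => Real.exp (-θ * t) * w t) (by fun_prop) u₀
  have hu2 := (hu.exp_smul θ).congr (b' := w) fun t _ => by
    simp only [← mul_assoc, ← Real.exp_add]; simp
  have huc2 : ContinuousOn (fun t => Real.exp (θ * t) • u t) (Ici 0) := by fun_prop
  refine ⟨fun t => Real.exp (θ * t) • u t, huc2, by simp [hu0], hu2.congr fun t ht => ?_⟩
  -- The constructed state and `Y` satisfy the same modal equations with the same input `w`. So the
  -- low modes are `Y`, and the prescribed boundary value is the feedback.
  have hmodes : ∀ n ∈ s, coef n (Real.exp (θ * t) • u t) = Y n t := by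
    intro n hn
    refine sub_eq_zero.1 (mode_eq_zero (α := 0) (β := t)
      (d := fun t => coef n (Real.exp (θ * t) • u t) - Y n t)
      (l := θ - p * (n * Real.pi) ^ 2) ?_ ?_ ?_ t ⟨le_of_lt ht, le_rfl⟩)
    · exact ((continuous_coef n).comp_continuousOn (huc2.mono Icc_subset_Ici_self)).sub
        (hYc n hn).continuous.continuousOn
    · intro r hr
      exact ((hasDerivAt_coef hu2 le_rfl Ioo_subset_Ioi_self hr n).sub (hYd n hn r)).congr_deriv
        (by simp only [hw]; ring)
    · simp [hu0, hY0 n hn]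
  rw [pair_kernel, hw, Finset.mul_sum]
  refine Finset.sum_congr rfl fun n hn => ?_
  rw [hmodes n hn, hkap]; ring

/-! ### The least-squares identifier -/

theorem gram_congr {μ τ : ℝ} (h : μ ≤ τ) {f f' g g' : ℝ → ℝ → ℝ}
    (hf : ∀ t ∈ Icc μ τ, ∀ s ∈ Icc μ τ, f t s = f' t s)
    (hg : ∀ t ∈ Icc μ τ, ∀ s ∈ Icc μ τ, g t s = g' t s) : gram μ τ f g = gram μ τ f' g' := by
  refine intervalIntegral.integral_congr fun t ht => intervalIntegral.integral_congr fun s hs => ?_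
  rw [uIcc_of_le h] at ht hs
  simp only [hf t ht s hs, hg t ht s hs]

theorem gram_comm (μ τ : ℝ) (f g : ℝ → ℝ → ℝ) : gram μ τ f g = gram μ τ g f := by
  simp only [gram, mul_comm]

theorem gram_comb {μ τ : ℝ} {f g h : ℝ → ℝ → ℝ} (hf : Continuous f.uncurry)
    (hg : Continuous g.uncurry) (hh : Continuous h.uncurry) (a b : ℝ) :
    gram μ τ (fun t s => a * f t s + b * g t s) h = a * gram μ τ f h + b * gram μ τ g h := by
  have hsl : ∀ {f : ℝ → ℝ → ℝ}, Continuous f.uncurry → ∀ t, Continuous (f t) := fun hf t =>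
    hf.comp (by fun_prop : Continuous fun s : ℝ => (t, s))
  have hint : ∀ {f : ℝ → ℝ → ℝ}, Continuous f.uncurry →
      Continuous fun t => ∫ s in μ..τ, f t s * h t s := fun {f} hf =>
    intervalIntegral.continuous_parametric_intervalIntegral_of_continuous'
      (f := fun t s => f t s * h t s) (hf.mul hh) μ τ
  simp only [gram]
  rw [← intervalIntegral.integral_const_mul, ← intervalIntegral.integral_const_mul,
    ← intervalIntegral.integral_add (((hint hf).const_mul a).intervalIntegrable _ _)
      (((hint hg).const_mul b).intervalIntegrable _ _)]
  congr 1
  ext t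
  have h1 := hsl hf t
  have h2 := hsl hg t
  have h3 := hsl hh t
  rw [← intervalIntegral.integral_const_mul, ← intervalIntegral.integral_const_mul,
    ← intervalIntegral.integral_add (Continuous.intervalIntegrable (by fun_prop) _ _)
      (Continuous.intervalIntegrable (by fun_prop) _ _)]
  congr 1
  ext s
  ring

theorem eq_zero_of_gram_self_eq_zero {μ τ : ℝ} (hμ : μ < τ) {h : ℝ → ℝ → ℝ}
    (hh : Continuous h.uncurry) (h0 : gram μ τ h h = 0) :
    ∀ t ∈ Icc μ τ, ∀ s ∈ Icc μ τ, h t s = 0 := by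
  intro t ht s hs
  by_contra hne
  have hcs : Continuous fun s => h t s * h t s :=
    (hh.comp (by fun_prop : Continuous fun s : ℝ => (t, s))).mul
      (hh.comp (by fun_prop : Continuous fun s : ℝ => (t, s)))
  have h1 : 0 < ∫ s in μ..τ, h t s * h t s :=
    intervalIntegral.integral_pos hμ hcs.continuousOn (fun _ _ => mul_self_nonneg _)
      ⟨s, hs, mul_self_pos.2 hne⟩
  have h2 : 0 < gram μ τ h h :=
    intervalIntegral.integral_pos hμ
      (intervalIntegral.continuous_parametric_intervalIntegral_of_continuous'
        (f := fun t s => h t s * h t s) (hh.mul hh) μ τ).continuousOn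
      (fun t _ => intervalIntegral.integral_nonneg hμ.le fun _ _ => mul_self_nonneg _)
      ⟨t, ht, h1⟩
  exact h2.ne' h0

/-- The window is half-open because the input at its right end already uses the updated estimates;
that single time does not affect the integrals. -/
theorem regJ_eq_zero {p : ℝ} {U : ℝ → ℝ} {μ τ : ℝ} (hU : ∀ σ ∈ Ico μ τ, U σ = 0) (n : ℕ) :
    ∀ t ∈ Icc μ τ, ∀ s ∈ Icc μ τ, regJ p U n t s = 0 := by
  intro t ht s hs
  have : ∫ σ in s..t, U σ = 0 := by
    refine intervalIntegral.integral_zero_ae ?_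
    filter_upwards [Measure.ae_ne volume τ] with σ hσ hm
    refine hU σ ⟨?_, lt_of_le_of_ne ?_ hσ⟩
    · exact (le_min hs.1 ht.1).trans hm.1.le
    · exact hm.2.trans (max_le hs.2 ht.2)
  rw [regJ, this, mul_zero]

/-- The integrated form of the plant equations in sine modes, with a right-continuous input. -/
structure IsPlantTrajectory (p θ c : ℝ) (u : ℝ → L2) (U : ℝ → ℝ) : Prop where
  continuous : Continuous u
  intervalIntegrable : ∀ s t, IntervalIntegrable U volume s t
  rightContinuous : ∀ t, ContinuousWithinAt U (Ioi t) t
  modes : ∀ n s t, 0 ≤ s → 0 ≤ t → coef n (u t) - coef n (u s) = ∫ σ in s..t,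
    ((θ - p * (n * Real.pi) ^ 2) * coef n (u σ) - p * (-1) ^ n * (n * Real.pi) * (c * U σ))

namespace IsPlantTrajectory

variable {p θ c : ℝ} {u : ℝ → L2} {U : ℝ → ℝ} (h : IsPlantTrajectory p θ c u U)
include h

theorem continuous_coef (n : ℕ) : Continuous fun t => coef n (u t) :=
  (AdaptiveHeat.continuous_coef n).comp h.continuous

/-- The integrated modal equation is linear in the unknown parameters, and the term with `n²π²p` in
`f_n` moves the known diffusion to the left side. There is no residual. -/
theorem regF_eq (n : ℕ) {t s : ℝ} (ht : 0 ≤ t) (hs : 0 ≤ s) :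
    regF p u n t s = θ * regG u n t s + c * regJ p U n t s := by
  have h1 : regF p u n t s = coef n (u t - u s) + (n : ℝ) ^ 2 * Real.pi ^ 2 * p *
      ∫ σ in s..t, coef n (u σ) := rfl
  have h2 : regG u n t s = ∫ σ in s..t, coef n (u σ) := rfl
  have ic : IntervalIntegrable (fun σ => coef n (u σ)) volume s t :=
    (h.continuous_coef n).intervalIntegrable _ _
  have iU := h.intervalIntegrable s t
  rw [h1, h2, regJ, coef_sub, h.modes n s t hs ht,
    intervalIntegral.integral_sub (ic.const_mul _) ((iU.const_mul c).const_mul _),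
    intervalIntegral.integral_const_mul, intervalIntegral.integral_const_mul,
    intervalIntegral.integral_const_mul]
  ring

theorem continuous_regG (n : ℕ) : Continuous (regG u n).uncurry := by
  have hc : Continuous fun t => ∫ σ in (0 : ℝ)..t, coef n (u σ) :=
    intervalIntegral.continuous_primitive
      (fun a b => (h.continuous_coef n).intervalIntegrable a b) 0
  have : (regG u n).uncurry = fun q : ℝ × ℝ =>
      (∫ σ in (0 : ℝ)..q.1, coef n (u σ)) - ∫ σ in (0 : ℝ)..q.2, coef n (u σ) := by
    ext q
    rw [intervalIntegral.integral_interval_sub_left ((h.continuous_coef n).intervalIntegrable _ _)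
      ((h.continuous_coef n).intervalIntegrable _ _)]
    rfl
  rw [this]
  exact (hc.comp continuous_fst).sub (hc.comp continuous_snd)

theorem continuous_regJ (n : ℕ) : Continuous (regJ p U n).uncurry := by
  have hc : Continuous fun t => ∫ σ in (0 : ℝ)..t, U σ :=
    intervalIntegral.continuous_primitive h.intervalIntegrable 0
  have : (regJ p U n).uncurry = fun q : ℝ × ℝ => -(-1 : ℝ) ^ n * p * n * Real.pi *
      ((∫ σ in (0 : ℝ)..q.1, U σ) - ∫ σ in (0 : ℝ)..q.2, U σ) := by
    ext q
    rw [intervalIntegral.integral_interval_sub_left (h.intervalIntegrable _ _)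
      (h.intervalIntegrable _ _)]
    rfl
  rw [this]
  exact continuous_const.mul ((hc.comp continuous_fst).sub (hc.comp continuous_snd))

/-- After subtraction of the exact identity for `f_n`, the normal equations say that the combination
`d` is orthogonal to `g_n` and to `j_n`. As `d` lies in their span, it is orthogonal to itself, and
by continuity it vanishes pointwise. -/
theorem mem_estimateSet_iff {μ τ : ℝ} (hμ : 0 ≤ μ) (hτ : μ < τ) (q : EuclideanSpace ℝ (Fin 2)) :
    q ∈ estimateSet p u U μ τ ↔ ∀ n, 1 ≤ n → ∀ t ∈ Icc μ τ, ∀ s ∈ Icc μ τ,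
      (q 0 - θ) * regG u n t s + (q 1 - c) * regJ p U n t s = 0 := by
  refine forall_congr' fun n => imp_congr_right fun _ => ?_
  have hG := h.continuous_regG n
  have hJ := h.continuous_regJ n
  have hF : ∀ t ∈ Icc μ τ, ∀ s ∈ Icc μ τ,
      regF p u n t s = θ * regG u n t s + c * regJ p U n t s := fun t ht s hs =>
    h.regF_eq n (hμ.trans ht.1) (hμ.trans hs.1)
  rw [gram_congr hτ.le hF (fun _ _ _ _ => rfl) (g' := regG u n),
    gram_congr hτ.le hF (fun _ _ _ _ => rfl) (g' := regJ p U n),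
    gram_comb hG hJ hG, gram_comb hG hJ hJ, gram_comm μ τ (regJ p U n) (regG u n)]
  set gg := gram μ τ (regG u n) (regG u n)
  set gj := gram μ τ (regG u n) (regJ p U n)
  set jj := gram μ τ (regJ p U n) (regJ p U n)
  set d : ℝ → ℝ → ℝ := fun t s => (q 0 - θ) * regG u n t s + (q 1 - c) * regJ p U n t s with hd
  have hdc : Continuous d.uncurry := (hG.const_mul _).add (hJ.const_mul _)
  have hdG : gram μ τ d (regG u n) = (q 0 - θ) * gg + (q 1 - c) * gj := by
    rw [hd, gram_comb hG hJ hG, gram_comm μ τ (regJ p U n) (regG u n)]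
  have hdJ : gram μ τ d (regJ p U n) = (q 0 - θ) * gj + (q 1 - c) * jj := by
    rw [hd, gram_comb hG hJ hJ]
  constructor
  · rintro ⟨h1, h2⟩
    refine eq_zero_of_gram_self_eq_zero hτ hdc ?_
    have : gram μ τ d d = (q 0 - θ) * gram μ τ (regG u n) d + (q 1 - c) * gram μ τ (regJ p U n) d :=
      gram_comb hG hJ hdc _ _
    rw [this, gram_comm μ τ (regG u n) d, gram_comm μ τ (regJ p U n) d, hdG, hdJ]
    linear_combination (θ - q 0) * h1 + (c - q 1) * h2
  · intro h0
    have hz : ∀ g : ℝ → ℝ → ℝ, gram μ τ d g = 0 := by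
      intro g
      rw [gram_congr hτ.le (f' := fun _ _ => 0) (g' := g) h0 (fun _ _ _ _ => rfl)]
      simp [gram]
    rw [hz] at hdG hdJ
    constructor <;> linarith

/-- Differentiating the vanishing regressor combination from the right. -/
theorem combination_eq_zero {d₀ d₁ μ τ : ℝ} {n : ℕ}
    (h0 : ∀ t ∈ Icc μ τ, ∀ s ∈ Icc μ τ, d₀ * regG u n t s + d₁ * regJ p U n t s = 0)
    {σ : ℝ} (hσ : σ ∈ Ico μ τ) :
    d₀ * coef n (u σ) + d₁ * (-(-1 : ℝ) ^ n * p * n * Real.pi * U σ) = 0 := by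
  set ψ : ℝ → ℝ := fun σ => d₀ * coef n (u σ) + d₁ * (-(-1 : ℝ) ^ n * p * n * Real.pi * U σ)
  have hi : ∀ s t, IntervalIntegrable ψ volume s t := fun s t =>
    (((h.continuous_coef n).intervalIntegrable s t).const_mul _).add
      (((h.intervalIntegrable s t).const_mul _).const_mul _)
  have hval : ∀ t ∈ Icc μ τ, ∫ r in σ..t, ψ r = 0 := by
    intro t ht
    rw [← h0 t ht σ (Ico_subset_Icc_self hσ), intervalIntegral.integral_add
      (((h.continuous_coef n).intervalIntegrable _ _).const_mul _)
      (((h.intervalIntegrable _ _).const_mul _).const_mul _),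
      intervalIntegral.integral_const_mul, intervalIntegral.integral_const_mul,
      intervalIntegral.integral_const_mul]
    rfl
  have hr : ContinuousWithinAt ψ (Ioi σ) σ :=
    ((h.continuous_coef n).continuousWithinAt.const_mul _).add
      (((h.rightContinuous σ).const_mul _).const_mul _)
  -- The input may jump at events, so only the right derivative is available; it also covers `σ =
  -- μ`.
  have hder : HasDerivWithinAt (fun t => ∫ r in σ..t, ψ r) (ψ σ) (Ici σ) σ :=
    intervalIntegral.integral_hasDerivWithinAt_right (hi σ σ)
      ⟨Ioc σ (σ + 1), Ioc_mem_nhdsGT (by linarith), (hi σ (σ + 1)).1.aestronglyMeasurable⟩ hr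
  have hder0 : HasDerivWithinAt (fun t => ∫ r in σ..t, ψ r) 0 (Ici σ) σ := by
    refine (hasDerivWithinAt_const σ (Ici σ) (0 : ℝ)).congr_of_eventuallyEq ?_ (by simp)
    filter_upwards [Icc_mem_nhdsGE hσ.2] with t ht
    exact hval t ⟨hσ.1.trans ht.1, ht.2⟩
  exact (uniqueDiffWithinAt_Ici σ).eq_deriv _ hder hder0

/-- A wrong first coordinate would make `|coef n (u σ)|` proportional to `n`. Coefficients of an
`L²` function tend to zero, so the factor `γ` is zero, then all coefficients are, against `u σ ≠ 0`.
-/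
theorem fst_eq_of_mem_estimateSet {μ τ : ℝ} (hμ : 0 ≤ μ)
    {q : EuclideanSpace ℝ (Fin 2)} (hq : q ∈ estimateSet p u U μ τ) {σ : ℝ} (hσ : σ ∈ Ico μ τ)
    (hu : u σ ≠ 0) : q 0 = θ := by
  by_contra hne
  have hne' : q 0 - θ ≠ 0 := sub_ne_zero.2 hne
  have h0 : ∀ n, 1 ≤ n → (q 0 - θ) * coef n (u σ)
      + (q 1 - c) * (-(-1 : ℝ) ^ n * p * n * Real.pi * U σ) = 0 := fun n hn =>
    h.combination_eq_zero ((h.mem_estimateSet_iff hμ (hσ.1.trans_lt hσ.2) q).1 hq n hn) hσ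
  set γ := (q 1 - c) * p * Real.pi * U σ with hγ
  have habs : ∀ n : ℕ, 1 ≤ n → |q 0 - θ| * |coef n (u σ)| = n * |γ| := by
    intro n hn
    have h1 : (q 0 - θ) * coef n (u σ) = (-1) ^ n * (n * γ) := by
      rw [hγ]; linear_combination h0 n hn
    rw [← abs_mul, h1, abs_mul, abs_pow, abs_neg, abs_one, one_pow, one_mul, abs_mul, Nat.abs_cast]
  have hγ0 : γ = 0 := by
    by_contra hγ0
    have ht : Tendsto (fun n : ℕ => |q 0 - θ| * |coef n (u σ)|) atTop (𝓝 0) := by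
      simpa using ((tendsto_coef (u σ)).abs.const_mul |q 0 - θ|)
    have hev := ht.eventually (gt_mem_nhds (abs_pos.2 hγ0))
    obtain ⟨n, hn, hn1⟩ := (hev.and (eventually_ge_atTop 1)).exists
    rw [habs n hn1] at hn
    have : (1 : ℝ) ≤ n := by exact_mod_cast hn1
    nlinarith [abs_nonneg γ]
  refine hu (eq_zero_of_coef_eq_zero _ fun n hn => ?_)
  have := habs n hn
  rw [hγ0, abs_zero, mul_zero] at this
  rcases mul_eq_zero.1 this with h1 | h1
  · exact absurd (abs_eq_zero.1 h1) hne'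
  · exact abs_eq_zero.1 h1

/-- Once `θ` is known the combination reduces to the input term, and a single mode suffices. -/
theorem snd_eq_of_mem_estimateSet (hp : 0 < p) {μ τ : ℝ} (hμ : 0 ≤ μ)
    {q : EuclideanSpace ℝ (Fin 2)} (hq : q ∈ estimateSet p u U μ τ) (hq0 : q 0 = θ) {σ : ℝ}
    (hσ : σ ∈ Ico μ τ) (hU : U σ ≠ 0) : q 1 = c := by
  have h0 := h.combination_eq_zero
    ((h.mem_estimateSet_iff hμ (hσ.1.trans_lt hσ.2) q).1 hq 1 le_rfl) hσ
  rw [hq0, sub_self, zero_mul, zero_add] at h0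
  rcases mul_eq_zero.1 h0 with h1 | h1
  · exact sub_eq_zero.1 h1
  · have hpi := Real.pi_ne_zero
    simp [hp.ne', hpi, hU] at h1

/-- The true parameters always satisfy the normal equations. -/
theorem mem_estimateSet {μ τ : ℝ} (hμ : 0 ≤ μ) (hτ : μ < τ) {q : EuclideanSpace ℝ (Fin 2)}
    (hq0 : q 0 = θ) (hq1 : q 1 = c ∨ ∀ σ ∈ Ico μ τ, U σ = 0) : q ∈ estimateSet p u U μ τ := by
  rw [h.mem_estimateSet_iff hμ hτ]
  intro n _ t ht s hs
  rcases hq1 with h1 | h1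
  · rw [hq0, h1]; ring
  · rw [hq0, regJ_eq_zero h1 n t ht s hs]; ring

theorem estimateSet_eq_univ {μ τ : ℝ} (hμ : 0 ≤ μ) (hτ : μ < τ) (hu : ∀ σ ∈ Ico μ τ, u σ = 0)
    (hU : ∀ σ ∈ Ico μ τ, U σ = 0) : estimateSet p u U μ τ = univ := by
  refine eq_univ_of_forall fun q => (h.mem_estimateSet_iff hμ hτ q).2 fun n _ t ht s hs => ?_
  have : regG u n t s = 0 := by
    refine intervalIntegral.integral_zero_ae ?_
    filter_upwards [Measure.ae_ne volume τ] with σ hσ hm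
    rw [hu σ ⟨(le_min hs.1 ht.1).trans hm.1.le,
      lt_of_le_of_ne (hm.2.trans (max_le hs.2 ht.2)) hσ⟩, pair_zero_right]
  rw [this, regJ_eq_zero hU n t ht s hs]; ring

/-- The update of the estimates. -/
theorem isProj (hp : 0 < p) {μ τ : ℝ} (hμ : 0 ≤ μ) (hτ : μ < τ) {a b a' b' : ℝ}
    (hzero : (∀ σ ∈ Ico μ τ, u σ = 0) → a' = a ∧ b' = b ∧ ∀ σ ∈ Ico μ τ, U σ = 0)
    (hne : (∃ σ ∈ Ico μ τ, u σ ≠ 0) → a' = θ)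
    (hU0 : (∀ σ ∈ Ico μ τ, U σ = 0) → b' = b)
    (hU : (∃ σ ∈ Ico μ τ, U σ ≠ 0) → b' = c) :
    IsProj (estimateSet p u U μ τ) !₂[a, b] !₂[a', b'] := by
  by_cases hu : ∀ σ ∈ Ico μ τ, u σ = 0
  · obtain ⟨rfl, rfl, hz⟩ := hzero hu
    rw [h.estimateSet_eq_univ hμ hτ hu hz]
    exact ⟨mem_univ _, fun y _ => by rw [dist_self]; exact dist_nonneg⟩
  · push Not at hu
    have ha := hne hu
    obtain ⟨σ, hσ, huσ⟩ := hu
    -- Without input, all admissible points have first coordinate `θ` and the second is free, so the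
    -- projection leaves the second estimate alone. With input, the only admissible point is `(θ,
    -- c)`.
    by_cases hz : ∀ σ ∈ Ico μ τ, U σ = 0
    · obtain rfl := hU0 hz
      refine ⟨h.mem_estimateSet hμ hτ (by simp [ha]) (Or.inr hz), fun y hy => ?_⟩
      have hy0 := h.fst_eq_of_mem_estimateSet hμ hy hσ huσ
      rw [EuclideanSpace.dist_eq, EuclideanSpace.dist_eq]
      refine Real.sqrt_le_sqrt ?_
      simp only [Fin.sum_univ_two, Matrix.cons_val_zero, Matrix.cons_val_one, dist_self, hy0, ha]
      have := sq_nonneg (dist b' (y 1))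
      simp only [ne_eq, OfNat.ofNat_ne_zero, not_false_eq_true, zero_pow, add_zero]
      linarith
    · push Not at hz
      obtain rfl := hU hz
      obtain ⟨σ', hσ', hUσ'⟩ := hz
      refine ⟨h.mem_estimateSet hμ hτ (by simp [ha]) (Or.inl (by simp)), fun y hy => ?_⟩
      have hy0 := h.fst_eq_of_mem_estimateSet hμ hy hσ huσ
      have hy1 := h.snd_eq_of_mem_estimateSet hp hμ hy hy0 hσ' hUσ'
      refine le_of_eq (congrArg _ ?_)
      ext i
      fin_cases i
      · simp [ha, hy0]
      · simp [hy1]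

end IsPlantTrajectory

/-! ### Event times -/

/-- `e` is the next event time after `s`, for the threshold factor `ρ`. -/
structure IsNextEvent (u : ℝ → L2) (ρ T s e : ℝ) : Prop where
  lt : s < e
  le : e ≤ s + T
  of_zero : u s = 0 → e = s + T
  no_hit : u s ≠ 0 → ∀ t ∈ Ioo s e, ‖u t‖ ≠ ρ * ‖u s‖
  hit : u s ≠ 0 → e = s + T ∨ ‖u e‖ = ρ * ‖u s‖

/-- The strict inequality at `s` excludes `s` itself from the closed hitting set, so its least
element is a genuine later time. -/
theorem exists_first_hit {u : ℝ → L2} {s L : ℝ} (hu : ContinuousOn u (Ici s)) (hs : ‖u s‖ < L)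
    {t : ℝ} (ht : s < t) (htL : ‖u t‖ = L) :
    ∃ m, IsLeast {t : ℝ | s < t ∧ ‖u t‖ = L} m := by
  have hc : ContinuousOn (fun t => ‖u t‖) (Icc s t) := (hu.mono Icc_subset_Ici_self).norm
  have hK : IsCompact (Icc s t ∩ (fun t => ‖u t‖) ⁻¹' {L}) :=
    isCompact_Icc.of_isClosed_subset (hc.preimage_isClosed_of_isClosed isClosed_Icc
      isClosed_singleton) inter_subset_left
  obtain ⟨m, ⟨hm, hmL⟩, hmin⟩ := hK.exists_isLeast ⟨t, ⟨ht.le, le_rfl⟩, htL⟩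
  have hmL' : ‖u m‖ = L := hmL
  refine ⟨m, ⟨lt_of_le_of_ne hm.1 fun h => ?_, hmL'⟩, fun r hr => ?_⟩
  · rw [← h] at hmL'; exact hs.ne hmL'
  · rcases le_total r t with h | h
    · exact hmin ⟨⟨hr.1.le, h⟩, hr.2⟩
    · exact hm.2.trans h

/-- Because the threshold exceeds the norm at `s`, the infimum in the trigger is attained whenever
there is a hit. The extended-real formula thus becomes conditions on real times. -/
theorem event_succ_iff {R : ℝ → ℝ} {T a : ℝ} {z : Trajectory} {i : ℕ} (hT : 0 < T)
    (hu : ContinuousOn z.u (Ici (z.τ i))) (hR : 1 < R (z.thetaHat (z.τ i)) * (1 + a)) :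
    ((z.τ (i + 1) : ℝ) : EReal) = min ((z.τ i + T : ℝ) : EReal) (triggerTime R T a z i) ↔
      IsNextEvent z.u (R (z.thetaHat (z.τ i)) * (1 + a)) T (z.τ i) (z.τ (i + 1)) := by
  set ρ := R (z.thetaHat (z.τ i)) * (1 + a) with hρ
  set s := z.τ i with hs
  set e := z.τ (i + 1) with he
  by_cases h0 : z.u s = 0
  · rw [triggerTime, if_pos h0, min_self, EReal.coe_eq_coe_iff]
    constructor
    · intro h
      exact ⟨by linarith, h.le, fun _ => h, fun h1 => absurd h0 h1, fun h1 => absurd h0 h1⟩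
    · exact fun h => h.of_zero h0
  · have hpos : 0 < ‖z.u s‖ := norm_pos_iff.2 h0
    have hL : ‖z.u s‖ < ρ * ‖z.u s‖ := by nlinarith
    rw [triggerTime, if_neg h0]
    by_cases hA : ∃ t, s < t ∧ ‖z.u t‖ = ρ * ‖z.u s‖
    · obtain ⟨t, ht, htL⟩ := hA
      obtain ⟨m, hm⟩ := exists_first_hit hu hL ht htL
      have hI : sInf ((fun t : ℝ => (t : EReal)) '' {t : ℝ | s < t ∧ ‖z.u t‖ = ρ * ‖z.u s‖})
          = (m : EReal) :=
        (EReal.coe_strictMono.monotone.map_isLeast hm).isGLB.sInf_eq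
      rw [hI, ← EReal.coe_strictMono.monotone.map_min, EReal.coe_eq_coe_iff]
      have hmL : ‖z.u m‖ = ρ * ‖z.u s‖ := hm.1.2
      have hsm : s < m := hm.1.1
      constructor
      · intro h
        refine ⟨?_, ?_, fun h1 => absurd h1 h0, fun _ t ht htL => ?_, fun _ => ?_⟩
        · rw [h]; exact lt_min (by linarith) hsm
        · rw [h]; exact min_le_left _ _
        · have := hm.2 ⟨ht.1, htL⟩
          rw [h] at ht
          exact absurd (this.trans_lt ht.2) (not_lt.2 (min_le_right _ _))
        · rcases le_total (s + T) m with h1 | h1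
          · left; rw [h, min_eq_left h1]
          · right; rw [h, min_eq_right h1, hmL]
      · intro h
        have h1 : e ≤ m := by
          by_contra hlt
          push Not at hlt
          exact h.no_hit h0 m ⟨hsm, hlt⟩ hmL
        rcases h.hit h0 with h2 | h2
        · rw [h2] at h1 ⊢; exact (min_eq_left h1).symm
        · have h3 : m ≤ e := hm.2 ⟨h.lt, h2⟩
          rw [min_eq_right (h3.trans h.le)]
          exact le_antisymm h1 h3
    · push Not at hA
      have hE : {t : ℝ | s < t ∧ ‖z.u t‖ = ρ * ‖z.u s‖} = ∅ :=
        eq_empty_of_forall_notMem fun t ht => hA t ht.1 ht.2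
      rw [hE, image_empty, sInf_empty, min_eq_left le_top, EReal.coe_eq_coe_iff]
      constructor
      · intro h
        exact ⟨by linarith, h.le, fun h1 => absurd h1 h0, fun _ t ht => hA t ht.1, fun _ => Or.inl h⟩
      · intro h
        exact (h.hit h0).resolve_right (hA e h.lt)

/-- Causality of the trigger: an event strictly earlier than the other one is not a timeout, so it
is a hit, and the other state would hit there as well. -/
theorem IsNextEvent.le_of_eqOn {u u' : ℝ → L2} {ρ T s e e' : ℝ} (h : IsNextEvent u ρ T s e)
    (h' : IsNextEvent u' ρ T s e') (heq : EqOn u u' (Icc s (min e e'))) : e' ≤ e := by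
  by_contra hlt
  push Not at hlt
  rw [min_eq_left hlt.le] at heq
  have h1 : e ≠ s + T := fun h1 => by linarith [h'.le]
  have h2 : u s ≠ 0 := fun h2 => h1 (h.of_zero h2)
  have hs : u s = u' s := heq ⟨le_rfl, h.lt.le⟩
  have h3 := (h.hit h2).resolve_left h1
  rw [heq ⟨h.lt.le, le_rfl⟩, hs] at h3
  exact h'.no_hit (hs ▸ h2) e ⟨h.lt, hlt⟩ h3

theorem IsNextEvent.eq_of_eqOn {u u' : ℝ → L2} {ρ T s e e' : ℝ} (h : IsNextEvent u ρ T s e)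
    (h' : IsNextEvent u' ρ T s e') (heq : EqOn u u' (Icc s (min e e'))) : e = e' :=
  le_antisymm (h'.le_of_eqOn h (by rw [min_comm]; exact heq.symm)) (h.le_of_eqOn h' heq)

theorem exists_isNextEvent {u : ℝ → L2} {ρ T s : ℝ} (hT : 0 < T) (hρ : 1 < ρ)
    (hu : ContinuousOn u (Ici s)) : ∃ e, IsNextEvent u ρ T s e := by
  by_cases h0 : u s = 0
  · exact ⟨s + T, by linarith, le_rfl, fun _ => rfl, fun h => absurd h0 h, fun h => absurd h0 h⟩
  · have hpos : 0 < ‖u s‖ := norm_pos_iff.2 h0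
    have hL : ‖u s‖ < ρ * ‖u s‖ := by nlinarith
    by_cases hA : ∃ t, s < t ∧ ‖u t‖ = ρ * ‖u s‖
    · obtain ⟨t, ht, htL⟩ := hA
      obtain ⟨m, hm⟩ := exists_first_hit hu hL ht htL
      refine ⟨min (s + T) m, lt_min (by linarith) hm.1.1, min_le_left _ _, fun h => absurd h h0,
        fun _ t ht htL => ?_, fun _ => ?_⟩
      · exact absurd ((hm.2 ⟨ht.1, htL⟩).trans_lt ht.2) (not_lt.2 (min_le_right _ _))
      · rcases le_total (s + T) m with h1 | h1
        · left; exact min_eq_left h1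
        · right; rw [min_eq_right h1]; exact hm.1.2
    · push Not at hA
      exact ⟨s + T, by linarith, le_rfl, fun h => absurd h h0, fun _ t ht => hA t ht.1,
        fun _ => Or.inl rfl⟩

/-- By the intermediate value theorem the norm cannot exceed the threshold without attaining it
earlier. -/
theorem IsNextEvent.norm_le {u : ℝ → L2} {ρ T s e : ℝ} (h : IsNextEvent u ρ T s e) (hρ : 1 < ρ)
    (hu : ContinuousOn u (Icc s e)) (h0 : u s ≠ 0) : ∀ t ∈ Icc s e, ‖u t‖ ≤ ρ * ‖u s‖ := by
  have hpos : 0 < ‖u s‖ := norm_pos_iff.2 h0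
  have hL : ‖u s‖ < ρ * ‖u s‖ := by nlinarith
  have hlt : ∀ t ∈ Ico s e, ‖u t‖ ≤ ρ * ‖u s‖ := by
    intro t ht
    by_contra hgt
    push Not at hgt
    have hc : ContinuousOn (fun t => ‖u t‖) (Icc s t) :=
      (hu.mono (Icc_subset_Icc_right ht.2.le)).norm
    obtain ⟨r, hr, hrL⟩ := intermediate_value_Icc ht.1 hc ⟨hL.le, hgt.le⟩
    have hrL' : ‖u r‖ = ρ * ‖u s‖ := hrL
    refine h.no_hit h0 r ⟨lt_of_le_of_ne hr.1 fun h1 => ?_, hr.2.trans_lt ht.2⟩ hrL'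
    rw [← h1] at hrL'; exact hL.ne hrL'
  intro t ht
  rcases ht.2.lt_or_eq with h1 | h1
  · exact hlt t ⟨ht.1, h1⟩
  · have hcl : closure (Ico s e) = Icc s e := closure_Ico h.lt.ne
    have : t ∈ closure (Ico s e) := by rw [hcl]; exact ht
    exact le_on_closure (f := fun t => ‖u t‖) (g := fun _ => ρ * ‖u s‖) hlt
      (by rw [hcl]; exact hu.norm) continuousOn_const this

/-! ### Uniqueness of the closed-loop solution -/

/-- The parallelogram law: the midpoint of two distinct nearest points would be nearer. -/
theorem IsProj.unique {S : Set (EuclideanSpace ℝ (Fin 2))}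
    (hS : ∀ q ∈ S, ∀ q' ∈ S, (1 / 2 : ℝ) • (q + q') ∈ S) {x q q' : EuclideanSpace ℝ (Fin 2)}
    (h : IsProj S x q) (h' : IsProj S x q') : q = q' := by
  have h1 := h.2 _ (hS q h.1 q' h'.1)
  have h2 := h'.2 _ (hS q h.1 q' h'.1)
  simp only [dist_eq_norm] at h1 h2
  have hp := parallelogram_law_with_norm ℝ (x - q) (x - q')
  have e1 : (x - q) + (x - q') = (2 : ℝ) • (x - (1 / 2 : ℝ) • (q + q')) := by module
  have e2 : (x - q) - (x - q') = q' - q := by abel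
  rw [e1, e2, norm_smul, Real.norm_of_nonneg zero_le_two] at hp
  have h3 := norm_nonneg (x - q)
  have h4 := norm_nonneg (x - q')
  have h5 : ‖q' - q‖ = 0 := by
    by_contra hne
    have : 0 < ‖q' - q‖ := lt_of_le_of_ne (norm_nonneg _) (Ne.symm hne)
    nlinarith
  exact (sub_eq_zero.1 (norm_eq_zero.1 h5)).symm

theorem estimateSet_midpoint {p : ℝ} {u : ℝ → L2} {U : ℝ → ℝ} {μ τ : ℝ} :
    ∀ q ∈ estimateSet p u U μ τ, ∀ q' ∈ estimateSet p u U μ τ,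
      (1 / 2 : ℝ) • (q + q') ∈ estimateSet p u U μ τ := by
  intro q hq q' hq' n hn
  obtain ⟨h1, h2⟩ := hq n hn
  obtain ⟨h3, h4⟩ := hq' n hn
  simp only [PiLp.smul_apply, PiLp.add_apply, smul_eq_mul]
  constructor <;> linarith

theorem estimateSet_congr {p : ℝ} {u u' : ℝ → L2} {U U' : ℝ → ℝ} {μ τ : ℝ} (h : μ ≤ τ)
    (hu : EqOn u u' (Icc μ τ)) (hU : EqOn U U' (Ico μ τ)) :
    estimateSet p u U μ τ = estimateSet p u' U' μ τ := by
  have hG : ∀ n, ∀ t ∈ Icc μ τ, ∀ s ∈ Icc μ τ, regG u n t s = regG u' n t s := by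
    intro n t ht s hs
    refine intervalIntegral.integral_congr fun σ hσ => ?_
    simp only [hu (uIcc_subset_Icc hs ht hσ)]
  have hF : ∀ n, ∀ t ∈ Icc μ τ, ∀ s ∈ Icc μ τ, regF p u n t s = regF p u' n t s := by
    intro n t ht s hs
    have := hG n t ht s hs
    simp only [regG] at this
    simp only [regF, this, hu ht, hu hs]
  have hJ : ∀ n, ∀ t ∈ Icc μ τ, ∀ s ∈ Icc μ τ, regJ p U n t s = regJ p U' n t s := by
    intro n t ht s hs
    have : ∫ σ in s..t, U σ = ∫ σ in s..t, U' σ := by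
      refine intervalIntegral.integral_congr_ae ?_
      filter_upwards [Measure.ae_ne volume τ] with σ hσ hm
      exact hU ⟨(le_min hs.1 ht.1).trans hm.1.le,
        lt_of_le_of_ne (hm.2.trans (max_le hs.2 ht.2)) hσ⟩
    simp only [regJ, this]
  ext q
  refine forall_congr' fun n => imp_congr_right fun _ => ?_
  rw [gram_congr h (hF n) (hG n), gram_congr h (hF n) (hJ n), gram_congr h (hG n) (hG n),
    gram_congr h (hG n) (hJ n), gram_congr h (hJ n) (hJ n)]

section Uniqueness

variable {p θ c : ℝ} {K : FeedbackGains} {R : ℝ → ℝ} {T a : ℝ} {Ntilde : ℕ} {u₀ : L2}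
  {θ₀ c₀ : ℝ} {z z' : Trajectory}

theorem IsSolution.isNextEvent (h : IsSolution p θ c K R T a Ntilde u₀ θ₀ c₀ z) (hT : 0 < T)
    (hR : ∀ ϑ, 1 < R ϑ * (1 + a)) (i : ℕ) (hi : 0 ≤ z.τ i) :
    IsNextEvent z.u (R (z.thetaHat (z.τ i)) * (1 + a)) T (z.τ i) (z.τ (i + 1)) :=
  (event_succ_iff hT (h.state_continuous.mono (Ici_subset_Ici.2 hi)) (hR _)).1 (h.event_succ i)

theorem IsSolution.event_nonneg (h : IsSolution p θ c K R T a Ntilde u₀ θ₀ c₀ z) (hT : 0 < T)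
    (hR : ∀ ϑ, 1 < R ϑ * (1 + a)) (i : ℕ) : 0 ≤ z.τ i := by
  induction i with
  | zero => rw [h.event_zero]
  | succ i ih => exact ih.trans (h.isNextEvent hT hR i ih).lt.le

theorem IsSolution.event_strictMono (h : IsSolution p θ c K R T a Ntilde u₀ θ₀ c₀ z) (hT : 0 < T)
    (hR : ∀ ϑ, 1 < R ϑ * (1 + a)) : StrictMono z.τ :=
  strictMono_nat_of_lt_succ fun i => (h.isNextEvent hT hR i (h.event_nonneg hT hR i)).lt

theorem Ioo_subset_of_strictMono {τ : ℕ → ℝ} (hm : StrictMono τ) {i : ℕ} (hi : 0 ≤ τ i) :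
    Ioo (τ i) (τ (i + 1)) ⊆ Ici 0 \ range τ := by
  rintro t ⟨h1, h2⟩
  refine ⟨hi.trans h1.le, ?_⟩
  rintro ⟨j, rfl⟩
  have h3 := hm.lt_iff_lt.1 h1
  have h4 := hm.lt_iff_lt.1 h2
  omega

/-- Two solutions coincide up to each event time. -/
theorem IsSolution.agree (h : IsSolution p θ c K R T a Ntilde u₀ θ₀ c₀ z)
    (h' : IsSolution p θ c K R T a Ntilde u₀ θ₀ c₀ z') (hT : 0 < T)
    (hR : ∀ ϑ, 1 < R ϑ * (1 + a)) (i : ℕ) :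
    (∀ j ≤ i, z.τ j = z'.τ j) ∧ EqOn z.u z'.u (Icc 0 (z.τ i)) ∧ EqOn z.U z'.U (Ico 0 (z.τ i)) ∧
      EqOn z.thetaHat z'.thetaHat (Icc 0 (z.τ i)) ∧ EqOn z.cHat z'.cHat (Icc 0 (z.τ i)) := by
  induction i with
  | zero =>
    simp only [Nat.le_zero, forall_eq, h.event_zero, h'.event_zero, Icc_self, Ico_self,
      eqOn_singleton, h.state_init, h'.state_init, h.thetaHat_init, h'.thetaHat_init, h.cHat_init,
      h'.cHat_init, true_and, and_true]
    exact eqOn_empty _ _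
  | succ i ih =>
    obtain ⟨hτ, hu, hU, hθ, hc⟩ := ih
    have hi0 := h.event_nonneg hT hR i
    have hm := h.event_strictMono hT hR
    have hm' := h'.event_strictMono hT hR
    have hlast : z.τ i ∈ Icc 0 (z.τ i) := ⟨hi0, le_rfl⟩
    have hτi := hτ i le_rfl
    have hθi : z'.thetaHat (z'.τ i) = z.thetaHat (z.τ i) := by rw [← hτi, hθ hlast]
    have hci : z'.cHat (z'.τ i) = z.cHat (z.τ i) := by rw [← hτi, hc hlast]
    have hn := h.isNextEvent hT hR i hi0
    have hn' := h'.isNextEvent hT hR i (h'.event_nonneg hT hR i)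
    rw [hθi, ← hτi] at hn'
    have hctl' := h'.control i
    rw [hθi, hci, ← hτi] at hctl'
    have hctl := h.control i
    have hJ' : Ioo (z.τ i) (z'.τ (i + 1)) ⊆ Ici 0 \ range z'.τ := by
      rw [hτi]; exact Ioo_subset_of_strictMono hm' (h'.event_nonneg hT hR i)
    -- The next event times are not yet known to coincide, so the states are first compared up to
    -- the smaller one; causality of the trigger then gives equality.
    set m := min (z.τ (i + 1)) (z'.τ (i + 1)) with hmdef
    have huc : EqOn z.u z'.u (Icc (z.τ i) m) := by
      refine eqOn_of_isClassicalOn (ρ := c * (z.cHat (z.τ i))⁻¹) (K := K)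
        (θh := z.thetaHat (z.τ i)) h.plant h'.plant hi0
        ((Ioo_subset_Ioo_right (min_le_left _ _)).trans (Ioo_subset_of_strictMono hm hi0))
        ((Ioo_subset_Ioo_right (min_le_right _ _)).trans hJ')
        (h.state_continuous.mono fun t ht => hi0.trans ht.1)
        (h'.state_continuous.mono fun t ht => hi0.trans ht.1) ?_ ?_ (hu hlast)
      · intro t ht
        rw [hctl t ⟨ht.1.le, ht.2.trans_le (min_le_left _ _)⟩, mul_assoc]
      · intro t ht
        rw [hctl' t ⟨ht.1.le, ht.2.trans_le (min_le_right _ _)⟩, mul_assoc]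
    have hnext : z.τ (i + 1) = z'.τ (i + 1) := hn.eq_of_eqOn hn' huc
    rw [hmdef, ← hnext, min_self] at huc
    rw [← hnext] at hctl'
    have hτ' : ∀ j ≤ i + 1, z.τ j = z'.τ j := fun j hj => by
      rcases Nat.le_succ_iff.1 hj with h1 | rfl
      exacts [hτ j h1, hnext]
    have huu : EqOn z.u z'.u (Icc 0 (z.τ (i + 1))) := fun t ht => by
      rcases le_total t (z.τ i) with h1 | h1
      exacts [hu ⟨ht.1, h1⟩, huc ⟨h1, ht.2⟩]
    have hUU : EqOn z.U z'.U (Ico 0 (z.τ (i + 1))) := fun t ht => by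
      rcases lt_or_ge t (z.τ i) with h1 | h1
      · exact hU ⟨ht.1, h1⟩
      · rw [hctl t ⟨h1, ht.2⟩, hctl' t ⟨h1, ht.2⟩, huc ⟨h1, ht.2.le⟩]
    obtain ⟨μ, hμ, hproj⟩ := h.update i
    obtain ⟨μ', hμ', hproj'⟩ := h'.update i
    have hμμ : μ' = μ := by
      have hset : {s : ℝ | ∃ j ≤ i, z'.τ j = s ∧ z'.τ (i + 1) - Ntilde * T ≤ s} =
          {s : ℝ | ∃ j ≤ i, z.τ j = s ∧ z.τ (i + 1) - Ntilde * T ≤ s} :=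
        Set.ext fun s => exists_congr fun j => and_congr_right fun hj => by rw [hτ j hj, hnext]
      rw [hset] at hμ'
      exact hμ'.unique hμ
    obtain ⟨j, hj, hjμ, -⟩ := hμ.1
    have hμ0 : 0 ≤ μ := hjμ ▸ h.event_nonneg hT hR j
    have hμle : μ ≤ z.τ (i + 1) := hjμ ▸ (hm (Nat.lt_succ_of_le hj)).le
    rw [hμμ, ← hnext, ← estimateSet_congr hμle (huu.mono (Icc_subset_Icc_left hμ0))
      (hUU.mono (Ico_subset_Ico_left hμ0)), hθi, hci] at hproj'
    have hq := hproj.unique estimateSet_midpoint hproj'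
    have hq0 : z.thetaHat (z.τ (i + 1)) = z'.thetaHat (z.τ (i + 1)) := by
      simpa using congrArg (fun q : EuclideanSpace ℝ (Fin 2) => q 0) hq
    have hq1 : z.cHat (z.τ (i + 1)) = z'.cHat (z.τ (i + 1)) := by
      simpa using congrArg (fun q : EuclideanSpace ℝ (Fin 2) => q 1) hq
    have hest := h.estimates_const i
    have hest' := h'.estimates_const i
    rw [hθi, hci, ← hτi, ← hnext] at hest'
    refine ⟨hτ', huu, hUU, fun t ht => ?_, fun t ht => ?_⟩
    · rcases le_total t (z.τ i) with h1 | h1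
      · exact hθ ⟨ht.1, h1⟩
      · rcases ht.2.lt_or_eq with h2 | rfl
        · rw [(hest t ⟨h1, h2⟩).1, (hest' t ⟨h1, h2⟩).1]
        · exact hq0
    · rcases le_total t (z.τ i) with h1 | h1
      · exact hc ⟨ht.1, h1⟩
      · rcases ht.2.lt_or_eq with h2 | rfl
        · rw [(hest t ⟨h1, h2⟩).2, (hest' t ⟨h1, h2⟩).2]
        · exact hq1

/-- Unbounded event times are needed for one of the solutions only, since the event times are
shared. -/
theorem IsSolution.same (h : IsSolution p θ c K R T a Ntilde u₀ θ₀ c₀ z)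
    (h' : IsSolution p θ c K R T a Ntilde u₀ θ₀ c₀ z') (hT : 0 < T)
    (hR : ∀ ϑ, 1 < R ϑ * (1 + a)) (hτ : Tendsto z.τ atTop atTop) : z'.Same z := by
  have hex : ∀ t, ∃ i, t < z.τ i := fun t => (hτ.eventually_gt_atTop t).exists
  refine ⟨funext fun i => ((h.agree h' hT hR i).1 i le_rfl).symm, fun t ht => ?_, fun t ht => ?_,
    fun t ht => ?_, fun t ht => ?_⟩ <;> obtain ⟨i, hi⟩ := hex t <;>
    obtain ⟨-, h1, h2, h3, h4⟩ := h.agree h' hT hR i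
  exacts [(h1 ⟨ht, hi.le⟩).symm, (h3 ⟨ht, hi.le⟩).symm, (h4 ⟨ht, hi.le⟩).symm,
    (h2 ⟨ht, hi⟩).symm]

end Uniqueness

/-! ### Shifts and concatenations of solutions -/

theorem IsClassicalOn.congr_state {p θ : ℝ} {b b' : ℝ → ℝ} {u u' : ℝ → L2}
    (h : IsClassicalOn p θ (Ioi 0) b u) (hu : ∀ t, 0 < t → u t = u' t)
    (hb : ∀ t, 0 < t → b t = b' t) : IsClassicalOn p θ (Ioi 0) b' u' := by
  obtain ⟨v, h1, h2, h3, h4, h5⟩ := h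
  exact ⟨v, fun t ht => hu t ht ▸ h1 t ht, h2, h3, h4,
    fun t ht => ⟨(h5 t ht).1, (h5 t ht).2.trans (hb t ht)⟩⟩

theorem IsClassicalOn.mono {p θ : ℝ} {J J' : Set ℝ} {b : ℝ → ℝ} {u : ℝ → L2}
    (h : IsClassicalOn p θ J b u) (hJ : J' ⊆ J) : IsClassicalOn p θ J' b u := by
  obtain ⟨v, h1, h2, h3, h4, h5⟩ := h
  exact ⟨v, h1, h2, h3.mono (prod_mono hJ subset_rfl), fun t ht => h4 t (hJ ht),
    fun t ht => h5 t (hJ ht)⟩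

theorem isClassicalOn_zero (p θ : ℝ) (J : Set ℝ) : IsClassicalOn p θ J (fun _ => 0) fun _ => 0 := by
  refine ⟨fun _ _ => 0, fun t _ => Lp.coeFn_zero ℝ 2 _, fun t _ => contDiffOn_const,
    contDiffOn_const, fun t _ x _ => by simp, fun t _ => ⟨rfl, rfl⟩⟩

theorem IsClassicalOn.shift {p θ : ℝ} {b : ℝ → ℝ} {u : ℝ → L2}
    (h : IsClassicalOn p θ (Ioi 0) b u) {s : ℝ} (hs : 0 ≤ s) :
    IsClassicalOn p θ (Ioi 0) (fun t => b (s + t)) (fun t => u (s + t)) := by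
  obtain ⟨v, h1, h2, h3, h4, h5⟩ := h
  have hpos : ∀ {t : ℝ}, 0 < t → 0 < s + t := fun ht => by linarith
  refine ⟨fun t => v (s + t), fun t ht => h1 _ (hpos ht), fun t ht => h2 _ (hpos ht), ?_, ?_,
    fun t ht => h5 _ (hpos ht)⟩
  · exact h3.comp (f := fun q : ℝ × ℝ => (s + q.1, q.2)) (by fun_prop)
      fun q hq => ⟨hpos hq.1, hq.2⟩
  · intro t ht x hx
    rw [deriv_comp_const_add (fun r => v r x) s t]
    exact h4 _ (hpos ht) x hx

/-- Follow `u₁` up to time `τ`, then `u₂` restarted at `τ`. -/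
def concat (τ : ℝ) (u₁ u₂ : ℝ → L2) (t : ℝ) : L2 := if t ≤ τ then u₁ t else u₂ (t - τ)

theorem concat_of_le {τ t : ℝ} {u₁ u₂ : ℝ → L2} (h : t ≤ τ) : concat τ u₁ u₂ t = u₁ t := if_pos h

theorem concat_of_ge {τ t : ℝ} {u₁ u₂ : ℝ → L2} (h0 : u₂ 0 = u₁ τ) (h : τ ≤ t) :
    concat τ u₁ u₂ t = u₂ (t - τ) := by
  rcases h.eq_or_lt with rfl | h
  · rw [concat, if_pos le_rfl, sub_self, h0]
  · exact if_neg (not_le.2 h)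

theorem continuous_concat {τ : ℝ} {u₁ u₂ : ℝ → L2} (h1 : Continuous u₁) (h2 : Continuous u₂)
    (h0 : u₂ 0 = u₁ τ) : Continuous (concat τ u₁ u₂) := by
  unfold concat
  exact Continuous.if_le h1 (by fun_prop) continuous_id continuous_const
    fun t ht => by rw [show t = τ from ht, sub_self, h0]

/-- The junction time is not in `J`, so near each time of `J` only one piece matters. At the
junction only regularity in `x` is required, and the first piece provides it. -/
theorem IsClassicalOn.concat {p θ τ : ℝ} {J₁ J : Set ℝ} {b₁ b₂ b : ℝ → ℝ} {u₁ u₂ : ℝ → L2}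
    (h1 : IsClassicalOn p θ J₁ b₁ u₁) (h2 : IsClassicalOn p θ (Ioi 0) b₂ u₂)
    (hJ : ∀ t ∈ J, (t < τ ∧ t ∈ J₁ ∧ b t = b₁ t) ∨ (τ < t ∧ b t = b₂ (t - τ))) :
    IsClassicalOn p θ J b (concat τ u₁ u₂) := by
  obtain ⟨v, hv, hv2, hv1, hpde, hbc⟩ := h1
  obtain ⟨v', hv', hv2', hv1', hpde', hbc'⟩ := h2
  refine ⟨fun t x => if t ≤ τ then v t x else v' (t - τ) x, fun t ht => ?_, fun t ht => ?_,
    fun q hq => ?_, fun t ht x hx => ?_, fun t ht => ?_⟩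
  · rcases le_or_gt t τ with h | h
    · simp only [concat_of_le h, if_pos h]; exact hv t ht
    · simp only [AdaptiveHeat.concat, if_neg (not_le.2 h)]; exact hv' _ (by linarith)
  · rcases le_or_gt t τ with h | h
    · simp only [if_pos h]; exact hv2 t ht
    · simp only [if_neg (not_le.2 h)]; exact hv2' _ (by linarith)
  · obtain ⟨t, x⟩ := q
    rcases hJ t hq.1 with ⟨h, hJ1, -⟩ | ⟨h, -⟩
    · have hc : ContDiffWithinAt ℝ 1 (fun q : ℝ × ℝ => v q.1 q.2) (J ×ˢ Icc 0 1) (t, x) := by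
        refine (hv1 (t, x) ⟨hJ1, hq.2⟩).mono_of_mem_nhdsWithin ?_
        filter_upwards [self_mem_nhdsWithin, mem_nhdsWithin_of_mem_nhds
          (continuousAt_fst.preimage_mem_nhds (Iio_mem_nhds h))] with r hr hr'
        rcases hJ r.1 hr.1 with ⟨-, h3, -⟩ | ⟨h3, -⟩
        · exact ⟨h3, hr.2⟩
        · exact absurd h3 (not_lt.2 (le_of_lt hr'))
      refine hc.congr_of_eventuallyEq ?_ (if_pos h.le)
      filter_upwards [mem_nhdsWithin_of_mem_nhds
        (continuousAt_fst.preimage_mem_nhds (Iio_mem_nhds h))] with r hr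
      exact if_pos (le_of_lt hr)
    · have h0 := (hv1'.comp (s := Ioi τ ×ˢ Icc (0 : ℝ) 1)
        (f := fun q : ℝ × ℝ => (q.1 - τ, q.2)) (by fun_prop)
        fun r hr => ⟨mem_Ioi.2 (sub_pos.2 hr.1), hr.2⟩) (t, x) ⟨h, hq.2⟩
      have hc : ContDiffWithinAt ℝ 1 (fun q : ℝ × ℝ => v' (q.1 - τ) q.2) (J ×ˢ Icc 0 1) (t, x) := by
        refine h0.mono_of_mem_nhdsWithin ?_
        filter_upwards [self_mem_nhdsWithin, mem_nhdsWithin_of_mem_nhds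
          (continuousAt_fst.preimage_mem_nhds (Ioi_mem_nhds h))] with r hr hr'
        exact ⟨hr', hr.2⟩
      refine hc.congr_of_eventuallyEq ?_ (if_neg (not_le.2 h))
      filter_upwards [mem_nhdsWithin_of_mem_nhds
        (continuousAt_fst.preimage_mem_nhds (Ioi_mem_nhds h))] with r hr
      exact if_neg (not_le.2 hr)
  · rcases hJ t ht with ⟨h, hJ1, -⟩ | ⟨h, -⟩
    · have hd : (fun s => if s ≤ τ then v s x else v' (s - τ) x) =ᶠ[𝓝 t] fun s => v s x := by
        filter_upwards [Iio_mem_nhds h] with s hs using if_pos (le_of_lt hs)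
      rw [hd.deriv_eq]
      simp only [if_pos h.le]
      exact hpde t hJ1 x hx
    · have hd : (fun s => if s ≤ τ then v s x else v' (s - τ) x) =ᶠ[𝓝 t] fun s => v' (s - τ) x := by
        filter_upwards [Ioi_mem_nhds h] with s hs using if_neg (not_le.2 hs)
      rw [hd.deriv_eq, deriv_comp_sub_const (f := fun r => v' r x)]
      simp only [if_neg (not_le.2 h)]
      exact hpde' _ (by simpa using h) x hx
  · rcases hJ t ht with ⟨h, hJ1, hb⟩ | ⟨h, hb⟩
    · simp only [if_pos h.le, hb]; exact hbc t hJ1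
    · simp only [if_neg (not_le.2 h), hb]; exact hbc' _ (by simpa using h)

/-! ### Phases with constant estimates -/

/-- `Φ` solves the plant with the estimates frozen at `ϑ`, `γ`. -/
structure IsPhase (p θ c : ℝ) (K : FeedbackGains) (ϑ γ : ℝ) (Φ : ℝ → L2) : Prop where
  continuous : Continuous Φ
  classical : IsClassicalOn p θ (Ioi 0) (fun t => c * (γ⁻¹ * pair (K.kernel ϑ) (Φ t))) Φ

theorem exists_isPhase {p : ℝ} (hp : 0 < p) (θ c : ℝ) (K : FeedbackGains) (ϑ γ : ℝ) (x₀ : L2) :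
    ∃ Φ, IsPhase p θ c K ϑ γ Φ ∧ Φ 0 = x₀ := by
  obtain ⟨u, huc, hu0, hu⟩ := exists_feedback_solution hp θ ϑ (c * γ⁻¹) K x₀
  have hm : ∀ t : ℝ, 0 < t → u t = u (max t 0) := fun t ht => by rw [max_eq_left ht.le]
  -- Extending by the initial value to negative times makes the phase continuous on the whole line.
  refine ⟨fun t => u (max t 0), ⟨?_, hu.congr_state hm fun t ht => ?_⟩, by simp [hu0]⟩
  · exact huc.comp_continuous (by fun_prop) fun t => mem_Ici.2 (le_max_right _ _)
  · rw [hm t ht, mul_assoc]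

namespace IsPhase

variable {p θ c : ℝ} {K : FeedbackGains} {ϑ γ : ℝ} {Φ Φ' : ℝ → L2}

theorem eqOn_zero (h : IsPhase p θ c K ϑ γ Φ) (h0 : Φ 0 = 0) : ∀ t, 0 ≤ t → Φ t = 0 := by
  intro t ht
  refine eqOn_of_isClassicalOn (α := 0) (β := t) (ρ := c * γ⁻¹) (K := K) (θh := ϑ) h.classical
    (isClassicalOn_zero p θ (Ioi 0)) le_rfl Ioo_subset_Ioi_self Ioo_subset_Ioi_self
    h.continuous.continuousOn continuousOn_const (fun t _ => (mul_assoc _ _ _).symm)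
    (fun t _ => by rw [pair_zero_right, mul_zero]) h0 ⟨ht, le_rfl⟩

/-- If the input vanishes on a time interval, then it also vanishes after a restart with the same
estimates. -/
theorem pair_eq_zero (h : IsPhase p θ c K ϑ γ Φ) (h' : IsPhase p θ c K ϑ γ Φ') {E : ℝ} (hE : 0 < E)
    (hΦ : Φ' 0 = Φ E) (hz : ∀ t ∈ Ico 0 E, pair (K.kernel ϑ) (Φ t) = 0) :
    ∀ t, 0 ≤ t → pair (K.kernel ϑ) (Φ' t) = 0 := by
  set l : ℕ → ℝ := fun n => θ - p * (n * Real.pi) ^ 2 with hl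
  set y : ℕ → ℝ → ℝ := fun n s => Real.exp (l n * s) * coef n (Φ 0) with hy
  have hyd : ∀ n s, HasDerivAt (y n) (l n * y n s) s := by
    intro n s
    have h1 : HasDerivAt (fun s => Real.exp (l n * s)) (Real.exp (l n * s) * l n) s := by
      simpa using ((hasDerivAt_id s).const_mul (l n)).exp
    exact (h1.mul_const _).congr_deriv (by simp only [hy]; ring)
  have hyc : ∀ n, Continuous (y n) := fun n => by fun_prop
  have hmode : ∀ n, ∀ s ∈ Icc 0 E, coef n (Φ s) = y n s := by
    intro n s hs
    refine sub_eq_zero.1 (mode_eq_zero (α := 0) (β := E) (l := l n)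
      (d := fun s => coef n (Φ s) - y n s)
      (((continuous_coef n).comp h.continuous).sub (hyc n)).continuousOn (fun r hr => ?_)
      (by simp [hy]) s hs)
    refine ((hasDerivAt_coef h.classical le_rfl Ioo_subset_Ioi_self hr n).sub
      (hyd n r)).congr_deriv ?_
    rw [hz r (Ioo_subset_Ico_self hr)]
    simp only [hl]; ring
  set W : ℝ → ℝ := fun s => ∑ n ∈ Finset.Icc 1 (K.N ϑ), Real.sqrt 2 * K.coeff ϑ n * y n s with hW
  -- With zero input each mode is a pure exponential, so the feedback value is a finite exponential
  -- sum. It is analytic and vanishes on an interval, hence everywhere.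
  have hW0 : ∀ s, W s = 0 := by
    have han : AnalyticOnNhd ℝ W univ := by
      intro s _
      simp only [hW, hy]
      fun_prop
    have hev : W =ᶠ[𝓝 (E / 2)] 0 := by
      filter_upwards [Ioo_mem_nhds (half_pos hE) (half_lt_self hE)] with s hs
      rw [Pi.zero_apply, ← hz s (Ioo_subset_Ico_self hs), pair_kernel]
      exact Finset.sum_congr rfl fun n _ => by rw [hmode n s (Ioo_subset_Icc_self hs)]
    intro s
    exact han.eqOn_zero_of_preconnected_of_eventuallyEq_zero isPreconnected_univ
      (mem_univ (E / 2)) hev (mem_univ s)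
  intro t ht
  have hpair : ∀ s, pair (K.kernel ϑ) (Φ' s) = ∑ n ∈ Finset.Icc 1 (K.N ϑ),
      Real.sqrt 2 * K.coeff ϑ n * (coef n (Φ' s) - y n (E + s)) := by
    intro s
    have := hW0 (E + s)
    simp only [mul_sub, Finset.sum_sub_distrib, pair_kernel]
    rw [show ∑ n ∈ Finset.Icc 1 (K.N ϑ), Real.sqrt 2 * K.coeff ϑ n * y n (E + s) = 0 from this,
      sub_zero]
  -- Since `W = 0`, the feedback of the restarted phase depends only on the deviations of its modes
  -- from the continued exponentials. These deviations obey a closed homogeneous system with zero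
  -- initial data.
  have hd := modes_eq_zero (α := 0) (β := t) (Finset.Icc 1 (K.N ϑ)) l
    (fun n => -(p * (-1) ^ n * (n * Real.pi) * (c * γ⁻¹)))
    (fun n => Real.sqrt 2 * K.coeff ϑ n) (fun n s => coef n (Φ' s) - y n (E + s))
    (fun n _ => (((continuous_coef n).comp h'.continuous).sub
      ((hyc n).comp (by fun_prop))).continuousOn)
    (fun n _ s hs => by
      refine ((hasDerivAt_coef h'.classical le_rfl Ioo_subset_Ioi_self hs n).sub
        ((hyd n (E + s)).comp_const_add E s)).congr_deriv ?_
      rw [← hpair s]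
      simp only [hl]; ring)
    (fun n _ => by rw [hΦ, hmode n E ⟨hE.le, le_rfl⟩, add_zero, sub_self])
  rw [hpair t]
  exact Finset.sum_eq_zero fun n hn => by rw [hd n hn t ⟨ht, le_rfl⟩, mul_zero]

end IsPhase

/-! ### Nominal solutions -/

theorem IsNominalSolution.shift {p θ : ℝ} {k : ℝ → ℝ} {x₀ : L2} {u : ℝ → L2}
    (h : IsNominalSolution p θ k x₀ u) {s : ℝ} (hs : 0 ≤ s) :
    IsNominalSolution p θ k (u s) fun t => u (s + t) :=
  ⟨h.1.comp (by fun_prop) fun t ht => add_nonneg hs ht, by simp, h.2.2.shift hs⟩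

theorem IsNominalFeedback.norm_le {p : ℝ} {K : FeedbackGains} {R ω : ℝ → ℝ}
    (hK : IsNominalFeedback p K R ω) {θ : ℝ} {x₀ : L2} {u : ℝ → L2}
    (h : IsNominalSolution p θ (K.kernel θ) x₀ u) {t : ℝ} (ht : 0 ≤ t) :
    ‖u t‖ ≤ R θ * Real.exp (-(ω θ) * t) * ‖x₀‖ := by
  obtain ⟨-, -, -, hex⟩ := hK θ
  obtain ⟨w, -, huniq, hle⟩ := hex x₀
  rw [huniq u h ht]
  exact hle t ht

/-- Take a unit vector at time zero. With `a > 0` it follows that the trigger threshold `R(1+a)`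
exceeds one. -/
theorem IsNominalFeedback.one_le {p : ℝ} {K : FeedbackGains} {R ω : ℝ → ℝ}
    (hK : IsNominalFeedback p K R ω) (θ : ℝ) : 1 ≤ R θ := by
  obtain ⟨-, -, -, hex⟩ := hK θ
  obtain ⟨w, hw, -, hle⟩ := hex (sineVec 0)
  have h := hle 0 le_rfl
  have h1 : ‖sineVec 0‖ = 1 := orthonormal_sineVec.1 0
  simpa [hw.2.1, h1] using h

/-! ### Regularity of the closed loop -/

/-- The modes are continuous across the finitely many exceptional times, so the fundamental theorem
of calculus integrates the modal equations through them. -/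
theorem isPlantTrajectory_of_isClassicalOn {p θ c : ℝ} {u : ℝ → L2} {U : ℝ → ℝ} {S : Set ℝ}
    (hS : S.Finite) (h : IsClassicalOn p θ (Ioi 0 \ S) (fun t => c * U t) u) (hu : Continuous u)
    (hU : ∀ s t, IntervalIntegrable U volume s t) (hUr : ∀ t, ContinuousWithinAt U (Ioi t) t) :
    IsPlantTrajectory p θ c u U := by
  refine ⟨hu, hU, hUr, fun n s t hs ht => ?_⟩
  have hc : Continuous fun t => coef n (u t) := (continuous_coef n).comp hu
  refine (MeasureTheory.integral_eq_of_hasDerivAt_off_countable (fun t => coef n (u t)) _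
    hS.countable hc.continuousOn (fun x hx => ?_) ?_).symm
  · have hx0 : 0 < x := (le_min hs ht).trans_lt hx.1.1
    obtain ⟨l, r, hlr, hsub⟩ := mem_nhds_iff_exists_Ioo_subset.1
      (((isOpen_Ioi.sdiff hS.isClosed).mem_nhds ⟨hx0, hx.2⟩ : Ioi 0 \ S ∈ 𝓝 x))
    exact hasDerivAt_coef h (le_max_right l 0)
      ((Ioo_subset_Ioo_left (le_max_left _ _)).trans hsub) ⟨max_lt hlr.1 hx0, hlr.2⟩ n
  · exact ((hc.intervalIntegrable _ _).const_mul _).sub (((hU s t).const_mul c).const_mul _)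

theorem intervalIntegrable_ite_lt {f g : ℝ → ℝ} {τ s t : ℝ} (hf : IntervalIntegrable f volume s t)
    (hg : IntervalIntegrable g volume s t) :
    IntervalIntegrable (fun r => if r < τ then f r else g r) volume s t :=
  ⟨Integrable.piecewise (s := Iio τ) measurableSet_Iio hf.1.integrableOn hg.1.integrableOn,
    Integrable.piecewise (s := Iio τ) measurableSet_Iio hf.2.integrableOn hg.2.integrableOn⟩

theorem continuousWithinAt_ite_lt {f g : ℝ → ℝ} {τ t : ℝ} (hf : ContinuousWithinAt f (Ioi t) t)
    (hg : ContinuousWithinAt g (Ioi t) t) :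
    ContinuousWithinAt (fun r => if r < τ then f r else g r) (Ioi t) t := by
  rcases lt_or_ge t τ with h | h
  · refine hf.congr_of_eventuallyEq ?_ (if_pos h)
    filter_upwards [mem_nhdsWithin_of_mem_nhds (Iio_mem_nhds h)] with r hr
    exact if_pos hr
  · refine hg.congr_of_eventuallyEq ?_ (if_neg (not_lt.2 h))
    filter_upwards [self_mem_nhdsWithin] with r hr
    exact if_neg (not_lt.2 (h.trans (le_of_lt hr)))

theorem IsNextEvent.shift {Φ u : ℝ → L2} {ρ T s e : ℝ} (h : IsNextEvent Φ ρ T 0 e)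
    (hu : ∀ t ∈ Icc 0 e, u (s + t) = Φ t) : IsNextEvent u ρ T s (s + e) := by
  have hs : u s = Φ 0 := by simpa using hu 0 ⟨le_rfl, h.lt.le⟩
  refine ⟨by linarith [h.lt], by linarith [h.le], fun h0 => ?_, fun h0 t ht => ?_, fun h0 => ?_⟩
  · rw [h.of_zero (hs ▸ h0)]; ring
  · rw [hs] at h0 ⊢
    have := h.no_hit h0 (t - s) ⟨by linarith [ht.1], by linarith [ht.2]⟩
    rwa [← hu (t - s) ⟨by linarith [ht.1], by linarith [ht.2]⟩, add_sub_cancel] at this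
  · rw [hs] at h0 ⊢
    rw [hu e ⟨h.lt.le, le_rfl⟩]
    exact (h.hit h0).imp (fun h1 => by linarith) id

/-! ### The closed-loop trajectory -/

/-- The piecewise constant function with the values `A₀`, `A₁`, `A₂` on the three phases. -/
def threeStep (τ₁ τ₂ A₀ A₁ A₂ t : ℝ) : ℝ := if t < τ₁ then A₀ else if t < τ₂ then A₁ else A₂

/-- Event times after which the inter-event time is `T`. -/
def phaseTimes (τ₁ τ₂ T : ℝ) : ℕ → ℝ
  | 0 => 0
  | 1 => τ₁
  | (i + 2) => τ₂ + i * T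

/-- The trajectory whose estimates are constant from the second event on. -/
def threePhase (K : FeedbackGains) (Φ₀ Φ₁ Φ₂ : ℝ → L2) (τ₁ τ₂ T θ₀ θ₁ θ₂ c₀ c₁ c₂ : ℝ) :
    Trajectory where
  u := concat τ₂ (concat τ₁ Φ₀ Φ₁) Φ₂
  thetaHat := threeStep τ₁ τ₂ θ₀ θ₁ θ₂
  cHat := threeStep τ₁ τ₂ c₀ c₁ c₂
  U := fun t => (threeStep τ₁ τ₂ c₀ c₁ c₂ t)⁻¹ *
    pair (K.kernel (threeStep τ₁ τ₂ θ₀ θ₁ θ₂ t)) (concat τ₂ (concat τ₁ Φ₀ Φ₁) Φ₂ t)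
  τ := phaseTimes τ₁ τ₂ T

section ThreePhase

variable {τ₁ τ₂ T A₀ A₁ A₂ t : ℝ}

theorem threeStep_of_lt (h : t < τ₁) : threeStep τ₁ τ₂ A₀ A₁ A₂ t = A₀ := if_pos h

theorem threeStep_of_mem (h1 : τ₁ ≤ t) (h2 : t < τ₂) : threeStep τ₁ τ₂ A₀ A₁ A₂ t = A₁ := by
  rw [threeStep, if_neg (not_lt.2 h1), if_pos h2]

theorem threeStep_of_ge (h : τ₁ ≤ τ₂) (h2 : τ₂ ≤ t) : threeStep τ₁ τ₂ A₀ A₁ A₂ t = A₂ := by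
  rw [threeStep, if_neg (not_lt.2 (h.trans h2)), if_neg (not_lt.2 h2)]

theorem strictMono_phaseTimes (h1 : 0 < τ₁) (h2 : τ₁ < τ₂) (hT : 0 < T) :
    StrictMono (phaseTimes τ₁ τ₂ T) := by
  refine strictMono_nat_of_lt_succ fun i => ?_
  match i with
  | 0 => exact h1
  | 1 => simpa [phaseTimes] using h2
  | (i + 2) =>
    simp only [phaseTimes]
    push_cast
    linarith

theorem tendsto_phaseTimes (hT : 0 < T) : Tendsto (phaseTimes τ₁ τ₂ T) atTop atTop := by
  rw [← tendsto_add_atTop_iff_nat 2]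
  exact tendsto_atTop_add_const_left _ _ (tendsto_natCast_atTop_atTop.atTop_mul_const hT)

theorem phaseTimes_two : phaseTimes τ₁ τ₂ T 2 = τ₂ := by simp [phaseTimes]

variable {p θ c θ₀ θ₁ θ₂ c₀ c₁ c₂ E₀ E₁ : ℝ} {K : FeedbackGains} {Φ₀ Φ₁ Φ₂ : ℝ → L2}

theorem threePhase_u_first (hE : 0 < E₁) (ht : t ≤ E₀) :
    (threePhase K Φ₀ Φ₁ Φ₂ E₀ (E₀ + E₁) T θ₀ θ₁ θ₂ c₀ c₁ c₂).u t = Φ₀ t := by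
  change concat _ _ _ t = _
  rw [concat_of_le (by linarith), concat_of_le ht]

theorem threePhase_u_second (hΦ₁ : Φ₁ 0 = Φ₀ E₀) (ht : E₀ ≤ t) (ht' : t ≤ E₀ + E₁) :
    (threePhase K Φ₀ Φ₁ Φ₂ E₀ (E₀ + E₁) T θ₀ θ₁ θ₂ c₀ c₁ c₂).u t = Φ₁ (t - E₀) := by
  change concat _ _ _ t = _
  rw [concat_of_le ht', concat_of_ge hΦ₁ ht]

theorem concat_second (hE : 0 < E₁) (hΦ₁ : Φ₁ 0 = Φ₀ E₀) (hΦ₂ : Φ₂ 0 = Φ₁ E₁) :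
    Φ₂ 0 = concat E₀ Φ₀ Φ₁ (E₀ + E₁) := by
  rw [concat_of_ge hΦ₁ (by linarith), hΦ₂, add_sub_cancel_left]

theorem threePhase_u_third (hE : 0 < E₁) (hΦ₁ : Φ₁ 0 = Φ₀ E₀) (hΦ₂ : Φ₂ 0 = Φ₁ E₁)
    (ht : E₀ + E₁ ≤ t) :
    (threePhase K Φ₀ Φ₁ Φ₂ E₀ (E₀ + E₁) T θ₀ θ₁ θ₂ c₀ c₁ c₂).u t = Φ₂ (t - (E₀ + E₁)) :=
  concat_of_ge (concat_second hE hΦ₁ hΦ₂) ht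

theorem threePhase_continuous (h0 : IsPhase p θ c K θ₀ c₀ Φ₀) (h1 : IsPhase p θ c K θ₁ c₁ Φ₁)
    (h2 : IsPhase p θ c K θ₂ c₂ Φ₂) (hE : 0 < E₁) (hΦ₁ : Φ₁ 0 = Φ₀ E₀) (hΦ₂ : Φ₂ 0 = Φ₁ E₁) :
    Continuous (threePhase K Φ₀ Φ₁ Φ₂ E₀ (E₀ + E₁) T θ₀ θ₁ θ₂ c₀ c₁ c₂).u :=
  continuous_concat (continuous_concat h0.continuous h1.continuous hΦ₁) h2.continuous
    (concat_second hE hΦ₁ hΦ₂)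

theorem threePhase_classical (h0 : IsPhase p θ c K θ₀ c₀ Φ₀) (h1 : IsPhase p θ c K θ₁ c₁ Φ₁)
    (h2 : IsPhase p θ c K θ₂ c₂ Φ₂) (hE : 0 < E₁) (hΦ₁ : Φ₁ 0 = Φ₀ E₀) (hΦ₂ : Φ₂ 0 = Φ₁ E₁) :
    IsClassicalOn p θ (Ioi 0 \ {E₀, E₀ + E₁})
      (fun t => c * (threePhase K Φ₀ Φ₁ Φ₂ E₀ (E₀ + E₁) T θ₀ θ₁ θ₂ c₀ c₁ c₂).U t)
      (threePhase K Φ₀ Φ₁ Φ₂ E₀ (E₀ + E₁) T θ₀ θ₁ θ₂ c₀ c₁ c₂).u := by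
  have hsecond := concat_second hE hΦ₁ hΦ₂
  have h01 : IsClassicalOn p θ (Ioi 0 \ {E₀})
      (fun t => if t < E₀ then c * (c₀⁻¹ * pair (K.kernel θ₀) (Φ₀ t))
        else c * (c₁⁻¹ * pair (K.kernel θ₁) (Φ₁ (t - E₀)))) (concat E₀ Φ₀ Φ₁) := by
    refine h0.classical.concat h1.classical fun t ht => ?_
    rcases lt_or_gt_of_ne (show t ≠ E₀ from ht.2) with h | h
    · exact Or.inl ⟨h, ht.1, if_pos h⟩
    · exact Or.inr ⟨h, if_neg (not_lt.2 h.le)⟩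
  refine h01.concat h2.classical fun t ht => ?_
  have hne : t ≠ E₀ ∧ t ≠ E₀ + E₁ := by simpa using ht.2
  simp only [threePhase]
  rcases lt_or_gt_of_ne hne.2 with h | h
  · refine Or.inl ⟨h, ⟨ht.1, hne.1⟩, ?_⟩
    rw [concat_of_le h.le]
    rcases lt_or_gt_of_ne hne.1 with h' | h'
    · rw [threeStep_of_lt h', threeStep_of_lt h', if_pos h', concat_of_le h'.le]
    · rw [threeStep_of_mem h'.le h, threeStep_of_mem h'.le h, if_neg (not_lt.2 h'.le),
        concat_of_ge hΦ₁ h'.le]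
  · refine Or.inr ⟨h, ?_⟩
    rw [threeStep_of_ge (by linarith) h.le, threeStep_of_ge (by linarith) h.le,
      concat_of_ge hsecond h.le]

theorem threePhase_plantTrajectory (h0 : IsPhase p θ c K θ₀ c₀ Φ₀)
    (h1 : IsPhase p θ c K θ₁ c₁ Φ₁) (h2 : IsPhase p θ c K θ₂ c₂ Φ₂) (hE : 0 < E₁)
    (hΦ₁ : Φ₁ 0 = Φ₀ E₀) (hΦ₂ : Φ₂ 0 = Φ₁ E₁) :
    IsPlantTrajectory p θ c (threePhase K Φ₀ Φ₁ Φ₂ E₀ (E₀ + E₁) T θ₀ θ₁ θ₂ c₀ c₁ c₂).u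
      (threePhase K Φ₀ Φ₁ Φ₂ E₀ (E₀ + E₁) T θ₀ θ₁ θ₂ c₀ c₁ c₂).U := by
  have hu := threePhase_continuous (T := T) h0 h1 h2 hE hΦ₁ hΦ₂
  have hf : ∀ ϑ γ : ℝ, Continuous fun t => γ⁻¹ * pair (K.kernel ϑ)
      ((threePhase K Φ₀ Φ₁ Φ₂ E₀ (E₀ + E₁) T θ₀ θ₁ θ₂ c₀ c₁ c₂).u t) := fun ϑ γ =>
    continuous_const.mul ((continuous_pair_kernel K ϑ).comp hu)
  have hU : (threePhase K Φ₀ Φ₁ Φ₂ E₀ (E₀ + E₁) T θ₀ θ₁ θ₂ c₀ c₁ c₂).U = fun t =>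
      if t < E₀ then c₀⁻¹ * pair (K.kernel θ₀)
        ((threePhase K Φ₀ Φ₁ Φ₂ E₀ (E₀ + E₁) T θ₀ θ₁ θ₂ c₀ c₁ c₂).u t)
      else if t < E₀ + E₁ then c₁⁻¹ * pair (K.kernel θ₁)
        ((threePhase K Φ₀ Φ₁ Φ₂ E₀ (E₀ + E₁) T θ₀ θ₁ θ₂ c₀ c₁ c₂).u t)
      else c₂⁻¹ * pair (K.kernel θ₂)
        ((threePhase K Φ₀ Φ₁ Φ₂ E₀ (E₀ + E₁) T θ₀ θ₁ θ₂ c₀ c₁ c₂).u t) := by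
    ext t
    simp only [threePhase, threeStep]
    split_ifs <;> rfl
  refine isPlantTrajectory_of_isClassicalOn (toFinite {E₀, E₀ + E₁})
    (threePhase_classical h0 h1 h2 hE hΦ₁ hΦ₂) hu (fun s t => ?_) (fun t => ?_)
  · rw [hU]
    exact intervalIntegrable_ite_lt ((hf θ₀ c₀).intervalIntegrable _ _)
      (intervalIntegrable_ite_lt ((hf θ₁ c₁).intervalIntegrable _ _)
        ((hf θ₂ c₂).intervalIntegrable _ _))
  · rw [hU]
    exact continuousWithinAt_ite_lt (hf θ₀ c₀).continuousWithinAt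
      (continuousWithinAt_ite_lt (hf θ₁ c₁).continuousWithinAt (hf θ₂ c₂).continuousWithinAt)

end ThreePhase

/-- The time `τ i` itself is admissible, since consecutive events are at most `T` apart and `Ntilde
≥ 1`. -/
theorem exists_window_start {τ : ℕ → ℝ} {T : ℝ} {Ntilde i : ℕ} (hT : 0 ≤ T) (hN : 1 ≤ Ntilde)
    (h : τ (i + 1) ≤ τ i + T) :
    ∃ j ≤ i, IsLeast {s : ℝ | ∃ j ≤ i, τ j = s ∧ τ (i + 1) - Ntilde * T ≤ s} (τ j) := by
  have hmem : τ i ∈ {s : ℝ | ∃ j ≤ i, τ j = s ∧ τ (i + 1) - Ntilde * T ≤ s} := by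
    have h1 : (1 : ℝ) ≤ Ntilde := by exact_mod_cast hN
    exact ⟨i, le_rfl, rfl, by nlinarith⟩
  have hfin : {s : ℝ | ∃ j ≤ i, τ j = s ∧ τ (i + 1) - Ntilde * T ≤ s}.Finite := by
    refine ((finite_Iic i).image τ).subset ?_
    rintro s ⟨j, hj, hjs, -⟩
    exact ⟨j, hj, hjs⟩
  obtain ⟨μ, hμ, hmin⟩ := exists_min_image _ id hfin ⟨_, hmem⟩
  obtain ⟨j, hj, rfl, hle⟩ := hμ
  exact ⟨j, hj, ⟨j, hj, rfl, hle⟩, hmin⟩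

set_option maxHeartbeats 1600000 in
/-- Solvability of the closed loop, with the properties of the solution. -/
theorem exists_closedLoop {p : ℝ} (hp : 0 < p) {K : FeedbackGains} {R ω : ℝ → ℝ}
    (hK : IsNominalFeedback p K R ω) {T a : ℝ} (hT : 0 < T) (ha : 0 < a) {Ntilde : ℕ}
    (hN : 1 ≤ Ntilde) (θ θ₀ : ℝ) {c c₀ : ℝ} (hc : 0 < c) (hc₀ : 0 < c₀) (u₀ : L2) :
    ∃ z : Trajectory, IsSolution p θ c K R T a Ntilde u₀ θ₀ c₀ z ∧ Tendsto z.τ atTop atTop ∧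
      (∀ t : ℝ, 0 ≤ t → ‖z.u t‖ ≤ (R θ * (R θ * (1 + a)) * (R θ₀ * (1 + a)) *
        Real.exp (ω θ * (2 * T))) * Real.exp (-(ω θ) * t) * ‖u₀‖) ∧
      (u₀ ≠ 0 → ∀ t : ℝ, z.τ 1 ≤ t → z.thetaHat t = θ) ∧
      ((∃ t : ℝ, 0 ≤ t ∧ z.U t ≠ 0) → ∀ t : ℝ, z.τ 2 ≤ t → z.cHat t = c) := by
  classical
  have hR : ∀ ϑ, 1 < R ϑ * (1 + a) := fun ϑ => by nlinarith [hK.one_le ϑ]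
  obtain ⟨-, -, hω, -⟩ := hK θ
  -- the first phase
  obtain ⟨Φ₀, h0, hΦ₀⟩ := exists_isPhase hp θ c K θ₀ c₀ u₀
  obtain ⟨E₀, hE₀⟩ := exists_isNextEvent (s := 0) hT (hR θ₀) h0.continuous.continuousOn
  set Q₀ : Prop := ∀ t ∈ Ico 0 E₀, pair (K.kernel θ₀) (Φ₀ t) = 0 with hQ₀
  -- The updated estimates are written down in closed form, according to whether state and input
  -- have been nonzero so far; that they are the least-squares projections is verified afterwards.
  set θ₁ := if u₀ = 0 then θ₀ else θ with hθ₁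
  set c₁ := if u₀ = 0 ∨ Q₀ then c₀ else c with hc₁
  -- the second phase
  obtain ⟨Φ₁, h1, hΦ₁⟩ := exists_isPhase hp θ c K θ₁ c₁ (Φ₀ E₀)
  obtain ⟨E₁, hE₁⟩ := exists_isNextEvent (s := 0) hT (hR θ₁) h1.continuous.continuousOn
  set Q₁ : Prop := ∀ t ∈ Ico 0 E₁, pair (K.kernel θ₁) (Φ₁ t) = 0 with hQ₁
  set c₂ := if u₀ = 0 ∨ (Q₀ ∧ Q₁) then c₀ else c with hc₂
  -- the third phase
  obtain ⟨Φ₂, h2, hΦ₂⟩ := exists_isPhase hp θ c K θ₁ c₂ (Φ₁ E₁)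
  have hE₀p : 0 < E₀ := hE₀.lt
  have hE₁p : 0 < E₁ := hE₁.lt
  set τ₂ := E₀ + E₁ with hτ₂
  set z := threePhase K Φ₀ Φ₁ Φ₂ E₀ τ₂ T θ₀ θ₁ θ₁ c₀ c₁ c₂ with hz
  have hu1 : ∀ t, t ≤ E₀ → z.u t = Φ₀ t := fun t ht => threePhase_u_first hE₁p ht
  have hu2 : ∀ t, E₀ ≤ t → t ≤ τ₂ → z.u t = Φ₁ (t - E₀) := fun t ht ht' =>
    threePhase_u_second hΦ₁ ht ht'
  have hu3 : ∀ t, τ₂ ≤ t → z.u t = Φ₂ (t - τ₂) := fun t ht => threePhase_u_third hE₁p hΦ₁ hΦ₂ ht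
  have huc : Continuous z.u := threePhase_continuous h0 h1 h2 hE₁p hΦ₁ hΦ₂
  have hplant : IsPlantTrajectory p θ c z.u z.U :=
    threePhase_plantTrajectory h0 h1 h2 hE₁p hΦ₁ hΦ₂
  have hmono : StrictMono z.τ := strictMono_phaseTimes hE₀p (by linarith) hT
  have hUdef : ∀ t, z.U t = (z.cHat t)⁻¹ * pair (K.kernel (z.thetaHat t)) (z.u t) := fun _ => rfl
  have ht0 : ∀ t, t < E₀ → z.thetaHat t = θ₀ ∧ z.cHat t = c₀ := fun t ht =>
    ⟨threeStep_of_lt ht, threeStep_of_lt ht⟩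
  have ht1 : ∀ t, E₀ ≤ t → t < τ₂ → z.thetaHat t = θ₁ ∧ z.cHat t = c₁ := fun t ht ht' =>
    ⟨threeStep_of_mem ht ht', threeStep_of_mem ht ht'⟩
  have ht2 : ∀ t, τ₂ ≤ t → z.thetaHat t = θ₁ ∧ z.cHat t = c₂ := fun t ht =>
    ⟨threeStep_of_ge (by linarith) ht, threeStep_of_ge (by linarith) ht⟩
  have hz0 : z.τ 0 = 0 := rfl
  have hz1 : z.τ 1 = E₀ := rfl
  have hz2 : ∀ i : ℕ, z.τ (i + 2) = τ₂ + i * T := fun _ => rfl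
  have hz2' : z.τ 2 = τ₂ := phaseTimes_two (τ₁ := E₀)
  have hzge : ∀ i : ℕ, τ₂ ≤ z.τ (i + 2) := fun i => by
    rw [hz2]; have : 0 ≤ (i : ℝ) * T := by positivity
    linarith
  have hc₁0 : c₁ ≠ 0 := by rw [hc₁]; split_ifs <;> positivity
  have hzero : u₀ = 0 → ∀ t, 0 ≤ t → z.u t = 0 := by
    intro hu₀
    have z0 := h0.eqOn_zero (hΦ₀.trans hu₀)
    have z1 := h1.eqOn_zero (hΦ₁.trans (z0 _ hE₀p.le))
    have z2 := h2.eqOn_zero (hΦ₂.trans (z1 _ hE₁p.le))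
    intro t ht
    rcases le_total t E₀ with h | h
    · rw [hu1 t h, z0 t ht]
    · rcases le_total t τ₂ with h' | h'
      · rw [hu2 t h h', z1 _ (by linarith)]
      · rw [hu3 t h', z2 _ (by linarith)]
  have hUzero : ∀ t, z.u t = 0 → z.U t = 0 := fun t ht => by rw [hUdef, ht, pair_zero_right, mul_zero]
  -- the input vanishes in the third phase if it vanishes in the first two
  have hθ₁' : u₀ ≠ 0 → θ₁ = θ := fun h => if_neg h
  have hpair2 : u₀ ≠ 0 → Q₀ → Q₁ → ∀ t, 0 ≤ t → pair (K.kernel θ₁) (Φ₂ t) = 0 := by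
    intro hu₀ hq₀ hq₁
    have e1 : c₁ = c₀ := if_pos (Or.inr hq₀)
    have e2 : c₂ = c₀ := if_pos (Or.inr ⟨hq₀, hq₁⟩)
    exact (e1 ▸ h1).pair_eq_zero (e2 ▸ h2) hE₁p hΦ₂ hq₁
  have hUall : u₀ = 0 ∨ (Q₀ ∧ Q₁) → ∀ t, 0 ≤ t → z.U t = 0 := by
    rintro hq t ht
    by_cases hu₀ : u₀ = 0
    · exact hUzero t (hzero hu₀ t ht)
    · obtain ⟨hq₀, hq₁⟩ := hq.resolve_left hu₀
      rcases lt_or_ge t E₀ with h | h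
      · rw [hUdef, (ht0 t h).1, hu1 t h.le, hq₀ t ⟨ht, h⟩, mul_zero]
      · rcases lt_or_ge t τ₂ with h' | h'
        · rw [hUdef, (ht1 t h h').1, hu2 t h h'.le, hq₁ _ ⟨by linarith, by linarith⟩, mul_zero]
        · rw [hUdef, (ht2 t h').1, hu3 t h', hpair2 hu₀ hq₀ hq₁ _ (by linarith), mul_zero]
  -- the third phase is nominal
  have hnom : u₀ ≠ 0 → IsNominalSolution p θ (K.kernel θ) (Φ₁ E₁) Φ₂ := by
    intro hu₀
    have e := hθ₁' hu₀
    refine ⟨h2.continuous.continuousOn, hΦ₂, h2.classical.congr fun t ht => ?_⟩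
    -- Either the input has never been excited and stays zero, so that the wrong `c₂` does no harm,
    -- or `c₂ = c` cancels.
    by_cases hq : Q₀ ∧ Q₁
    · have := hpair2 hu₀ hq.1 hq.2 t (le_of_lt ht)
      rw [e] at this
      rw [e, this, mul_zero, mul_zero]
    · have e2 : c₂ = c := if_neg (by tauto)
      rw [e, e2, ← mul_assoc, mul_inv_cancel₀ hc.ne', one_mul]
  have hτ₂T : τ₂ ≤ 2 * T := by linarith [hE₀.le, hE₁.le]
  have hdec : u₀ ≠ 0 → ∀ s t, τ₂ ≤ s → s ≤ t →
      ‖z.u t‖ ≤ R θ * Real.exp (-(ω θ) * (t - s)) * ‖z.u s‖ := by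
    intro hu₀ s t hs hst
    have h := hK.norm_le ((hnom hu₀).shift (sub_nonneg.2 hs)) (sub_nonneg.2 hst)
    rw [show s - τ₂ + (t - s) = t - τ₂ by ring] at h
    rwa [hu3 s hs, hu3 t (hs.trans hst)]
  have hest : ∀ i, ∀ t ∈ Ico (z.τ i) (z.τ (i + 1)),
      z.thetaHat t = z.thetaHat (z.τ i) ∧ z.cHat t = z.cHat (z.τ i) := by
    intro i t ht
    match i with
    | 0 =>
      rw [(ht0 t ht.2).1, (ht0 t ht.2).2, hz0, (ht0 0 hE₀p).1, (ht0 0 hE₀p).2]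
      exact ⟨rfl, rfl⟩
    | 1 =>
      have h3 : t < τ₂ := hz2' ▸ ht.2
      have h4 : E₀ < τ₂ := by linarith
      rw [(ht1 t ht.1 h3).1, (ht1 t ht.1 h3).2, hz1, (ht1 _ le_rfl h4).1, (ht1 _ le_rfl h4).2]
      exact ⟨rfl, rfl⟩
    | (i + 2) =>
      have h3 := hzge i
      rw [(ht2 t (h3.trans ht.1)).1, (ht2 t (h3.trans ht.1)).2, (ht2 _ h3).1, (ht2 _ h3).2]
      exact ⟨rfl, rfl⟩
  have hnext : ∀ i, IsNextEvent z.u (R (z.thetaHat (z.τ i)) * (1 + a)) T (z.τ i) (z.τ (i + 1)) := by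
    intro i
    match i with
    | 0 =>
      have h := hE₀.shift (u := z.u) (s := 0) fun t ht => by rw [zero_add, hu1 t ht.2]
      rw [zero_add] at h
      rwa [hz0, hz1, (ht0 0 hE₀p).1]
    | 1 =>
      have h := hE₁.shift (u := z.u) (s := E₀) fun t ht => by
        rw [hu2 _ (by linarith [ht.1]) (by linarith [ht.2]), add_sub_cancel_left]
      rwa [show z.τ (1 + 1) = E₀ + E₁ from hz2', hz1, (ht1 E₀ le_rfl (by linarith)).1]
    | (i + 2) =>
      have hs : z.τ (i + 2 + 1) = z.τ (i + 2) + T := by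
        refine (hz2 (i + 1)).trans ?_
        rw [hz2]; push_cast; ring
      have hge := hzge i
      rw [hs]
      refine ⟨by linarith, le_rfl, fun _ => rfl, fun h t ht => ?_, fun _ => Or.inl rfl⟩
      -- In the nominal phase the norm stays below `R θ` times its value at the last event, strictly
      -- less than the threshold. No hit occurs and the timeout decides.
      have hu₀ : u₀ ≠ 0 := fun hu₀ => h (hzero hu₀ _ (by linarith))
      rw [(ht2 _ hge).1, hθ₁' hu₀]
      have hpos : 0 < ‖z.u (z.τ (i + 2))‖ := norm_pos_iff.2 h
      have h1 := hdec hu₀ _ t hge ht.1.le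
      have h2 : Real.exp (-(ω θ) * (t - z.τ (i + 2))) ≤ 1 := by
        rw [Real.exp_le_one_iff]
        have := mul_nonneg hω.le (sub_nonneg.2 ht.1.le)
        linarith
      have hR1 := hK.one_le θ
      refine ne_of_lt (h1.trans_lt ?_)
      refine mul_lt_mul_of_pos_right ?_ hpos
      nlinarith
  -- how the estimates depend on the data
  have hest0 : u₀ = 0 → ∀ t, z.thetaHat t = θ₀ ∧ z.cHat t = c₀ := by
    intro hu₀ t
    have e1 : θ₁ = θ₀ := if_pos hu₀
    have e2 : c₁ = c₀ := if_pos (Or.inl hu₀)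
    have e3 : c₂ = c₀ := if_pos (Or.inl hu₀)
    rcases lt_or_ge t E₀ with h | h
    · exact ht0 t h
    · rcases lt_or_ge t τ₂ with h' | h'
      · rw [← e1, ← e2]; rw [e1]; exact e1 ▸ ht1 t h h'
      · rw [← e1, ← e3]; rw [e1]; exact e1 ▸ ht2 t h'
  have hestθ : u₀ ≠ 0 → ∀ t, E₀ ≤ t → z.thetaHat t = θ := by
    intro hu₀ t ht
    rw [← hθ₁' hu₀]
    rcases lt_or_ge t τ₂ with h | h
    · exact (ht1 t ht h).1
    · exact (ht2 t h).1
  have hcsame : ∀ i, (∀ σ ∈ Ico (z.τ i) (z.τ (i + 1)), z.U σ = 0) →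
      z.cHat (z.τ (i + 1)) = z.cHat (z.τ i) := by
    intro i hi
    match i with
    | 0 =>
      have hq : Q₀ := fun t ht => by
        have := hi t ht
        rw [hUdef, (ht0 t ht.2).1, (ht0 t ht.2).2, hu1 t ht.2.le] at this
        exact (mul_eq_zero.1 this).resolve_left (inv_ne_zero hc₀.ne')
      rw [hz0, (ht0 0 hE₀p).2, show z.τ (0 + 1) = E₀ from hz1, (ht1 E₀ le_rfl (by linarith)).2]
      exact if_pos (Or.inr hq)
    | 1 =>
      have hq : Q₁ := fun t ht => by
        have h3 : E₀ ≤ E₀ + t := by linarith [ht.1]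
        have h4 : E₀ + t < τ₂ := by linarith [ht.2]
        have := hi (E₀ + t) ⟨h3, h4.trans_eq hz2'.symm⟩
        rw [hUdef, (ht1 _ h3 h4).1, (ht1 _ h3 h4).2, hu2 _ h3 h4.le, add_sub_cancel_left] at this
        exact (mul_eq_zero.1 this).resolve_left (inv_ne_zero hc₁0)
      rw [hz1, (ht1 E₀ le_rfl (by linarith)).2, show z.τ (1 + 1) = τ₂ from hz2', (ht2 _ le_rfl).2,
        hc₁, hc₂]
      simp only [hq, and_true]
    | (i + 2) =>
      rw [(ht2 _ (hzge i)).2, (ht2 _ (hzge (i + 1))).2]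
  have hcident : (∃ t, 0 ≤ t ∧ z.U t ≠ 0) → c₂ = c := by
    rintro ⟨t, ht, hU⟩
    exact if_neg fun h => hU (hUall h t ht)
  refine ⟨z, ⟨huc.continuousOn, ?_, ?_, ?_, ?_, ?_, hest, rfl, ?_, ?_⟩, tendsto_phaseTimes hT, ?_,
    ?_, ?_⟩
  · refine (threePhase_classical h0 h1 h2 hE₁p hΦ₁ hΦ₂).mono ?_
    rintro t ⟨ht, hne⟩
    refine ⟨lt_of_le_of_ne ht fun h => hne ⟨0, h⟩, ?_⟩
    rintro (h | h)
    · exact hne ⟨1, h.symm⟩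
    · exact hne ⟨2, hz2'.trans h.symm⟩
  · rw [hu1 0 hE₀p.le, hΦ₀]
  · exact (ht0 0 hE₀p).1
  · exact (ht0 0 hE₀p).2
  · intro i t ht
    rw [hUdef, (hest i t ht).1, (hest i t ht).2]
  · exact fun i => (event_succ_iff hT huc.continuousOn (hR _)).2 (hnext i)
  · intro i
    have hτnn : ∀ j, 0 ≤ z.τ j := fun j => hz0 ▸ hmono.monotone (Nat.zero_le j)
    obtain ⟨j, hj, hleast⟩ := exists_window_start hT.le hN (hnext i).le
    refine ⟨z.τ j, hleast, ?_⟩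
    have hjle : z.τ j ≤ z.τ i := hmono.monotone hj
    have hlt : z.τ j < z.τ (i + 1) := hmono (Nat.lt_succ_of_le hj)
    have hE₀le : E₀ ≤ z.τ (i + 1) := hz1 ▸ hmono.monotone (Nat.le_add_left 1 i)
    refine hplant.isProj hp (hτnn j) hlt (fun h => ?_) (fun ⟨σ, hσ, hne⟩ => ?_) (fun h => ?_)
      (fun ⟨σ, hσ, hne⟩ => ?_)
    · have hU0 : ∀ σ ∈ Ico (z.τ j) (z.τ (i + 1)), z.U σ = 0 := fun σ hσ => hUzero σ (h σ hσ)
      refine ⟨?_, hcsame i fun σ hσ => hU0 σ ⟨hjle.trans hσ.1, hσ.2⟩, hU0⟩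
      by_cases hu₀ : u₀ = 0
      · rw [(hest0 hu₀ _).1, (hest0 hu₀ _).1]
      · rw [hestθ hu₀ _ hE₀le]
        -- The first window contains time zero, where the state is `u₀ ≠ 0`; from the first event
        -- on, the estimate is `θ` before and after the update.
        match i with
        | 0 =>
          obtain rfl : j = 0 := Nat.le_zero.1 hj
          have := h 0 ⟨le_rfl, hE₀p⟩
          rw [hu1 0 hE₀p.le, hΦ₀] at this
          exact absurd this hu₀
        | (i + 1) =>
          rw [hestθ hu₀ _ (hz1 ▸ hmono.monotone (Nat.le_add_left 1 i))]
    · refine hestθ (fun hu₀ => hne (hzero hu₀ σ ((hτnn j).trans hσ.1))) _ hE₀le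
    · exact hcsame i fun σ hσ => h σ ⟨hjle.trans hσ.1, hσ.2⟩
    · have hσ0 := (hτnn j).trans hσ.1
      match i with
      | 0 =>
        rw [show z.τ (0 + 1) = E₀ from hz1, (ht1 E₀ le_rfl (by linarith)).2]
        refine if_neg ?_
        rintro (h | h)
        · exact hne (hUall (Or.inl h) σ hσ0)
        · have hσE : σ < E₀ := hσ.2
          refine hne ?_
          rw [hUdef, (ht0 σ hσE).1, hu1 σ hσE.le, h σ ⟨hσ0, hσE⟩, mul_zero]
      | (i + 1) =>
        rw [show z.cHat (z.τ (i + 1 + 1)) = c₂ from (ht2 _ (hzge i)).2]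
        exact hcident ⟨σ, hσ0, hne⟩
  · intro t ht
    have hRθ := hK.one_le θ
    by_cases hu₀ : u₀ = 0
    · rw [hzero hu₀ t ht, hu₀, norm_zero, mul_zero]
    -- The trigger allows growth by one threshold factor in each of the first two phases.
    · set B := R θ * (1 + a) * (R θ₀ * (1 + a)) * ‖u₀‖ with hB
      have hB1 : ∀ s, 0 ≤ s → s ≤ E₀ → ‖Φ₀ s‖ ≤ R θ₀ * (1 + a) * ‖u₀‖ := fun s hs hs' => by
        have := hE₀.norm_le (hR θ₀) h0.continuous.continuousOn (by rwa [hΦ₀]) s ⟨hs, hs'⟩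
        rwa [hΦ₀] at this
      have hρ := hR θ
      have hρ₀ := hR θ₀
      have hn := norm_nonneg u₀
      have hpos : 0 ≤ R θ₀ * (1 + a) * ‖u₀‖ := by positivity
      have hB2 : ∀ s, 0 ≤ s → s ≤ τ₂ → ‖z.u s‖ ≤ B := by
        intro s hs hs'
        rcases le_total s E₀ with h | h
        · rw [hu1 s h]
          refine (hB1 s hs h).trans ?_
          rw [hB]; nlinarith
        · rw [hu2 s h hs']
          -- The trigger bounds nothing when the phase starts from zero; then the state stays zero.
          by_cases hz : Φ₁ 0 = 0
          · rw [h1.eqOn_zero hz _ (by linarith), norm_zero]; positivity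
          · have h3 := hE₁.norm_le (hR θ₁) h1.continuous.continuousOn hz (s - E₀)
              ⟨by linarith, by linarith⟩
            rw [hΦ₁, hθ₁' hu₀] at h3
            refine h3.trans ?_
            rw [hB, mul_assoc (R θ * (1 + a))]
            gcongr
            exact hB1 E₀ hE₀p.le le_rfl
      have hB0 : 0 ≤ B := by positivity
      have hgoal : R θ * (R θ * (1 + a)) * (R θ₀ * (1 + a)) * Real.exp (ω θ * (2 * T)) *
          Real.exp (-(ω θ) * t) * ‖u₀‖ = R θ * Real.exp (ω θ * (2 * T - t)) * B := by
        rw [hB, show ω θ * (2 * T - t) = ω θ * (2 * T) + -(ω θ) * t by ring, Real.exp_add]; ring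
      rw [hgoal]
      rcases le_total t τ₂ with h | h
      · refine (hB2 t ht h).trans ?_
        have : 1 ≤ Real.exp (ω θ * (2 * T - t)) :=
          Real.one_le_exp (mul_nonneg hω.le (by linarith))
        have : 1 ≤ R θ * Real.exp (ω θ * (2 * T - t)) := by nlinarith
        nlinarith
      · refine (hdec hu₀ τ₂ t le_rfl h).trans ?_
        gcongr R θ * Real.exp ?_ * ?_
        · nlinarith
        · exact hB2 τ₂ (by linarith) le_rfl
  · exact fun hu₀ t ht => hestθ hu₀ t ht
  · intro hU t ht
    rw [(ht2 t (hz2' ▸ ht)).2]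
    exact hcident hU

end AdaptiveHeat

end

theorem theorem2p2 (p : ℝ) (hp : 0 < p)
    (K : AdaptiveHeat.FeedbackGains) (R ω : ℝ → ℝ)
    (hK : AdaptiveHeat.IsNominalFeedback p K R ω)
    (T a : ℝ) (hT : 0 < T) (ha : 0 < a) (Ntilde : ℕ) (hN : 1 ≤ Ntilde) :
    ∃ M : ℝ → ℝ → ℝ → ℝ → ℝ,
      ∀ θ c θ₀ c₀ : ℝ, 0 < c → 0 < c₀ →
        0 < M θ θ₀ c c₀ ∧
        ∀ u₀ : AdaptiveHeat.L2,
          ∃ z : AdaptiveHeat.Trajectory,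
            AdaptiveHeat.IsSolution p θ c K R T a Ntilde u₀ θ₀ c₀ z ∧
            (∀ z' : AdaptiveHeat.Trajectory,
              AdaptiveHeat.IsSolution p θ c K R T a Ntilde u₀ θ₀ c₀ z' → z'.Same z) ∧
            Tendsto z.τ atTop atTop ∧
            (∀ t : ℝ, 0 ≤ t →
              ‖z.u t‖ ≤ M θ θ₀ c c₀ * Real.exp (-(ω θ) * t) * ‖u₀‖) ∧
            (u₀ ≠ 0 → ∀ t : ℝ, z.τ 1 ≤ t → z.thetaHat t = θ) ∧
            ((∃ t : ℝ, 0 ≤ t ∧ z.U t ≠ 0) → ∀ t : ℝ, z.τ 2 ≤ t → z.cHat t = c) := by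
  -- The factors with `1 + a` bound the growth over the first two phases, the remaining `R θ` is the
  -- nominal overshoot afterwards, and `exp(2ωT)` makes up for the time before the second event, at
  -- most `2T`. Neither `c` nor its initial estimate enters.
  refine ⟨fun θ θ₀ _ _ => R θ * (R θ * (1 + a)) * (R θ₀ * (1 + a)) * Real.exp (ω θ * (2 * T)),
    fun θ c θ₀ c₀ hc hc₀ => ⟨?_, fun u₀ => ?_⟩⟩
  · have h1 : 0 < R θ := (hK θ).2.1
    have h2 : 0 < R θ₀ := (hK θ₀).2.1
    positivity
  · obtain ⟨z, hz, hτ, hdecay, hθ, hcHat⟩ :=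
      AdaptiveHeat.exists_closedLoop hp hK hT ha hN θ θ₀ hc hc₀ u₀
    exact ⟨z, hz, fun z' hz' => hz.same hz' hT
      (fun ϑ => by nlinarith [hK.one_le ϑ]) hτ, hτ, hdecay, hθ, hcHat⟩
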